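/- **Linearisation of non-local continuity equations.** *Notation.* Fix $d\in\mathbb N$, $T>0$, $p\in[1,+\infty)$. $\mathcal P_c(\mathbb R^d)$ is the set of compactly supported Borel probability measures on $\mathbb R^d$, with the Wasserstein distance $W_p$; $\mathcal P(B)$ denotes those carried by $B$; $B(x,R)$ is the closed ball; $\mathcal M_1(\mu)=\int|x|\,d\mu$; $\Gamma_o(\mu,\nu)$ is the set of optimal plans for the quadratic cost. A map $\phi:\mathcal P_c(\mathbb R^d)\to\mathbb R$ is locally differentiable at $\mu$ with Wasserstein gradient $\nabla\phi(\mu)=\xi$ if $\xi$ belongs to the closure in $L^2(\mu)$ of $\{\nabla\zeta:\zeta\in C^\infty_c(\mathbb R^d)\}$ and, for both pairs $(\phi,\xi)$ and $(-\phi,-\xi)$ in place of $(\psi,\eta)$ and for every $R>0$, $$\psi(\nu)-\psi(\mu)\ \ge\ \inf_{\gamma\in\Gamma_o(\mu,\nu)}\int\langle\eta(x),y-x\rangle\,d\gamma(x,y)+o_R(W_2(\mu,\nu))\qquad\text{for all }\nu\in\mathcal P\Big(\bigcup_{x\in\operatorname{supp}\mu}B(x,R)\Big).$$ For $\phi$ with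 values in $\mathbb R^d$, $D_\mu\phi(\mu)(y)$ is the matrix whose rows are $\nabla\phi_i(\mu)(y)$. Continuity equations $\partial_t\mu(t)+\operatorname{div}(v(t,\mu(t))\mu(t))=0$ are meant in the sense of distributions on $(0,T)\times\mathbb R^d$, and their solutions are curves in $AC([0,T],\mathcal P_c(\mathbb R^d))$ with respect to $W_p$. *Hypotheses.* Let $v:[0,T]\times\mathcal P_c(\mathbb R^d)\times\mathbb R^d\to\mathbb R^d$ satisfy (H): 1. $t\mapsto v(t,\mu,x)$ is Lebesgue measurable for all $(\mu,x)$; there is $m\in L^1([0,T],\mathbb R_+)$ with $|v(t,\mu,x)|\le m(t)(1+|x|+\mathcal M_1(\mu))$ for a.e. $t$ and all $(\mu,x)$; and for every $R>0$, with $K=B(0,R)$, there are $l_K,L_K\in L^1([0,T],\mathbb R_+)$ such that for a.e. $t$, all $\mu,\nu\in\mathcal P(K)$ and $x,y\in K$, $|v(t,\mu,x)-v(t,\mu,y)|\le l_K(t)|x-y|$ and $|v(t,\mu,x)-v(t,\nu,x)|\le L_K(t)W_p(\mu,\nu)$. 2. For a.e. $t$ and all $\mu$, $x\mapsto v(t,\mu,x)$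 is Fréchet differentiable, and for every $R>0$ and a.e. $t$ the map $(\mu,x)\mapsto D_xv(t,\mu,x)$ is continuous on $\mathcal P(K)\times K$, $K=B(0,R)$. 3. For a.e. $t$ and all $x$, $\mu\mapsto v(t,\mu,x)$ is (componentwise) locally differentiable on $\mathcal P_c(\mathbb R^d)$, and for every $R>0$ and a.e. $t$ the map $(\mu,x,y)\mapsto D_\mu v(t,\mu,x)(y)$ is continuous on $\mathcal P(K)\times K\times K$, $K=B(0,R)$. Let $\mu^0\in\mathcal P_c(\mathbb R^d)$, let $\mu(\cdot)$ be the solution of $\partial_t\mu(t)+\operatorname{div}(v(t,\mu(t))\mu(t))=0$, $\mu(0)=\mu^0$, and let $K=B(0,R)$ be a ball with $\mu(t)\in\mathcal P(K)$ for all $t\in[0,T]$. Let $\mathcal F^0\in C^0(\mathbb R^d,\mathbb R^d)$, and let $w:[0,T]\times\mathbb R^d\to\mathbb R^d$ be measurable in $t$ for each $x$, continuous in $x$ for a.e. $t$, with $|w(t,x)|\le m'(t)(1+|x|)$ for a.e. $t$ and all $x$, for some $m'\in L^1([0,T],\mathbb R_+)$, and Lipschitz in $x$ on each ball $B(0,R')$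 for a.e. $t$, with a Lipschitz constant in $L^1([0,T],\mathbb R_+)$ that may depend on $R'$. *Conclusion.* (a) There is a unique family of flows $\Phi_{(s,t)}$, $s,t\in[0,T]$, on $\mathbb R^d$ with $\Phi_{(s,t)}(x)=x+\int_s^t v(\sigma,\mu(\sigma),\Phi_{(s,\sigma)}(x))\,d\sigma$. (b) There is a solution $\mathcal F\in C^0([0,T]\times\mathbb R^d,\mathbb R^d)$ of the linearised non-local Cauchy problem (in integral form in time) $$\partial_t\mathcal F(t,x)=D_xv\big(t,\mu(t),\Phi_{(0,t)}(x)\big)\mathcal F(t,x)+w\big(t,\Phi_{(0,t)}(x)\big)+\int D_\mu v\big(t,\mu(t),\Phi_{(0,t)}(x)\big)\big(\Phi_{(0,t)}(y)\big)\mathcal F(t,y)\,d\mu^0(y),\qquad \mathcal F(0,x)=\mathcal F^0(x).$$ It is unique on $\mathbb R^d$, and also on every smaller set $S\supseteq K$: any solution in $C^0([0,T]\times S,\mathbb R^d)$ coincides with $\mathcal F$ on $[0,T]\times S$. (c) There are maps $\mathcal G_\epsilon\in C^0([0,T]\times K,\mathbb R^d)$, $\epsilon\in[-1,1]$, such that for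 every $\epsilon\in[-1,1]$ the perturbed problem $$\partial_t\mu_\epsilon(t)+\operatorname{div}\big((v(t,\mu_\epsilon(t))+\epsilon w(t))\mu_\epsilon(t)\big)=0,\qquad \mu_\epsilon(0)=(\mathrm{Id}+\epsilon\mathcal F^0)_\#\mu^0$$ has a unique solution $\mu_\epsilon(\cdot)\in AC([0,T],\mathcal P_c(\mathbb R^d))$, and $\mu_\epsilon(t)=\mathcal G_\epsilon(t,\cdot)_\#\mu(t)$ for all $t\in[0,T]$. Moreover $$\sup_{(t,x)\in[0,T]\times K}\big|\mathcal G_\epsilon(t,x)-x-\epsilon\,\mathcal F\big(t,\Phi_{(t,0)}(x)\big)\big|=o(\epsilon)\qquad\text{as }\epsilon\to0.$$ -/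

import Mathlib

open MeasureTheory Set

namespace WassLin

/-- The space `ℝ^d` with its Euclidean structure. -/
abbrev E (d : ℕ) : Type := EuclideanSpace ℝ (Fin d)

/-- `𝒫_c(ℝ^d)`: compactly supported Borel probability measures on `ℝ^d`. -/
def Pc (d : ℕ) : Type :=
  {μ : Measure (E d) // IsProbabilityMeasure μ ∧ ∃ R : ℝ, μ (Metric.closedBall 0 R)ᶜ = 0}

/-- The underlying measure of an element of `𝒫_c(ℝ^d)`. -/
def Pc.meas {d : ℕ} (μ : Pc d) : Measure (E d) := μ.1

/-- `μ ∈ 𝒫(B(0,R))`. -/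
def Pc.InBall {d : ℕ} (μ : Pc d) (R : ℝ) : Prop := μ.meas (Metric.closedBall 0 R)ᶜ = 0

/-- The first moment `∫ |x| dμ(x)`. -/
noncomputable def Pc.moment1 {d : ℕ} (μ : Pc d) : ℝ := ∫ x, ‖x‖ ∂μ.meas

/-- The transport plans between two measures. -/
def plans {d : ℕ} (μ ν : Pc d) : Set (Measure (E d × E d)) :=
  {γ | γ.map Prod.fst = μ.meas ∧ γ.map Prod.snd = ν.meas}

/-- The transport cost `∫ |x - y|^p dγ(x,y)`. -/
noncomputable def cost {d : ℕ} (p : ℝ) (γ : Measure (E d × E d)) : ENNReal :=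
  ∫⁻ z, ‖z.1 - z.2‖ₑ ^ p ∂γ

/-- The Wasserstein distance of order `p`. -/
noncomputable def wass {d : ℕ} (p : ℝ) (μ ν : Pc d) : ℝ :=
  ((⨅ γ ∈ plans μ ν, cost p γ) ^ (1 / p)).toReal

/-- The plans which are optimal for the quadratic cost. -/
def optPlans {d : ℕ} (μ ν : Pc d) : Set (Measure (E d × E d)) :=
  {γ | γ ∈ plans μ ν ∧ ∀ γ' ∈ plans μ ν, cost 2 γ ≤ cost 2 γ'}

/-- The `R`-fattening of the support of `μ`. -/
def fattening {d : ℕ} (μ : Pc d) (R : ℝ) : Set (E d) :=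
  ⋃ x ∈ μ.meas.support, Metric.closedBall x R

/-- `ξ` belongs to the localised subdifferential of `φ` at `μ`: for every `R > 0`,
`φ(ν) - φ(μ) ≥ inf_{γ ∈ Γ_o(μ,ν)} ∫ ⟨ξ(x), y - x⟩ dγ(x,y) + o_R(W_2(μ,ν))`
for all `ν` carried by the `R`-fattening of the support of `μ`. -/
def IsLocSubgradient {d : ℕ} (φ : Pc d → ℝ) (μ : Pc d) (ξ : E d → E d) : Prop :=
  MemLp ξ 2 μ.meas ∧
  ∀ R > 0, ∀ δ > 0, ∃ η > 0, ∀ ν : Pc d, ν.meas (fattening μ R)ᶜ = 0 → wass 2 μ ν < η →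
    (⨅ γ ∈ optPlans μ ν, ((∫ z, inner ℝ (ξ z.1) (z.2 - z.1) ∂γ : ℝ) : EReal))
      ≤ ((φ ν - φ μ + δ * wass 2 μ ν : ℝ) : EReal)

/-- `ξ` belongs to the localised superdifferential of `φ` at `μ`. -/
def IsLocSupergradient {d : ℕ} (φ : Pc d → ℝ) (μ : Pc d) (ξ : E d → E d) : Prop :=
  IsLocSubgradient (fun ν => -φ ν) μ (fun x => -ξ x)

/-- `ξ` belongs to the analytical tangent space at `μ`, the closure in `L²(μ)` of the gradients of
smooth compactly supported functions. -/
def InTangent {d : ℕ} (μ : Pc d) (ξ : E d → E d) : Prop :=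
  MemLp ξ 2 μ.meas ∧
  ∀ ε > 0, ∃ ζ : E d → ℝ, ContDiff ℝ (⊤ : ℕ∞) ζ ∧ HasCompactSupport ζ ∧
    eLpNorm (fun x => ξ x - gradient ζ x) 2 μ.meas < ENNReal.ofReal ε

/-- `ξ` is the Wasserstein gradient of `φ` at `μ`, i.e. the element of the tangent space that is both
a localised sub- and supergradient (it is unique up to `μ`-null sets). -/
def IsWassGradient {d : ℕ} (φ : Pc d → ℝ) (μ : Pc d) (ξ : E d → E d) : Prop :=
  InTangent μ ξ ∧ IsLocSubgradient φ μ ξ ∧ IsLocSupergradient φ μ ξ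

/-- `y ↦ D y` is the Wasserstein differential at `μ` of a vector-valued map `φ`: the rows of the
matrix `D y` are the values at `y` of the Wasserstein gradients of the components of `φ`. -/
def IsWassDifferential {d : ℕ} (φ : Pc d → E d) (μ : Pc d) (D : E d → E d →L[ℝ] E d) : Prop :=
  ∀ i : Fin d, IsWassGradient (fun ν => φ ν i) μ
    (fun y => ContinuousLinearMap.adjoint (D y) (EuclideanSpace.single i 1))

/-- Continuity of `f` on `𝒫(B(0,R)) × S`, where `𝒫(B(0,R))` carries the distance `W_p`. -/
def WContinuousOn {d : ℕ} {X Y : Type} [PseudoMetricSpace X] [PseudoMetricSpace Y] (p R : ℝ)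
    (S : Set X) (f : Pc d → X → Y) : Prop :=
  ∀ μ : Pc d, μ.InBall R → ∀ x ∈ S, ∀ ε > 0, ∃ δ > 0, ∀ ν : Pc d, ν.InBall R → ∀ y ∈ S,
    wass p μ ν < δ → dist x y < δ → dist (f μ x) (f ν y) < ε

/-- `m ∈ L¹([0,T], ℝ₊)`. -/
def L1Nonneg (T : ℝ) (m : ℝ → ℝ) : Prop := (∀ t, 0 ≤ m t) ∧ IntegrableOn m (Icc 0 T)

/-- Lebesgue measure on `[0,T]`. -/
noncomputable def leb (T : ℝ) : Measure ℝ := volume.restrict (Icc 0 T)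

/-- Hypotheses (CE) for a non-local velocity field. -/
structure HypCE {d : ℕ} (p T : ℝ) (v : ℝ → Pc d → E d → E d) : Prop where
  measurable : ∀ μ x, AEStronglyMeasurable (fun t => v t μ x) (leb T)
  sublinear : ∃ m, L1Nonneg T m ∧
    ∀ᵐ t ∂leb T, ∀ μ x, ‖v t μ x‖ ≤ m t * (1 + ‖x‖ + μ.moment1)
  lipschitz : ∀ R > 0, ∃ l L, L1Nonneg T l ∧ L1Nonneg T L ∧ ∀ᵐ t ∂leb T,
    ∀ μ ν : Pc d, μ.InBall R → ν.InBall R →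
      ∀ x ∈ Metric.closedBall (0 : E d) R, ∀ y ∈ Metric.closedBall (0 : E d) R,
        ‖v t μ x - v t μ y‖ ≤ l t * ‖x - y‖ ∧ ‖v t μ x - v t ν x‖ ≤ L t * wass p μ ν

/-- Hypotheses (CE) for a Carathéodory vector field that does not depend on the measure. -/
structure HypCELocal {d : ℕ} (T : ℝ) (w : ℝ → E d → E d) : Prop where
  measurable : ∀ x, AEStronglyMeasurable (fun t => w t x) (leb T)
  continuous : ∀ᵐ t ∂leb T, Continuous (w t)
  sublinear : ∃ m, L1Nonneg T m ∧ ∀ᵐ t ∂leb T, ∀ x, ‖w t x‖ ≤ m t * (1 + ‖x‖)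
  lipschitz : ∀ R > 0, ∃ l, L1Nonneg T l ∧ ∀ᵐ t ∂leb T,
    ∀ x ∈ Metric.closedBall (0 : E d) R, ∀ y ∈ Metric.closedBall (0 : E d) R,
      ‖w t x - w t y‖ ≤ l t * ‖x - y‖

/-- Hypotheses (H) for a non-local velocity field `v` whose Wasserstein differential in the measure
variable is `(t, μ, x, y) ↦ Dμ t μ x y`. -/
structure HypH {d : ℕ} (p T : ℝ) (v : ℝ → Pc d → E d → E d)
    (Dμ : ℝ → Pc d → E d → E d → E d →L[ℝ] E d) : Prop where
  ce : HypCE p T v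
  diff_x : ∀ᵐ t ∂leb T, ∀ μ, Differentiable ℝ (v t μ)
  cont_x : ∀ R > 0, ∀ᵐ t ∂leb T,
    WContinuousOn p R (Metric.closedBall (0 : E d) R) (fun μ x => fderiv ℝ (v t μ) x)
  diff_μ : ∀ᵐ t ∂leb T, ∀ μ x, IsWassDifferential (fun ν => v t ν x) μ (Dμ t μ x)
  cont_μ : ∀ R > 0, ∀ᵐ t ∂leb T,
    WContinuousOn p R (Metric.closedBall (0 : E d) R ×ˢ Metric.closedBall (0 : E d) R)
      (fun μ z => Dμ t μ z.1 z.2)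

/-- `μ(·) ∈ AC([0,T], 𝒫_c(ℝ^d))`, for the distance `W_p`. -/
def IsACCurve {d : ℕ} (p T : ℝ) (μ : ℝ → Pc d) : Prop :=
  ∃ m, L1Nonneg T m ∧
    ∀ s t, 0 ≤ s → s ≤ t → t ≤ T → wass p (μ s) (μ t) ≤ ∫ τ in s..t, m τ

/-- `∂ₜ μ(t) + div(v(t,μ(t)) μ(t)) = 0` on `(0,T) × ℝ^d` in the sense of distributions. -/
def SolvesNonlocalCE {d : ℕ} (T : ℝ) (v : ℝ → Pc d → E d → E d) (μ : ℝ → Pc d) : Prop :=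
  ∀ ξ : ℝ × E d → ℝ, ContDiff ℝ (⊤ : ℕ∞) ξ → HasCompactSupport ξ →
    tsupport ξ ⊆ Ioo 0 T ×ˢ univ →
    IntervalIntegrable (fun t => ∫ x, (deriv (fun s => ξ (s, x)) t
      + inner ℝ (gradient (fun y => ξ (t, y)) x) (v t (μ t) x)) ∂(μ t).meas) volume 0 T ∧
    ∫ t in (0 : ℝ)..T, (∫ x, (deriv (fun s => ξ (s, x)) t
      + inner ℝ (gradient (fun y => ξ (t, y)) x) (v t (μ t) x)) ∂(μ t).meas) = 0

/-- `μ(·) ∈ AC([0,T], 𝒫_c(ℝ^d))` solves the Cauchy problem for the non-local continuity equation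
driven by `v`, with initial datum `μ₀`. -/
structure IsSolution {d : ℕ} (p T : ℝ) (v : ℝ → Pc d → E d → E d) (μ₀ : Measure (E d))
    (μ : ℝ → Pc d) : Prop where
  ac : IsACCurve p T μ
  eqn : SolvesNonlocalCE T v μ
  init : (μ 0).meas = μ₀

/-- `Φ s t x = Φ_{(s,t)}[μ(s)](x)` is the family of non-local flows along the curve `μ(·)`. -/
def IsNonlocalFlow {d : ℕ} (T : ℝ) (v : ℝ → Pc d → E d → E d) (μ : ℝ → Pc d)
    (Φ : ℝ → ℝ → E d → E d) : Prop :=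
  ∀ s ∈ Icc 0 T, ∀ t ∈ Icc 0 T, ∀ x,
    IntervalIntegrable (fun σ => v σ (μ σ) (Φ s σ x)) volume s t ∧
    Φ s t x = x + ∫ σ in s..t, v σ (μ σ) (Φ s σ x)

/-- The right-hand side of the linearised non-local Cauchy problem. -/
noncomputable def linRHS {d : ℕ} (v : ℝ → Pc d → E d → E d)
    (Dμ : ℝ → Pc d → E d → E d → E d →L[ℝ] E d) (w : ℝ → E d → E d) (μ : ℝ → Pc d)
    (Φ : ℝ → ℝ → E d → E d) (F : ℝ → E d → E d) (t : ℝ) (x : E d) : E d :=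
  fderiv ℝ (v t (μ t)) (Φ 0 t x) (F t x) + w t (Φ 0 t x)
    + ∫ y, Dμ t (μ t) (Φ 0 t x) (Φ 0 t y) (F t y) ∂(μ 0).meas

/-- `F ∈ C⁰([0,T] × S, ℝ^d)` solves the linearised non-local Cauchy problem on `S` with initial datum
`F₀`; the derivative in time is meant in the Carathéodory (integral) sense. -/
structure IsLinSolution {d : ℕ} (T : ℝ) (v : ℝ → Pc d → E d → E d)
    (Dμ : ℝ → Pc d → E d → E d → E d →L[ℝ] E d) (w : ℝ → E d → E d) (μ : ℝ → Pc d)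
    (Φ : ℝ → ℝ → E d → E d) (F₀ : E d → E d) (S : Set (E d)) (F : ℝ → E d → E d) : Prop where
  cont : ContinuousOn (fun z : ℝ × E d => F z.1 z.2) (Icc 0 T ×ˢ S)
  integrable : ∀ x ∈ S, IntervalIntegrable (fun s => linRHS v Dμ w μ Φ F s x) volume 0 T
  eqn : ∀ t ∈ Icc 0 T, ∀ x ∈ S, F t x = F₀ x + ∫ s in (0 : ℝ)..t, linRHS v Dμ w μ Φ F s x

end WassLin

section

open scoped Topology
open Filter TopologicalSpace

set_option linter.unusedSectionVars false

namespace WassLin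

/-! ### Integrable kernels on an interval, Gronwall's inequality, diagonal measurability. -/

section RealLine

variable {B : Type*} [NormedAddCommGroup B] [NormedSpace ℝ B] {T : ℝ}

/-! The proof is Lagrangian: it moves the problem from measures to maps. On the Banach space of
continuous maps X from a closed ball of radius ρ to ℝ^d, extended to ℝ^d by radial retraction, the
velocity lifts to the field X ↦ v(t, X_#μ⁰, X(·)) (`liftField`). Since W_p(X_#μ⁰, Y_#μ⁰) ≤ ‖X - Y‖
in the sup norm, the lifted field has integrable sublinear growth and integrable Lipschitz constants
on balls (`HypCE.caraField_lift`). Carathéodory's theory, proved in an arbitrary Banach space, then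
applies: existence by a Picard contraction in a weighted norm, uniqueness and stability by Gronwall.

The lifted equation is equivalent to the continuity equation. If X solves it, the chain rule shows
that X(t)_#μ⁰ is a distributional solution (`IsCaraSol.isSolution`). Conversely, let ν be any
absolutely continuous solution. A logarithmic Lyapunov function keeps ν in a fixed ball
(`SolvesNonlocalCE.exists_inBall`). Freezing ν in the velocity gives a local field, and ν is
transported by its characteristics (`IsWeakSol.integral_eq`): a Lipschitz function propagated
backwards along the flow, and mollified, has an almost constant integral against ν. So ν(t) =
Y(t)_#μ⁰ for the frozen flow Y; then Y solves the lifted equation, whose solution is unique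
(`IsSolution.eq_push`).

The lifted field is differentiable in each direction. For an element ξ of the tangent space, ∫⟨ξ(x),
y - x⟩dγ depends on the plan γ, up to small errors, only through its marginals, because ξ is nearly
a gradient ∇ζ and ∫⟨∇ζ(x), y - x⟩dγ = ∫ζ dν - ∫ζ dμ + O(cost). The optimal plans in the definition
of the Wasserstein gradient may therefore be replaced by the plan (f, g)_#ρ induced by any two close
maps (`IsWassGradient.expansion`). With the continuity of D_x v and D_μ v, the mean value inequality
gives a derivative in the sup norm (`DiffField.uniform_estimate`), and it is the linear part of the
right-hand side of the linearised problem.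

What remains is first-order dependence of an ODE on its data (`CaraField.first_order`): the
linearisation error along the reference curve is o(ε) in the mean in time by dominated convergence,
and Gronwall propagates it. If X_ε is the perturbed Lagrangian solution, 𝒢_ε(t, x) =
X_ε(t)(Φ_{(t,0)}(x)). Since μ⁰ is carried by K, the integral term of the linearised problem only
sees values on K. This gives uniqueness on every S ⊇ K, and lets solutions on growing balls be glued
into one on ℝ^d.

A recurring device, `le_of_increment_le_sq`, replaces differentiation in time: if the increments of
h are bounded above by C times the squared increments of a continuous monotone function, then h does
not increase. -/

lemma intervalIntegrable_of_mem_Icc {f : ℝ → B} (hf : IntegrableOn f (Icc 0 T)) {s t : ℝ}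
    (hs : s ∈ Icc 0 T) (ht : t ∈ Icc 0 T) : IntervalIntegrable f volume s t :=
  (hf.mono_set ((convex_Icc (0 : ℝ) T).ordConnected.uIcc_subset hs ht)).intervalIntegrable

lemma ae_restrict_uIoc_of_ae_leb {P : ℝ → Prop} (h : ∀ᵐ t ∂leb T, P t) {s t : ℝ}
    (hs : s ∈ Icc 0 T) (ht : t ∈ Icc 0 T) : ∀ᵐ τ ∂volume.restrict (uIoc s t), P τ :=
  ae_mono (Measure.restrict_mono (uIoc_subset_uIcc.trans
    ((convex_Icc (0 : ℝ) T).ordConnected.uIcc_subset hs ht)) le_rfl) h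

lemma ae_leb_mem : ∀ᵐ t ∂leb T, t ∈ Icc 0 T := ae_restrict_mem measurableSet_Icc

lemma continuousOn_primitive_Icc {f : ℝ → B} (hf : IntegrableOn f (Icc 0 T)) {s : ℝ}
    (hs : s ∈ Icc 0 T) : ContinuousOn (fun t => ∫ τ in s..t, f τ) (Icc 0 T) := by
  have h0 : (0 : ℝ) ≤ T := hs.1.trans hs.2
  have := intervalIntegral.continuousOn_primitive_interval' (a := s) (μ := volume)
    (intervalIntegrable_of_mem_Icc hf (left_mem_Icc.2 h0) (right_mem_Icc.2 h0))
    (by rwa [uIcc_of_le h0])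
  rwa [uIcc_of_le h0] at this

lemma integral_sub_integral {f : ℝ → B} (hf : IntegrableOn f (Icc 0 T)) {r s t : ℝ}
    (hr : r ∈ Icc 0 T) (hs : s ∈ Icc 0 T) (ht : t ∈ Icc 0 T) :
    (∫ τ in r..t, f τ) - ∫ τ in r..s, f τ = ∫ τ in s..t, f τ :=
  intervalIntegral.integral_interval_sub_left (intervalIntegrable_of_mem_Icc hf hr ht)
    (intervalIntegrable_of_mem_Icc hf hr hs)

lemma norm_integral_le_of_ae_leb {f : ℝ → B} {g : ℝ → ℝ} (hg : IntegrableOn g (Icc 0 T))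
    (h : ∀ᵐ t ∂leb T, ‖f t‖ ≤ g t) {s t : ℝ} (hs : s ∈ Icc 0 T) (ht : t ∈ Icc 0 T) :
    ‖∫ τ in s..t, f τ‖ ≤ |∫ τ in s..t, g τ| :=
  intervalIntegral.norm_integral_le_abs_of_norm_le (ae_restrict_uIoc_of_ae_leb h hs ht)
    (intervalIntegrable_of_mem_Icc hg hs ht)

lemma norm_integral_le_of_ae_leb_of_le {f : ℝ → B} {g : ℝ → ℝ} (hg : IntegrableOn g (Icc 0 T))
    (h : ∀ᵐ t ∂leb T, ‖f t‖ ≤ g t) {s t : ℝ} (hs : s ∈ Icc 0 T) (ht : t ∈ Icc 0 T) (hst : s ≤ t) :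
    ‖∫ τ in s..t, f τ‖ ≤ ∫ τ in s..t, g τ :=
  intervalIntegral.norm_integral_le_of_norm_le hst
    ((ae_restrict_iff' measurableSet_Ioc).1
      (by simpa [uIoc_of_le hst] using ae_restrict_uIoc_of_ae_leb h hs ht))
    (intervalIntegrable_of_mem_Icc hg hs ht)

namespace L1Nonneg

variable {l l' : ℝ → ℝ}

lemma integral_nonneg (hl : L1Nonneg T l) {s t : ℝ} (hst : s ≤ t) : 0 ≤ ∫ τ in s..t, l τ :=
  intervalIntegral.integral_nonneg hst fun _ _ => hl.1 _

lemma add (hl : L1Nonneg T l) (hl' : L1Nonneg T l') : L1Nonneg T (fun t => l t + l' t) :=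
  ⟨fun t => add_nonneg (hl.1 t) (hl'.1 t), Integrable.add hl.2 hl'.2⟩

lemma const_mul (hl : L1Nonneg T l) {c : ℝ} (hc : 0 ≤ c) : L1Nonneg T (fun t => c * l t) :=
  ⟨fun t => mul_nonneg hc (hl.1 t), Integrable.const_mul hl.2 c⟩

lemma const {c : ℝ} (hc : 0 ≤ c) : L1Nonneg T (fun _ => c) :=
  ⟨fun _ => hc, by simp [IntegrableOn]⟩

lemma monotoneOn (hl : L1Nonneg T l) : MonotoneOn (fun t => ∫ τ in (0 : ℝ)..t, l τ) (Icc 0 T) := by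
  intro s hs t ht hst
  have h0 : (0 : ℝ) ∈ Icc 0 T := ⟨le_rfl, hs.1.trans hs.2⟩
  have := integral_sub_integral hl.2 h0 hs ht
  have := hl.integral_nonneg hst
  simp only; linarith

lemma integral_le_total (hl : L1Nonneg T l) {s t : ℝ} (hs : s ∈ Icc 0 T) (ht : t ∈ Icc 0 T) :
    |∫ τ in s..t, l τ| ≤ ∫ τ in (0 : ℝ)..T, l τ := by
  have h0 : (0 : ℝ) ≤ T := hs.1.trans hs.2
  have m0 : (0 : ℝ) ∈ Icc 0 T := left_mem_Icc.2 h0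
  have mT : T ∈ Icc 0 T := right_mem_Icc.2 h0
  rw [← integral_sub_integral hl.2 m0 hs ht, abs_le]
  have a1 := hl.integral_nonneg hs.1
  have a2 := hl.integral_nonneg ht.1
  have a3 := hl.monotoneOn hs mT hs.2
  have a4 := hl.monotoneOn ht mT ht.2
  simp only at a3 a4
  constructor <;> linarith

end L1Nonneg

/-- A function whose increments are controlled from above by the squares of the increments of a
continuous monotone function is nonincreasing. -/
lemma le_of_increment_le_sq {h K : ℝ → ℝ} {C a b : ℝ} (hab : a ≤ b)
    (hKm : MonotoneOn K (Icc a b)) (hKc : ContinuousOn K (Icc a b)) (hC : 0 ≤ C)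
    (H : ∀ s t, a ≤ s → s ≤ t → t ≤ b → h t - h s ≤ C * (K t - K s) ^ 2) : h b ≤ h a := by
  have uc := isCompact_Icc.uniformContinuousOn_of_continuous hKc
  rw [Metric.uniformContinuousOn_iff] at uc
  -- Uniform continuity of K gives a uniform partition on which every increment of K is below η. One
  -- factor of each square is spent on η; the other telescopes.
  have key : ∀ η > 0, h b - h a ≤ η * (C * (K b - K a)) := by
    intro η hη
    obtain ⟨δ, hδ, hd⟩ := uc η hη
    obtain ⟨n, hn⟩ := exists_nat_gt ((b - a) / δ)
    have hn0 : (0 : ℝ) < n := lt_of_le_of_lt (div_nonneg (by linarith) hδ.le) hn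
    set x : ℕ → ℝ := fun i => a + i * ((b - a) / n) with hx
    have hstep : 0 ≤ (b - a) / n := div_nonneg (by linarith) hn0.le
    have hxm : ∀ i, i ≤ n → x i ∈ Icc a b := by
      intro i hi
      have hi' : (i : ℝ) ≤ n := by exact_mod_cast hi
      refine ⟨by simp only [hx]; nlinarith [mul_nonneg (Nat.cast_nonneg (α := ℝ) i) hstep], ?_⟩
      have : (i : ℝ) * ((b - a) / n) ≤ n * ((b - a) / n) := by gcongr
      have h2 : (n : ℝ) * ((b - a) / n) = b - a := by field_simp
      simp only [hx]; linarith
    have hxs : ∀ i, x i ≤ x (i + 1) := by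
      intro i; simp only [hx]; push_cast; nlinarith
    have hinc : ∀ i ∈ Finset.range n, h (x (i + 1)) - h (x i)
        ≤ η * C * (K (x (i + 1)) - K (x i)) := by
      intro i hi
      have hi := Finset.mem_range.1 hi
      have h1 := hxm i hi.le
      have h2 := hxm (i + 1) hi
      refine (H _ _ h1.1 (hxs i) h2.2).trans ?_
      have h3 : K (x i) ≤ K (x (i + 1)) := hKm h1 h2 (hxs i)
      have h4 : dist (K (x (i + 1))) (K (x i)) < η := by
        refine hd _ h2 _ h1 ?_
        have : x (i + 1) - x i = (b - a) / n := by simp only [hx]; push_cast; ring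
        rw [Real.dist_eq, this, abs_of_nonneg hstep, div_lt_iff₀ hn0, mul_comm]
        rwa [div_lt_iff₀ hδ] at hn
      rw [Real.dist_eq, abs_of_nonneg (by linarith)] at h4
      have : C * (K (x (i + 1)) - K (x i)) * (K (x (i + 1)) - K (x i))
          ≤ C * (K (x (i + 1)) - K (x i)) * η :=
        mul_le_mul_of_nonneg_left h4.le (mul_nonneg hC (by linarith))
      nlinarith
    have hsum := Finset.sum_le_sum hinc
    rw [Finset.sum_range_sub (fun i => h (x i)), ← Finset.mul_sum,
      Finset.sum_range_sub (fun i => K (x i))] at hsum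
    have hxn : x n = b := by simp only [hx]; field_simp; ring
    have hx0 : x 0 = a := by simp [hx]
    rw [hxn, hx0] at hsum
    linarith
  by_contra hlt
  push Not at hlt
  have hM : 0 ≤ C * (K b - K a) :=
    mul_nonneg hC (by linarith [hKm (left_mem_Icc.2 hab) (right_mem_Icc.2 hab) hab])
  have := key ((h b - h a) / (2 * (C * (K b - K a) + 1))) (div_pos (by linarith) (by linarith))
  have h2 : (h b - h a) / (2 * (C * (K b - K a) + 1)) * (C * (K b - K a)) ≤ (h b - h a) / 2 := by
    rw [div_mul_eq_mul_div, div_le_div_iff₀ (by linarith) (by norm_num)]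
    nlinarith
  linarith

/-- Weighted integral estimate behind Gronwall's inequality and the Picard contraction. -/
lemma abs_integral_mul_exp_le {l : ℝ → ℝ} (hl : L1Nonneg T l) {r t : ℝ}
    (hr : r ∈ Icc 0 T) (ht : t ∈ Icc 0 T) :
    |∫ τ in r..t, l τ * Real.exp (2 * |∫ σ in r..τ, l σ|)|
      ≤ (Real.exp (2 * |∫ σ in r..t, l σ|) - 1) / 2 := by
  set P : ℝ → ℝ := fun t => ∫ σ in r..t, l σ with hP
  have hPc : ContinuousOn P (Icc 0 T) := continuousOn_primitive_Icc hl.2 hr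
  have hPd : ∀ s ∈ Icc 0 T, ∀ t ∈ Icc 0 T, P t - P s = ∫ τ in s..t, l τ :=
    fun s hs t ht => integral_sub_integral hl.2 hr hs ht
  have hPm : MonotoneOn P (Icc 0 T) := by
    intro s hs t ht hst
    have := hPd s hs t ht
    have := hl.integral_nonneg hst
    linarith
  have hPr : P r = 0 := by simp [hP]
  set φ : ℝ → ℝ := fun τ => l τ * Real.exp (2 * |P τ|) with hφ
  have hφi : IntegrableOn φ (Icc 0 T) :=
    IntegrableOn.mul_continuousOn hl.2 (by fun_prop) isCompact_Icc
  have hφ0 : ∀ τ, 0 ≤ φ τ := fun τ => mul_nonneg (hl.1 τ) (Real.exp_pos _).le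
  obtain ⟨C, hC⟩ : ∃ C, ∀ t ∈ Icc 0 T, Real.exp (2 * |P t|) ≤ C :=
    ⟨_, fun t ht => Real.exp_le_exp.2 (mul_le_mul_of_nonneg_left (hl.integral_le_total hr ht) two_pos.le)⟩
  have hC0 : 0 ≤ C := (Real.exp_pos _).le.trans (hC t ht)
  -- Formally exp(2P)/2 is a primitive of l·exp(2P), but P is only absolutely continuous. The
  -- identity is therefore checked on increments, up to second order in the increment of P. The
  -- numbers x and y stand for |P| at the endpoints nearer to and farther from r, so that one
  -- estimate serves both sides of r.
  have inc : ∀ s ∈ Icc 0 T, ∀ t ∈ Icc 0 T, s ≤ t → ∀ x y : ℝ, y - x = P t - P s →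
      (∀ τ ∈ Icc s t, |P τ| ≤ y) → Real.exp (2 * y) ≤ C →
      (∫ τ in s..t, φ τ) - (Real.exp (2 * y) - Real.exp (2 * x)) / 2 ≤ 2 * C * (P t - P s) ^ 2 := by
    intro s hs t ht hst x y hyx hy hyC
    have hΔ : 0 ≤ P t - P s := by linarith [hPm hs ht hst]
    have h1 : ∫ τ in s..t, φ τ ≤ ∫ τ in s..t, l τ * Real.exp (2 * y) :=
      intervalIntegral.integral_mono_on hst (intervalIntegrable_of_mem_Icc hφi hs ht)
        ((intervalIntegrable_of_mem_Icc hl.2 hs ht).mul_const _)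
        (fun τ hτ => mul_le_mul_of_nonneg_left
          (Real.exp_le_exp.2 (mul_le_mul_of_nonneg_left (hy τ hτ) two_pos.le)) (hl.1 τ))
    rw [intervalIntegral.integral_mul_const, ← hPd s hs t ht] at h1
    have h2 : Real.exp (2 * x) * (2 * (y - x) + 1) ≤ Real.exp (2 * y) := by
      have := Real.add_one_le_exp (2 * (y - x))
      calc _ ≤ Real.exp (2 * x) * Real.exp (2 * (y - x)) := by gcongr
        _ = _ := by rw [← Real.exp_add]; ring_nf
    have h3 : Real.exp (2 * y) * (1 - 2 * (y - x)) ≤ Real.exp (2 * x) := by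
      have := Real.add_one_le_exp (-(2 * (y - x)))
      calc _ ≤ Real.exp (2 * y) * Real.exp (-(2 * (y - x))) := by gcongr; linarith
        _ = _ := by rw [← Real.exp_add]; ring_nf
    rw [hyx] at h2 h3
    have h4 := mul_le_mul_of_nonneg_right hyC (sq_nonneg (P t - P s))
    have h5 := mul_le_mul_of_nonneg_right h3 hΔ
    nlinarith
  have hsub : ∀ {a b : ℝ}, a ∈ Icc 0 T → b ∈ Icc 0 T → Icc a b ⊆ Icc 0 T :=
    fun ha hb => Icc_subset_Icc ha.1 hb.2
  rcases le_total r t with hrt | htr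
  · have hpos : ∀ τ ∈ Icc r t, 0 ≤ P τ := fun τ hτ => by
      rw [← hPr]; exact hPm hr (hsub hr ht hτ) hτ.1
    have := le_of_increment_le_sq (h := fun τ => (∫ σ in r..τ, φ σ) - Real.exp (2 * P τ) / 2)
      (C := 2 * C) hrt (hPm.mono (hsub hr ht)) (hPc.mono (hsub hr ht)) (by positivity)
      (fun s s' hs hss hs' => by
        have ms : s ∈ Icc 0 T := hsub hr ht ⟨hs, hss.trans hs'⟩
        have ms' : s' ∈ Icc 0 T := hsub hr ht ⟨hs.trans hss, hs'⟩
        have e := integral_sub_integral hφi hr ms ms'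
        have p' := hpos s' ⟨hs.trans hss, hs'⟩
        have := inc s ms s' ms' hss (P s) (P s') rfl (fun τ hτ => by
            rw [abs_of_nonneg (hpos τ ⟨hs.trans hτ.1, hτ.2.trans hs'⟩)]
            exact hPm (hsub ms ms' hτ) ms' hτ.2)
          (by simpa [abs_of_nonneg p'] using hC s' ms')
        linarith)
    simp only [hPr, intervalIntegral.integral_same, mul_zero, Real.exp_zero] at this
    rw [abs_of_nonneg (intervalIntegral.integral_nonneg hrt fun τ _ => hφ0 τ),
      abs_of_nonneg (hpos t ⟨hrt, le_rfl⟩)]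
    linarith
  · have hneg : ∀ τ ∈ Icc t r, P τ ≤ 0 := fun τ hτ => by
      rw [← hPr]; exact hPm (hsub ht hr hτ) hr hτ.2
    have := le_of_increment_le_sq (h := fun τ => (∫ σ in t..τ, φ σ) + Real.exp (2 * (-P τ)) / 2)
      (C := 2 * C) htr (hPm.mono (hsub ht hr)) (hPc.mono (hsub ht hr)) (by positivity)
      (fun s s' hs hss hs' => by
        have ms : s ∈ Icc 0 T := hsub ht hr ⟨hs, hss.trans hs'⟩
        have ms' : s' ∈ Icc 0 T := hsub ht hr ⟨hs.trans hss, hs'⟩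
        have e := integral_sub_integral hφi ht ms ms'
        have p' := hneg s ⟨hs, hss.trans hs'⟩
        have := inc s ms s' ms' hss (-P s') (-P s) (by ring) (fun τ hτ => by
            rw [abs_of_nonpos (hneg τ ⟨hs.trans hτ.1, hτ.2.trans hs'⟩)]
            exact neg_le_neg (hPm ms (hsub ms ms' hτ) hτ.1))
          (by simpa [abs_of_nonpos p'] using hC s ms)
        linarith)
    simp only [hPr, intervalIntegral.integral_same, mul_zero, neg_zero, Real.exp_zero] at this
    rw [intervalIntegral.integral_symm, abs_neg,
      abs_of_nonneg (intervalIntegral.integral_nonneg htr fun τ _ => hφ0 τ),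
      abs_of_nonpos (hneg t ⟨le_rfl, htr⟩)]
    linarith

/-- Gronwall's inequality with an integrable kernel, on both sides of the base point. -/
lemma gronwall_abs {l u : ℝ → ℝ} {a r : ℝ} (hl : L1Nonneg T l) (hr : r ∈ Icc 0 T)
    (huc : ContinuousOn u (Icc 0 T)) (hu0 : ∀ t ∈ Icc 0 T, 0 ≤ u t)
    (H : ∀ t ∈ Icc 0 T, u t ≤ a + |∫ τ in r..t, l τ * u τ|) {t : ℝ} (ht : t ∈ Icc 0 T) :
    u t ≤ 2 * a * Real.exp (2 * ∫ τ in (0 : ℝ)..T, l τ) := by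
  set P : ℝ → ℝ := fun t => ∫ σ in r..t, l σ with hP
  have hPc : ContinuousOn P (Icc 0 T) := continuousOn_primitive_Icc hl.2 hr
  set e : ℝ → ℝ := fun t => Real.exp (2 * |P t|) with he
  have hec : ContinuousOn e (Icc 0 T) := by simp only [he]; fun_prop
  have he0 : ∀ t, 0 < e t := fun t => Real.exp_pos _
  have he1 : ∀ t, 1 ≤ e t := fun t => Real.one_le_exp (by positivity)
  have ha : 0 ≤ a := by
    have := H r hr
    simp only [intervalIntegral.integral_same, abs_zero, add_zero] at this
    exact (hu0 r hr).trans this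
  -- Let M be the maximum of u/e. At a maximum point the hypothesis reads M·e ≤ a + M(e - 1)/2,
  -- which forces M ≤ 2a without any iteration.
  obtain ⟨t₀, ht₀, hmax⟩ := isCompact_Icc.exists_isMaxOn ⟨t, ht⟩
    (huc.div hec fun t _ => (he0 t).ne')
  set M := u t₀ / e t₀ with hM
  have hM' : ∀ t ∈ Icc 0 T, u t ≤ M * e t := fun t ht => by
    have : u t / e t ≤ M := hmax ht
    rwa [div_le_iff₀ (he0 t)] at this
  have hM0 : 0 ≤ M := div_nonneg (hu0 _ ht₀) (he0 _).le
  have hb : ∀ t ∈ Icc 0 T, |∫ τ in r..t, l τ * u τ| ≤ M * ((e t - 1) / 2) := by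
    intro t ht
    have h1 : |∫ τ in r..t, l τ * u τ| ≤ |∫ τ in r..t, M * (l τ * e τ)| := by
      rw [← Real.norm_eq_abs]
      refine norm_integral_le_of_ae_leb ?_ ?_ hr ht
      · exact (IntegrableOn.mul_continuousOn hl.2 hec isCompact_Icc).const_mul M
      · filter_upwards [ae_leb_mem] with τ hτ
        rw [Real.norm_eq_abs, abs_of_nonneg (mul_nonneg (hl.1 τ) (hu0 τ hτ))]
        nlinarith [mul_le_mul_of_nonneg_left (hM' τ hτ) (hl.1 τ)]
    refine h1.trans ?_
    rw [intervalIntegral.integral_const_mul, abs_mul, abs_of_nonneg hM0]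
    exact mul_le_mul_of_nonneg_left (abs_integral_mul_exp_le hl hr ht) hM0
  have hMa : M ≤ 2 * a := by
    have h1 := (H t₀ ht₀).trans (add_le_add_right (hb t₀ ht₀) a)
    have h2 : u t₀ = M * e t₀ := by rw [hM, div_mul_cancel₀ _ (he0 _).ne']
    rw [h2] at h1
    by_contra hlt
    push Not at hlt
    nlinarith [he1 t₀, mul_le_mul_of_nonneg_left (he1 t₀) ha]
  refine (hM' t ht).trans ?_
  have : e t ≤ Real.exp (2 * ∫ τ in (0 : ℝ)..T, l τ) :=
    Real.exp_le_exp.2 (mul_le_mul_of_nonneg_left (hl.integral_le_total hr ht) two_pos.le)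
  exact mul_le_mul hMa this (he0 t).le (by linarith)

/-- Measurability along the diagonal of a function of two times which is measurable in the second
one and continuous in the first one. -/
lemma aestronglyMeasurable_diag {X : Type*} [TopologicalSpace X] [PseudoMetrizableSpace X]
    {F : ℝ → ℝ → X} (hm : ∀ s ∈ Icc 0 T, AEStronglyMeasurable (F s) (leb T))
    (hc : ∀ᵐ t ∂leb T, Tendsto (fun s => F s t) (𝓝[Icc 0 T] t) (𝓝 (F t t))) :
    AEStronglyMeasurable (fun t => F t t) (leb T) := by
  -- The first time variable is rounded down to a multiple of 1/(n+1). On each of the countably many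
  -- level sets of the floor it is constant, so measurability in the second variable suffices. The
  -- minimum with T keeps the rounded time in [0,T] for every real t.
  set p : ℕ → ℝ → ℝ := fun n t => min T (⌊((n : ℝ) + 1) * t⌋₊ / ((n : ℝ) + 1)) with hp
  have hpm : ∀ n, 0 ≤ T → ∀ t, p n t ∈ Icc 0 T := fun n hT t =>
    ⟨le_min hT (by positivity), min_le_left _ _⟩
  refine aestronglyMeasurable_of_tendsto_ae atTop (f := fun n t => F (p n t) t) ?_ ?_
  · intro n
    by_cases hT : 0 ≤ T
    swap
    · have : leb T = 0 := by simp [leb, Icc_eq_empty hT]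
      rw [this]; exact aestronglyMeasurable_zero_measure _
    have hcov : (⋃ j : ℕ, {t : ℝ | ⌊((n : ℝ) + 1) * t⌋₊ = j}) = univ := by
      ext t; simp
    rw [← Measure.restrict_univ (μ := leb T), ← hcov, aestronglyMeasurable_iUnion_iff]
    intro j
    have hmeas : MeasurableSet {t : ℝ | ⌊((n : ℝ) + 1) * t⌋₊ = j} := by
      have : Measurable fun t : ℝ => ⌊((n : ℝ) + 1) * t⌋₊ :=
        Nat.measurable_floor.comp (measurable_const_mul _)
      exact this (measurableSet_singleton j)
    refine ((hm (min T (j / ((n : ℝ) + 1))) ⟨le_min hT (by positivity), min_le_left _ _⟩).restrict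
      ).congr ?_
    filter_upwards [ae_restrict_mem hmeas] with t ht
    have ht' : ⌊((n : ℝ) + 1) * t⌋₊ = j := ht
    simp only [hp, ht']
  · filter_upwards [hc, ae_leb_mem] with t ht htm
    refine ht.comp (tendsto_nhdsWithin_iff.2 ⟨?_, .of_forall fun n => hpm n (htm.1.trans htm.2) t⟩)
    have h1 : Tendsto (fun n : ℕ => (⌊((n : ℝ) + 1) * t⌋₊ : ℝ) / ((n : ℝ) + 1)) atTop (𝓝 t) := by
      have := (tendsto_nat_floor_mul_div_atTop (R := ℝ) htm.1).comp
        (tendsto_natCast_atTop_atTop (R := ℝ) |>.atTop_add (tendsto_const_nhds (x := (1 : ℝ))))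
      refine this.congr fun n => ?_
      simp [mul_comm]
    have := (tendsto_const_nhds (x := T)).min h1
    rwa [min_eq_right htm.2] at this

end RealLine
end WassLin

namespace WassLin

/-! ### Radial retraction onto a ball of a normed space. -/

section Retraction

variable {B : Type*} [NormedAddCommGroup B] [NormedSpace ℝ B]

/-- The radial retraction onto the closed ball of radius `ρ`. -/
noncomputable def retract (ρ : ℝ) (x : B) : B := (ρ / max ρ ‖x‖) • x

lemma retract_of_le {ρ : ℝ} (hρ : 0 < ρ) {x : B} (hx : ‖x‖ ≤ ρ) : retract ρ x = x := by
  rw [retract, max_eq_left hx, div_self hρ.ne', one_smul]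

lemma norm_retract_le {ρ : ℝ} (hρ : 0 < ρ) (x : B) : ‖retract ρ x‖ ≤ ρ := by
  have h : 0 < max ρ ‖x‖ := lt_max_of_lt_left hρ
  rw [retract, norm_smul, Real.norm_of_nonneg (by positivity), div_mul_eq_mul_div,
    div_le_iff₀ h]
  exact mul_le_mul_of_nonneg_left (le_max_right _ _) hρ.le

lemma norm_retract_le_norm {ρ : ℝ} (hρ : 0 < ρ) (x : B) : ‖retract ρ x‖ ≤ ‖x‖ := by
  have h : 0 < max ρ ‖x‖ := lt_max_of_lt_left hρ
  rw [retract, norm_smul, Real.norm_of_nonneg (by positivity), div_mul_eq_mul_div,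
    div_le_iff₀ h, mul_comm]
  exact mul_le_mul_of_nonneg_left (le_max_left _ _) (norm_nonneg _)

/-- The difference splits into a change of the vector and a change of the scaling factor, each
costing at most ‖x - y‖. The constant 2 makes this valid in every normed space, and so also in the
spaces of maps used later. -/
lemma norm_retract_sub_le {ρ : ℝ} (hρ : 0 < ρ) (x y : B) :
    ‖retract ρ x - retract ρ y‖ ≤ 2 * ‖x - y‖ := by
  have hx : 0 < max ρ ‖x‖ := lt_max_of_lt_left hρ
  have hy : 0 < max ρ ‖y‖ := lt_max_of_lt_left hρ
  have e : retract ρ x - retract ρ y = (ρ / max ρ ‖x‖) • (x - y)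
      + ((ρ / max ρ ‖x‖ - ρ / max ρ ‖y‖)) • y := by
    simp only [retract, smul_sub, sub_smul]; abel
  rw [e]
  refine (norm_add_le _ _).trans ?_
  rw [norm_smul, norm_smul, Real.norm_of_nonneg (by positivity)]
  have h1 : ρ / max ρ ‖x‖ ≤ 1 := (div_le_one hx).2 (le_max_left _ _)
  have h2 : ‖ρ / max ρ ‖x‖ - ρ / max ρ ‖y‖‖ * ‖y‖ ≤ ‖x - y‖ := by
    have h3 : ρ / max ρ ‖x‖ - ρ / max ρ ‖y‖
        = ρ / max ρ ‖x‖ * ((max ρ ‖y‖ - max ρ ‖x‖) / max ρ ‖y‖) := by field_simp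
    have h4 : |max ρ ‖y‖ - max ρ ‖x‖| ≤ ‖x - y‖ := by
      have := abs_max_sub_max_le_abs ‖y‖ ‖x‖ ρ
      rw [max_comm ρ, max_comm ρ]
      exact this.trans ((abs_norm_sub_norm_le _ _).trans (norm_sub_rev _ _).le)
    rw [h3, norm_mul, Real.norm_of_nonneg (by positivity), norm_div, Real.norm_eq_abs,
      Real.norm_of_nonneg hy.le, mul_assoc]
    have h5 : |max ρ ‖y‖ - max ρ ‖x‖| / max ρ ‖y‖ * ‖y‖ ≤ ‖x - y‖ := by
      rw [div_mul_eq_mul_div, div_le_iff₀ hy]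
      exact mul_le_mul h4 (le_max_right _ _) (norm_nonneg _) (norm_nonneg _)
    exact (mul_le_of_le_one_left (by positivity) h1).trans h5
  nlinarith [norm_nonneg (x - y)]

lemma continuous_retract {ρ : ℝ} (hρ : 0 < ρ) : Continuous (retract ρ : B → B) := by
  refine (LipschitzWith.of_dist_le_mul (K := 2) fun x y => ?_).continuous
  simpa [dist_eq_norm] using norm_retract_sub_le hρ x y

end Retraction

/-! ### Carathéodory equations in a Banach space. -/

section Caratheodory

variable {B : Type*} [NormedAddCommGroup B] [NormedSpace ℝ B] {T : ℝ}

/-- Carathéodory vector fields on a normed space with integrable sublinear growth and integrable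
Lipschitz constants on balls. -/
structure CaraField (T : ℝ) (f : ℝ → B → B) : Prop where
  meas : ∀ x, AEStronglyMeasurable (fun t => f t x) (leb T)
  growth : ∃ m, L1Nonneg T m ∧ ∀ᵐ t ∂leb T, ∀ x, ‖f t x‖ ≤ m t * (1 + ‖x‖)
  lip : ∀ R > 0, ∃ l, L1Nonneg T l ∧ ∀ᵐ t ∂leb T, ∀ x ∈ Metric.closedBall (0 : B) R,
    ∀ y ∈ Metric.closedBall (0 : B) R, ‖f t x - f t y‖ ≤ l t * ‖x - y‖

/-- `X` is a Carathéodory solution on `[0,T]` of `X' = f(t, X)`, `X(r) = x₀`. -/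
structure IsCaraSol (T : ℝ) (f : ℝ → B → B) (r : ℝ) (x₀ : B) (X : ℝ → B) : Prop where
  cont : ContinuousOn X (Icc 0 T)
  eqn : ∀ t ∈ Icc 0 T, X t = x₀ + ∫ s in r..t, f s (X s)

variable {f : ℝ → B → B}

lemma exists_norm_le_of_continuousOn {X : ℝ → B} (hX : ContinuousOn X (Icc 0 T)) :
    ∃ C > 0, ∀ t ∈ Icc 0 T, ‖X t‖ ≤ C := by
  obtain ⟨C, hC⟩ := isCompact_Icc.exists_bound_of_continuousOn hX
  exact ⟨max C 1, by positivity, fun t ht => (hC t ht).trans (le_max_left _ _)⟩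

/-- The exceptional set of times in the Lipschitz hypothesis depends on the radius; integer radii
suffice and leave a single null set. -/
lemma CaraField.ae_continuous (hf : CaraField T f) : ∀ᵐ t ∂leb T, Continuous (f t) := by
  choose l hl hl' using fun n : ℕ => hf.lip ((n : ℝ) + 1) (by positivity)
  filter_upwards [ae_all_iff.2 hl'] with t ht
  refine continuous_iff_continuousAt.2 fun x => ?_
  obtain ⟨n, hn⟩ := exists_nat_gt ‖x‖
  have hlip : LipschitzOnWith (Real.toNNReal (l n t)) (f t) (Metric.closedBall 0 ((n : ℝ) + 1)) :=
    LipschitzOnWith.of_dist_le_mul fun y hy z hz => by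
      rw [dist_eq_norm, dist_eq_norm, Real.coe_toNNReal _ ((hl n).1 t)]
      exact ht n y hy z hz
  refine hlip.continuousOn.continuousAt (Metric.closedBall_mem_nhds_of_mem ?_)
  simp only [mem_ball_zero_iff]; linarith

lemma CaraField.aestronglyMeasurable_comp (hf : CaraField T f) {X : ℝ → B}
    (hX : ContinuousOn X (Icc 0 T)) : AEStronglyMeasurable (fun t => f t (X t)) (leb T) := by
  refine aestronglyMeasurable_diag (F := fun s t => f t (X s)) (fun s _ => hf.meas _) ?_
  filter_upwards [hf.ae_continuous, ae_leb_mem] with t ht htm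
  exact (ht.tendsto (X t)).comp (hX t htm)

lemma CaraField.integrableOn_comp (hf : CaraField T f) {X : ℝ → B}
    (hX : ContinuousOn X (Icc 0 T)) : IntegrableOn (fun t => f t (X t)) (Icc 0 T) := by
  obtain ⟨m, hm, hm'⟩ := hf.growth
  obtain ⟨C, hC0, hC⟩ := exists_norm_le_of_continuousOn hX
  refine Integrable.mono' (hm.2.mul_const (1 + C)) (hf.aestronglyMeasurable_comp hX) ?_
  filter_upwards [hm', ae_leb_mem] with t ht htm
  exact (ht _).trans (mul_le_mul_of_nonneg_left (by linarith [hC t htm]) (hm.1 t))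

/-- A priori bound for Carathéodory solutions, uniform in the initial time. -/
lemma IsCaraSol.norm_le_of_growth {m : ℝ → ℝ} (hm : L1Nonneg T m)
    (hm' : ∀ᵐ t ∂leb T, ∀ x, ‖f t x‖ ≤ m t * (1 + ‖x‖))
    {r : ℝ} (hr : r ∈ Icc 0 T) {x₀ : B} {X : ℝ → B} (hX : IsCaraSol T f r x₀ X) {t : ℝ}
    (ht : t ∈ Icc 0 T) :
    ‖X t‖ ≤ 2 * (‖x₀‖ + ∫ τ in (0 : ℝ)..T, m τ) * Real.exp (2 * ∫ τ in (0 : ℝ)..T, m τ) := by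
  refine gronwall_abs hm hr hX.cont.norm (fun _ _ => norm_nonneg _) (fun t ht => ?_) ht
  have i1 : IntegrableOn (fun τ => m τ * ‖X τ‖) (Icc 0 T) :=
    IntegrableOn.mul_continuousOn hm.2 hX.cont.norm isCompact_Icc
  have h1 : ‖∫ s in r..t, f s (X s)‖ ≤ |∫ τ in r..t, (m τ + m τ * ‖X τ‖)| := by
    refine norm_integral_le_of_ae_leb (Integrable.add hm.2 i1) ?_ hr ht
    filter_upwards [hm'] with τ hτ
    exact (hτ _).trans (by ring_nf; rfl)
  rw [intervalIntegral.integral_add (intervalIntegrable_of_mem_Icc hm.2 hr ht)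
    (intervalIntegrable_of_mem_Icc i1 hr ht)] at h1
  have h2 := hm.integral_le_total hr ht
  have h3 := norm_add_le x₀ (∫ s in r..t, f s (X s))
  have h4 := abs_add_le (∫ τ in r..t, m τ) (∫ τ in r..t, m τ * ‖X τ‖)
  rw [← hX.eqn t ht] at h3
  linarith

/-- Stability of Carathéodory solutions. -/
lemma norm_sub_le_of_lip {l : ℝ → ℝ} (hl : L1Nonneg T l) {X Y Z : ℝ → B} {a r : ℝ}
    (hr : r ∈ Icc 0 T) (hX : ContinuousOn X (Icc 0 T)) (hY : ContinuousOn Y (Icc 0 T))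
    (hZ : ∀ᵐ t ∂leb T, ‖Z t‖ ≤ l t * ‖X t - Y t‖)
    (h : ∀ t ∈ Icc 0 T, ‖X t - Y t‖ ≤ a + ‖∫ s in r..t, Z s‖) {t : ℝ} (ht : t ∈ Icc 0 T) :
    ‖X t - Y t‖ ≤ 2 * a * Real.exp (2 * ∫ τ in (0 : ℝ)..T, l τ) := by
  refine gronwall_abs hl hr (hX.sub hY).norm (fun _ _ => norm_nonneg _) (fun t ht => ?_) ht
  refine (h t ht).trans (add_le_add_right ?_ a)
  exact norm_integral_le_of_ae_leb
    (IntegrableOn.mul_continuousOn hl.2 (hX.sub hY).norm isCompact_Icc) hZ hr ht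

lemma CaraField.norm_sub_le (hf : CaraField T f) {l : ℝ → ℝ} {R : ℝ} (hl : L1Nonneg T l)
    (hl' : ∀ᵐ t ∂leb T, ∀ x ∈ Metric.closedBall (0 : B) R,
      ∀ y ∈ Metric.closedBall (0 : B) R, ‖f t x - f t y‖ ≤ l t * ‖x - y‖)
    {r : ℝ} (hr : r ∈ Icc 0 T) {x₀ y₀ : B} {X Y : ℝ → B} (hX : IsCaraSol T f r x₀ X)
    (hY : IsCaraSol T f r y₀ Y) (hXR : ∀ t ∈ Icc 0 T, ‖X t‖ ≤ R) (hYR : ∀ t ∈ Icc 0 T, ‖Y t‖ ≤ R)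
    {t : ℝ} (ht : t ∈ Icc 0 T) :
    ‖X t - Y t‖ ≤ 2 * ‖x₀ - y₀‖ * Real.exp (2 * ∫ τ in (0 : ℝ)..T, l τ) := by
  refine norm_sub_le_of_lip (Z := fun s => f s (X s) - f s (Y s)) hl hr hX.cont hY.cont ?_
    (fun t ht => ?_) ht
  · filter_upwards [hl', ae_leb_mem] with τ h hτ
    exact h _ (by simpa using hXR τ hτ) _ (by simpa using hYR τ hτ)
  · rw [intervalIntegral.integral_sub
      (intervalIntegrable_of_mem_Icc (hf.integrableOn_comp hX.cont) hr ht)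
      (intervalIntegrable_of_mem_Icc (hf.integrableOn_comp hY.cont) hr ht)]
    have : X t - Y t = (x₀ - y₀) + ((∫ s in r..t, f s (X s)) - ∫ s in r..t, f s (Y s)) := by
      rw [hX.eqn t ht, hY.eqn t ht]; abel
    rw [this]
    exact norm_add_le _ _

lemma CaraField.unique (hf : CaraField T f) {r : ℝ} (hr : r ∈ Icc 0 T) {x₀ : B} {X Y : ℝ → B}
    (hX : IsCaraSol T f r x₀ X) (hY : IsCaraSol T f r x₀ Y) {t : ℝ} (ht : t ∈ Icc 0 T) :
    X t = Y t := by
  obtain ⟨C, hC0, hC⟩ := exists_norm_le_of_continuousOn hX.cont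
  obtain ⟨C', -, hC'⟩ := exists_norm_le_of_continuousOn hY.cont
  obtain ⟨l, hl, hl'⟩ := hf.lip (max C C') (lt_max_of_lt_left hC0)
  have := hf.norm_sub_le hl hl' hr hX hY (fun t ht => (hC t ht).trans (le_max_left _ _))
    (fun t ht => (hC' t ht).trans (le_max_right _ _)) ht
  simpa [sub_eq_zero] using this

/-- A solution starting at `(r, x₀)` is also a solution starting at `(s, X s)`. -/
lemma CaraField.restart (hf : CaraField T f) {r s : ℝ} (hr : r ∈ Icc 0 T) (hs : s ∈ Icc 0 T)
    {x₀ : B} {X : ℝ → B} (hX : IsCaraSol T f r x₀ X) : IsCaraSol T f s (X s) X := by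
  refine ⟨hX.cont, fun t ht => ?_⟩
  rw [hX.eqn t ht, hX.eqn s hs, ← integral_sub_integral (hf.integrableOn_comp hX.cont) hr hs ht]
  abel

variable [CompleteSpace B]

/-- Existence for globally Lipschitz Carathéodory fields. -/
lemma exists_isCaraSol_of_lipschitz {m l : ℝ → ℝ} (hm : L1Nonneg T m) (hl : L1Nonneg T l)
    (hmeas : ∀ x, AEStronglyMeasurable (fun t => f t x) (leb T))
    (hm' : ∀ᵐ t ∂leb T, ∀ x, ‖f t x‖ ≤ m t)
    (hl' : ∀ᵐ t ∂leb T, ∀ x y, ‖f t x - f t y‖ ≤ l t * ‖x - y‖)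
    {r : ℝ} (hr : r ∈ Icc 0 T) (x₀ : B) : ∃ X, IsCaraSol T f r x₀ X := by
  have hT : 0 ≤ T := hr.1.trans hr.2
  have hf : CaraField T f := by
    refine ⟨hmeas, ⟨m, hm, ?_⟩, fun R _ => ⟨l, hl, ?_⟩⟩
    · filter_upwards [hm'] with t ht x
      exact (ht x).trans (le_mul_of_one_le_right (hm.1 t) (by linarith [norm_nonneg x]))
    · filter_upwards [hl'] with t ht x _ y _ using ht x y
  set P : ℝ → ℝ := fun t => ∫ σ in r..t, l σ with hP
  have hPc : ContinuousOn P (Icc 0 T) := continuousOn_primitive_Icc hl.2 hr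
  set e : ℝ → ℝ := fun t => Real.exp (2 * |P t|) with he
  have hec : ContinuousOn e (Icc 0 T) := by simp only [he]; fun_prop
  have he0 : ∀ t, 0 < e t := fun t => Real.exp_pos _
  have he1 : ∀ t, 1 ≤ e t := fun t => Real.one_le_exp (by positivity)
  -- The Picard map is conjugated by the weight e = exp(2|P|): the unknown is Y = X/e. In this
  -- variable it contracts by 1/2 on the whole of [0,T], however large the integral of l is.
  let ex : C(Icc (0 : ℝ) T, B) → ℝ → B := fun Y t => e t • IccExtend hT Y t
  have hex : ∀ Y, ContinuousOn (ex Y) (Icc 0 T) := fun Y =>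
    hec.smul (Y.continuous.Icc_extend').continuousOn
  have hint := fun Y => hf.integrableOn_comp (hex Y)
  let N : C(Icc (0 : ℝ) T, B) → C(Icc (0 : ℝ) T, B) := fun Y =>
    ⟨fun t => (e t)⁻¹ • (x₀ + ∫ s in r..(t : ℝ), f s (ex Y s)), by
      have h1 : ContinuousOn (fun t => (e t)⁻¹ • (x₀ + ∫ s in r..t, f s (ex Y s))) (Icc 0 T) :=
        (hec.inv₀ fun t _ => (he0 t).ne').smul
          (continuousOn_const.add (continuousOn_primitive_Icc (hint Y) hr))
      exact h1.comp_continuous continuous_subtype_val fun t => t.2⟩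
  have hN : ContractingWith (1 / 2) N := by
    refine ⟨by norm_num, LipschitzWith.of_dist_le_mul fun Y Z => ?_⟩
    rw [ContinuousMap.dist_le (by positivity)]
    intro t
    have h1 : dist (N Y t) (N Z t)
        = (e t)⁻¹ * ‖∫ s in r..(t : ℝ), (f s (ex Y s) - f s (ex Z s))‖ := by
      rw [dist_eq_norm]
      change ‖(e t)⁻¹ • (x₀ + ∫ s in r..(t : ℝ), f s (ex Y s))
        - (e t)⁻¹ • (x₀ + ∫ s in r..(t : ℝ), f s (ex Z s))‖ = _
      rw [← smul_sub, norm_smul, add_sub_add_left_eq_sub,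
        ← intervalIntegral.integral_sub (intervalIntegrable_of_mem_Icc (hint Y) hr t.2)
        (intervalIntegrable_of_mem_Icc (hint Z) hr t.2), Real.norm_of_nonneg (inv_pos.2 (he0 _)).le]
    have h2 : ‖∫ s in r..(t : ℝ), (f s (ex Y s) - f s (ex Z s))‖
        ≤ |∫ s in r..(t : ℝ), dist Y Z * (l s * e s)| := by
      refine norm_integral_le_of_ae_leb
        ((IntegrableOn.mul_continuousOn hl.2 hec isCompact_Icc).const_mul _) ?_ hr t.2
      filter_upwards [hl'] with s hs
      refine (hs _ _).trans ?_
      have : ‖ex Y s - ex Z s‖ ≤ e s * dist Y Z := by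
        simp only [ex]
        rw [← smul_sub, norm_smul, Real.norm_of_nonneg (he0 s).le, ← dist_eq_norm]
        exact mul_le_mul_of_nonneg_left (ContinuousMap.dist_apply_le_dist _) (he0 s).le
      nlinarith [mul_le_mul_of_nonneg_left this (hl.1 s)]
    rw [intervalIntegral.integral_const_mul, abs_mul, abs_of_nonneg dist_nonneg] at h2
    have h3 := abs_integral_mul_exp_le hl hr t.2
    rw [h1, inv_mul_le_iff₀ (he0 _)]
    refine h2.trans ((mul_le_mul_of_nonneg_left h3 dist_nonneg).trans ?_)
    have : (Real.exp (2 * |∫ σ in r..(t : ℝ), l σ|) - 1) / 2 ≤ e t * (1 / 2) := by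
      simp only [he, hP]; linarith
    have h5 := mul_le_mul_of_nonneg_left this (dist_nonneg (x := Y) (y := Z))
    simp only [NNReal.coe_div, NNReal.coe_one, NNReal.coe_ofNat]
    linarith
  set Y := hN.fixedPoint with hY
  have hfix : N Y = Y := hN.fixedPoint_isFixedPt
  refine ⟨ex Y, hex Y, fun t ht => ?_⟩
  have h1 : (N Y) ⟨t, ht⟩ = (e t)⁻¹ • (x₀ + ∫ s in r..t, f s (ex Y s)) := rfl
  rw [hfix] at h1
  change e t • IccExtend hT Y t = _
  rw [IccExtend_of_mem hT Y ht, h1, smul_smul, mul_inv_cancel₀ (he0 t).ne', one_smul]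

/-- Composition with the retraction onto the ball given by the a priori bound makes the field
bounded and globally Lipschitz. The retraction does not increase norms, so the truncated field
satisfies the same growth condition; its solution obeys the same bound and never meets the
truncation. -/
lemma CaraField.exists_isCaraSol (hf : CaraField T f) {r : ℝ} (hr : r ∈ Icc 0 T) (x₀ : B) :
    ∃ X, IsCaraSol T f r x₀ X := by
  obtain ⟨m, hm, hm'⟩ := hf.growth
  set ρ := max 1 (2 * (‖x₀‖ + ∫ τ in (0 : ℝ)..T, m τ) * Real.exp (2 * ∫ τ in (0 : ℝ)..T, m τ))
  have hρ : 0 < ρ := lt_max_of_lt_left one_pos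
  obtain ⟨l, hl, hl'⟩ := hf.lip ρ hρ
  have hgr : ∀ᵐ t ∂leb T, ∀ x, ‖f t (retract ρ x)‖ ≤ m t * (1 + ‖x‖) := by
    filter_upwards [hm'] with t ht x
    exact (ht _).trans (mul_le_mul_of_nonneg_left
      (add_le_add_right (norm_retract_le_norm hρ x) 1) (hm.1 t))
  obtain ⟨X, hX⟩ := exists_isCaraSol_of_lipschitz (f := fun t x => f t (retract ρ x))
    (m := fun t => (1 + ρ) * m t) (l := fun t => 2 * l t) (hm.const_mul (by positivity))
    (hl.const_mul two_pos.le) (fun x => hf.meas _)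
    (by
      filter_upwards [hm'] with t ht x
      refine (ht _).trans ?_
      rw [mul_comm]
      exact mul_le_mul_of_nonneg_right (by linarith [norm_retract_le hρ x]) (hm.1 t))
    (by
      filter_upwards [hl'] with t ht x y
      refine (ht _ (by simpa using norm_retract_le hρ x) _
        (by simpa using norm_retract_le hρ y)).trans ?_
      nlinarith [mul_le_mul_of_nonneg_left (norm_retract_sub_le hρ x y) (hl.1 t)])
    hr x₀
  refine ⟨X, hX.cont, fun t ht => ?_⟩
  have hle : ∀ t ∈ Icc 0 T, retract ρ (X t) = X t := fun t ht =>
    retract_of_le hρ ((hX.norm_le_of_growth hm hgr hr ht).trans (le_max_right _ _))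
  rw [hX.eqn t ht]
  congr 1
  refine intervalIntegral.integral_congr fun s hs => ?_
  simp only [hle s ((convex_Icc (0 : ℝ) T).ordConnected.uIcc_subset hr ht hs)]

end Caratheodory

end WassLin

namespace WassLin

/-- A map with values in a space of continuous functions is measurable as soon as its evaluations
are. -/
lemma aestronglyMeasurable_of_eval {Ω K F : Type*} [MeasurableSpace Ω] {μ : Measure Ω}
    [MetricSpace K] [CompactSpace K] [NormedAddCommGroup F] [CompleteSpace F]
    [SecondCountableTopology F] {f : Ω → C(K, F)}
    (h : ∀ x, AEStronglyMeasurable (fun ω => f ω x) μ) : AEStronglyMeasurable f μ := by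
  borelize F
  borelize C(K, F)
  rcases isEmpty_or_nonempty K with hK | hK
  · have : f = fun _ => 0 := by
      funext ω; ext x; exact hK.elim x
    rw [this]; exact aestronglyMeasurable_const
  -- Evaluation along a dense sequence is a continuous injection between Polish spaces, hence a
  -- measurable embedding by the Lusin–Souslin theorem.
  have hemb : MeasurableEmbedding (fun (X : C(K, F)) (n : ℕ) => X (denseSeq K n)) := by
    refine Continuous.measurableEmbedding (by fun_prop) fun X Y hXY => ?_
    exact DFunLike.coe_injective ((denseRange_denseSeq K).equalizer X.continuous Y.continuous hXY)
  refine AEMeasurable.aestronglyMeasurable (hemb.aemeasurable_comp_iff.1 ?_)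
  rw [aemeasurable_pi_iff]
  exact fun n => (h _).aemeasurable

/-! ### Compactly supported measures, push-forwards, plans and Wasserstein distances. -/

section Measures

variable {d : ℕ}

instance (μ : Pc d) : IsProbabilityMeasure μ.meas := μ.2.1

lemma Pc.ext_meas {μ ν : Pc d} (h : μ.meas = ν.meas) : μ = ν := Subtype.ext h

lemma Pc.InBall.ae_norm_le {μ : Pc d} {R : ℝ} (h : μ.InBall R) : ∀ᵐ x ∂μ.meas, ‖x‖ ≤ R := by
  have : ∀ᵐ x ∂μ.meas, x ∈ Metric.closedBall (0 : E d) R := by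
    rw [ae_iff]; exact h
  simpa using this

lemma Pc.inBall_of_ae {μ : Pc d} {R : ℝ} (h : ∀ᵐ x ∂μ.meas, ‖x‖ ≤ R) : μ.InBall R := by
  have : ∀ᵐ x ∂μ.meas, x ∈ Metric.closedBall (0 : E d) R := by simpa using h
  rw [ae_iff] at this
  exact this

lemma Pc.InBall.mono {μ : Pc d} {R R' : ℝ} (h : μ.InBall R) (hR : R ≤ R') : μ.InBall R' :=
  Pc.inBall_of_ae (h.ae_norm_le.mono fun _ hx => hx.trans hR)

lemma Pc.exists_inBall (μ : Pc d) : ∃ R > 0, μ.InBall R := by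
  obtain ⟨R, hR⟩ := μ.2.2
  have : μ.InBall R := hR
  exact ⟨max R 1, by positivity, this.mono (le_max_left _ _)⟩

lemma Pc.InBall.nonneg {μ : Pc d} {R : ℝ} (h : μ.InBall R) : 0 ≤ R := by
  obtain ⟨x, hx⟩ := h.ae_norm_le.exists
  exact (norm_nonneg x).trans hx

lemma Pc.integrable_of_ae_norm_le (μ : Pc d) {F : Type*} [NormedAddCommGroup F] {f : E d → F}
    (hf : AEStronglyMeasurable f μ.meas) {C : ℝ} (hC : ∀ᵐ x ∂μ.meas, ‖f x‖ ≤ C) :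
    Integrable f μ.meas :=
  (integrable_const C).mono' hf hC

lemma Pc.exists_ae_norm_le_of_continuous (μ : Pc d) {F : Type*} [NormedAddCommGroup F]
    {f : E d → F} (hf : Continuous f) : ∃ C > 0, ∀ᵐ x ∂μ.meas, ‖f x‖ ≤ C := by
  obtain ⟨R, -, hR⟩ := μ.exists_inBall
  obtain ⟨C, hC⟩ := (isCompact_closedBall (0 : E d) R).exists_bound_of_continuousOn hf.continuousOn
  refine ⟨max C 1, by positivity, hR.ae_norm_le.mono fun x hx => ?_⟩
  exact (hC x (by simpa using hx)).trans (le_max_left _ _)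

lemma Pc.integrable_of_continuous (μ : Pc d) {F : Type*} [NormedAddCommGroup F]
    {f : E d → F} (hf : Continuous f) : Integrable f μ.meas := by
  obtain ⟨C, -, hC⟩ := μ.exists_ae_norm_le_of_continuous hf
  exact μ.integrable_of_ae_norm_le hf.aestronglyMeasurable hC

/-- The push-forward of a compactly supported probability measure by a continuous map. -/
noncomputable def Pc.push (μ : Pc d) (g : C(E d, E d)) : Pc d :=
  ⟨μ.meas.map g, Measure.isProbabilityMeasure_map g.continuous.aemeasurable, by
    obtain ⟨C, -, hC⟩ := μ.exists_ae_norm_le_of_continuous g.continuous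
    refine ⟨C, ?_⟩
    have : ∀ᵐ x ∂μ.meas.map g, x ∈ Metric.closedBall (0 : E d) C := by
      refine (ae_map_iff (p := fun x => x ∈ Metric.closedBall (0 : E d) C)
        g.continuous.aemeasurable Metric.isClosed_closedBall.measurableSet).2 ?_
      simpa using hC
    rw [ae_iff] at this
    exact this⟩

lemma Pc.meas_push (μ : Pc d) (g : C(E d, E d)) : (μ.push g).meas = μ.meas.map g := rfl

lemma Pc.push_inBall {μ : Pc d} {g : C(E d, E d)} {C : ℝ} (h : ∀ᵐ x ∂μ.meas, ‖g x‖ ≤ C) :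
    (μ.push g).InBall C := by
  refine Pc.inBall_of_ae ?_
  rw [Pc.meas_push, ae_map_iff g.continuous.aemeasurable (measurableSet_le (by fun_prop) (by fun_prop))]
  exact h

lemma Pc.integral_push (μ : Pc d) (g : C(E d, E d)) {F : Type*} [NormedAddCommGroup F]
    [NormedSpace ℝ F] {f : E d → F} (hf : Continuous f) :
    ∫ x, f x ∂(μ.push g).meas = ∫ x, f (g x) ∂μ.meas := by
  rw [Pc.meas_push, integral_map g.continuous.aemeasurable hf.aestronglyMeasurable]

lemma Pc.push_congr {μ : Pc d} {f g : C(E d, E d)} (h : ∀ᵐ x ∂μ.meas, f x = g x) :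
    μ.push f = μ.push g :=
  Pc.ext_meas (Measure.map_congr h)

lemma Pc.push_id (μ : Pc d) : μ.push (ContinuousMap.id _) = μ :=
  Pc.ext_meas (by simp [Pc.meas_push])

lemma Pc.moment1_nonneg (μ : Pc d) : 0 ≤ μ.moment1 := integral_nonneg fun _ => norm_nonneg _

lemma Pc.InBall.moment1_le {μ : Pc d} {R : ℝ} (h : μ.InBall R) : μ.moment1 ≤ R := by
  have : ∫ x, ‖x‖ ∂μ.meas ≤ ∫ _, R ∂μ.meas :=
    integral_mono_ae (μ.integrable_of_continuous continuous_norm) (integrable_const _) h.ae_norm_le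
  simpa [Pc.moment1] using this

lemma isProbabilityMeasure_of_mem_plans {μ ν : Pc d} {γ : Measure (E d × E d)}
    (h : γ ∈ plans μ ν) : IsProbabilityMeasure γ := by
  have : IsProbabilityMeasure (γ.map Prod.fst) := by rw [h.1]; infer_instance
  exact Measure.isProbabilityMeasure_of_map Prod.fst

lemma ae_fst_of_mem_plans {μ ν : Pc d} {γ : Measure (E d × E d)} (h : γ ∈ plans μ ν)
    {P : E d → Prop} (hP : ∀ᵐ x ∂μ.meas, P x) : ∀ᵐ z ∂γ, P z.1 :=
  ae_of_ae_map measurable_fst.aemeasurable (by rw [h.1]; exact hP)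

lemma ae_snd_of_mem_plans {μ ν : Pc d} {γ : Measure (E d × E d)} (h : γ ∈ plans μ ν)
    {P : E d → Prop} (hP : ∀ᵐ x ∂ν.meas, P x) : ∀ᵐ z ∂γ, P z.2 :=
  ae_of_ae_map measurable_snd.aemeasurable (by rw [h.2]; exact hP)

lemma integral_fst_of_mem_plans {μ ν : Pc d} {γ : Measure (E d × E d)} (h : γ ∈ plans μ ν)
    {F : Type*} [NormedAddCommGroup F] [NormedSpace ℝ F] {f : E d → F}
    (hf : AEStronglyMeasurable f μ.meas) : ∫ z, f z.1 ∂γ = ∫ x, f x ∂μ.meas := by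
  rw [← h.1] at hf ⊢
  rw [integral_map measurable_fst.aemeasurable hf]

lemma integral_snd_of_mem_plans {μ ν : Pc d} {γ : Measure (E d × E d)} (h : γ ∈ plans μ ν)
    {F : Type*} [NormedAddCommGroup F] [NormedSpace ℝ F] {f : E d → F}
    (hf : AEStronglyMeasurable f ν.meas) : ∫ z, f z.2 ∂γ = ∫ x, f x ∂ν.meas := by
  rw [← h.2] at hf ⊢
  rw [integral_map measurable_snd.aemeasurable hf]

lemma prod_mem_plans (μ ν : Pc d) : μ.meas.prod ν.meas ∈ plans μ ν := by
  constructor <;> simp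

lemma exists_ae_norm_le_of_mem_plans {μ ν : Pc d} {γ : Measure (E d × E d)} (h : γ ∈ plans μ ν) :
    ∃ C, ∀ᵐ z ∂γ, ‖z‖ ≤ C := by
  obtain ⟨R, -, hR⟩ := μ.exists_inBall
  obtain ⟨R', -, hR'⟩ := ν.exists_inBall
  refine ⟨max R R', ?_⟩
  filter_upwards [ae_fst_of_mem_plans h hR.ae_norm_le, ae_snd_of_mem_plans h hR'.ae_norm_le]
    with z h1 h2
  exact max_le_max h1 h2

lemma integrable_of_mem_plans {μ ν : Pc d} {γ : Measure (E d × E d)} (h : γ ∈ plans μ ν)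
    {F : Type*} [NormedAddCommGroup F] {f : E d × E d → F} (hf : Continuous f) :
    Integrable f γ := by
  have := isProbabilityMeasure_of_mem_plans h
  obtain ⟨C, hC⟩ := exists_ae_norm_le_of_mem_plans h
  obtain ⟨D, hD⟩ :=
    (isCompact_closedBall (0 : E d × E d) C).exists_bound_of_continuousOn hf.continuousOn
  exact (integrable_const D).mono' hf.aestronglyMeasurable
    (hC.mono fun z hz => hD z (by simpa using hz))

lemma cost_ne_top {μ ν : Pc d} {γ : Measure (E d × E d)} (h : γ ∈ plans μ ν) {p : ℝ}
    (hp : 0 ≤ p) : cost p γ ≠ ⊤ := by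
  have h1 : Integrable (fun z : E d × E d => ‖z.1 - z.2‖ ^ p) γ :=
    integrable_of_mem_plans h
      ((by fun_prop : Continuous fun z : E d × E d => ‖z.1 - z.2‖).rpow_const fun _ => Or.inr hp)
  refine ne_of_lt (lt_of_eq_of_lt ?_ h1.hasFiniteIntegral)
  refine lintegral_congr fun z => ?_
  rw [← ofReal_norm, ← ofReal_norm, Real.norm_of_nonneg (by positivity),
    ENNReal.ofReal_rpow_of_nonneg (norm_nonneg _) hp]

lemma wass_nonneg (p : ℝ) (μ ν : Pc d) : 0 ≤ wass p μ ν := ENNReal.toReal_nonneg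

lemma wass_comm (p : ℝ) (μ ν : Pc d) : wass p μ ν = wass p ν μ := by
  have key : ∀ μ ν : Pc d, (⨅ γ ∈ plans μ ν, cost p γ) ≤ ⨅ γ ∈ plans ν μ, cost p γ := by
    intro μ ν
    refine le_iInf₂ fun γ hγ => ?_
    refine iInf₂_le_of_le (γ.map Prod.swap) ⟨?_, ?_⟩ ?_
    · rw [Measure.map_map measurable_fst measurable_swap]; exact hγ.2
    · rw [Measure.map_map measurable_snd measurable_swap]; exact hγ.1
    · rw [cost, lintegral_map (by fun_prop) measurable_swap]
      refine (lintegral_congr fun z => ?_).le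
      simp only [Prod.fst_swap, Prod.snd_swap]
      rw [← neg_sub, enorm_neg]
  rw [wass, wass, le_antisymm (key μ ν) (key ν μ)]

/-- The plan induced by two maps. -/
lemma map_prodMk_mem_plans (μ : Pc d) (f g : C(E d, E d)) :
    μ.meas.map (fun x => (f x, g x)) ∈ plans (μ.push f) (μ.push g) := by
  constructor
  · rw [Measure.map_map measurable_fst (by fun_prop)]; rfl
  · rw [Measure.map_map measurable_snd (by fun_prop)]; rfl

lemma cost_map_prodMk_le {μ : Pc d} {f g : C(E d, E d)} {p c : ℝ} (hp : 0 ≤ p)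
    (h : ∀ᵐ x ∂μ.meas, ‖f x - g x‖ ≤ c) :
    cost p (μ.meas.map (fun x => (f x, g x))) ≤ ENNReal.ofReal c ^ p := by
  rw [cost, lintegral_map (by fun_prop) (by fun_prop)]
  have : ∫⁻ x, ‖f x - g x‖ₑ ^ p ∂μ.meas ≤ ∫⁻ _, ENNReal.ofReal c ^ p ∂μ.meas := by
    refine lintegral_mono_ae (h.mono fun x hx => ENNReal.rpow_le_rpow ?_ hp)
    rw [← ofReal_norm]
    exact ENNReal.ofReal_le_ofReal hx
  simpa using this

/-- The plan (f, g)_#μ is a competitor. This inequality is what turns Lipschitz continuity in W_p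
into Lipschitz continuity in the sup norm of maps. -/
lemma wass_push_le {μ : Pc d} {f g : C(E d, E d)} {p c : ℝ} (hp : 1 ≤ p) (hc : 0 ≤ c)
    (h : ∀ᵐ x ∂μ.meas, ‖f x - g x‖ ≤ c) : wass p (μ.push f) (μ.push g) ≤ c := by
  have h1 : (⨅ γ ∈ plans (μ.push f) (μ.push g), cost p γ) ≤ ENNReal.ofReal c ^ p :=
    iInf₂_le_of_le _ (map_prodMk_mem_plans μ f g) (cost_map_prodMk_le (by linarith) h)
  refine ENNReal.toReal_le_of_le_ofReal hc ?_
  refine (ENNReal.rpow_le_rpow h1 (by positivity)).trans_eq ?_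
  rw [← ENNReal.rpow_mul, mul_one_div_cancel (by linarith), ENNReal.rpow_one]

lemma wass_self {p : ℝ} (hp : 1 ≤ p) (μ : Pc d) : wass p μ μ = 0 := by
  refine le_antisymm ?_ (wass_nonneg _ _ _)
  have := wass_push_le (μ := μ) (f := ContinuousMap.id _) (g := ContinuousMap.id _) hp le_rfl
    (by simp)
  rwa [Pc.push_id] at this

/-- Integrals of Lipschitz functions are Lipschitz with respect to the Wasserstein distance. -/
lemma abs_integral_sub_le_wass {p : ℝ} (hp : 1 ≤ p) {ζ : E d → ℝ} {C : ℝ} (hC : 0 ≤ C)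
    (μ ν : Pc d) (hζ : AEStronglyMeasurable ζ μ.meas) (hζ' : AEStronglyMeasurable ζ ν.meas)
    {S : Set (E d)} (hS : ∀ᵐ x ∂μ.meas, x ∈ S) (hS' : ∀ᵐ x ∂ν.meas, x ∈ S)
    (hL : ∀ x ∈ S, ∀ y ∈ S, |ζ x - ζ y| ≤ C * ‖x - y‖) (hi : Integrable ζ μ.meas)
    (hi' : Integrable ζ ν.meas) :
    |∫ x, ζ x ∂μ.meas - ∫ x, ζ x ∂ν.meas| ≤ C * wass p μ ν := by
  have hp0 : 0 < p := by linarith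
  have key : ∀ γ ∈ plans μ ν, ENNReal.ofReal |∫ x, ζ x ∂μ.meas - ∫ x, ζ x ∂ν.meas|
      ≤ ENNReal.ofReal C * cost p γ ^ (1 / p) := by
    intro γ hγ
    have := isProbabilityMeasure_of_mem_plans hγ
    have i1 : Integrable (fun z : E d × E d => ζ z.1) γ := by
      rw [← hγ.1] at hi; exact hi.comp_measurable measurable_fst
    have i2 : Integrable (fun z : E d × E d => ζ z.2) γ := by
      rw [← hγ.2] at hi'; exact hi'.comp_measurable measurable_snd
    rw [← integral_fst_of_mem_plans hγ hζ, ← integral_snd_of_mem_plans hγ hζ',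
      ← integral_sub i1 i2, ← Real.norm_eq_abs, ofReal_norm]
    refine (enorm_integral_le_lintegral_enorm _).trans ?_
    have h1 : ∫⁻ z, ‖ζ z.1 - ζ z.2‖ₑ ∂γ ≤ ∫⁻ z, ENNReal.ofReal C * ‖z.1 - z.2‖ₑ ∂γ := by
      refine lintegral_mono_ae ?_
      filter_upwards [ae_fst_of_mem_plans hγ hS, ae_snd_of_mem_plans hγ hS'] with z h1 h2
      rw [← ofReal_norm, ← ofReal_norm, ← ENNReal.ofReal_mul hC]
      exact ENNReal.ofReal_le_ofReal (hL _ h1 _ h2)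
    refine h1.trans ?_
    rw [lintegral_const_mul _ (by fun_prop)]
    gcongr
    -- Since γ is a probability measure, its L¹ cost is at most its L^p cost.
    have h2 := eLpNorm_le_eLpNorm_of_exponent_le (μ := γ) (f := fun z : E d × E d => z.1 - z.2)
      (p := 1) (q := ENNReal.ofReal p) (by simpa using ENNReal.ofReal_le_ofReal hp)
      (by fun_prop)
    rw [eLpNorm_one_eq_lintegral_enorm, eLpNorm_eq_lintegral_rpow_enorm_toReal
      (by simpa using hp0) ENNReal.ofReal_ne_top, ENNReal.toReal_ofReal hp0.le] at h2
    exact h2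
  have hfin : (⨅ γ ∈ plans μ ν, cost p γ) ≠ ⊤ :=
    ne_top_of_le_ne_top (cost_ne_top (prod_mem_plans μ ν) hp0.le)
      (iInf₂_le _ (prod_mem_plans μ ν))
  have hfin' : (⨅ γ ∈ plans μ ν, cost p γ) ^ (1 / p) ≠ ⊤ :=
    ENNReal.rpow_ne_top_of_nonneg (by positivity) hfin
  have main : ENNReal.ofReal |∫ x, ζ x ∂μ.meas - ∫ x, ζ x ∂ν.meas|
      ≤ ENNReal.ofReal C * (⨅ γ ∈ plans μ ν, cost p γ) ^ (1 / p) := by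
    rcases hC.eq_or_lt with rfl | hC
    · simpa using key _ (prod_mem_plans μ ν)
    have hC' : ENNReal.ofReal C ≠ 0 := by simpa using hC
    rw [mul_comm, ← ENNReal.div_le_iff hC' ENNReal.ofReal_ne_top, one_div,
      ENNReal.le_rpow_inv_iff hp0]
    refine le_iInf₂ fun γ hγ => ?_
    rw [← ENNReal.le_rpow_inv_iff hp0, ← one_div, ENNReal.div_le_iff hC' ENNReal.ofReal_ne_top,
      mul_comm]
    exact key γ hγ
  have := ENNReal.toReal_mono (ENNReal.mul_ne_top ENNReal.ofReal_ne_top hfin') main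
  rwa [ENNReal.toReal_ofReal (abs_nonneg _), ENNReal.toReal_mul, ENNReal.toReal_ofReal hC] at this

lemma abs_integral_sub_le_wass_of_continuous {p : ℝ} (hp : 1 ≤ p) {ζ : E d → ℝ}
    (hζ : Continuous ζ) {C : ℝ} (hC : 0 ≤ C) (hL : ∀ x y, |ζ x - ζ y| ≤ C * ‖x - y‖) (μ ν : Pc d) :
    |∫ x, ζ x ∂μ.meas - ∫ x, ζ x ∂ν.meas| ≤ C * wass p μ ν :=
  abs_integral_sub_le_wass (S := univ) hp hC μ ν hζ.aestronglyMeasurable hζ.aestronglyMeasurable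
    (by simp) (by simp) (fun x _ y _ => hL x y) (μ.integrable_of_continuous hζ)
    (ν.integrable_of_continuous hζ)

lemma abs_moment1_sub_le {p : ℝ} (hp : 1 ≤ p) (μ ν : Pc d) :
    |μ.moment1 - ν.moment1| ≤ wass p μ ν := by
  have := abs_integral_sub_le_wass_of_continuous hp (ζ := fun x : E d => ‖x‖) continuous_norm
    zero_le_one (fun x y => by simpa using abs_norm_sub_norm_le x y) μ ν
  simpa [Pc.moment1] using this

lemma wass_le_of_abs_modulus {p T : ℝ} {ν : ℝ → Pc d} {k : ℝ → ℝ}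
    (hk' : ∀ s t, 0 ≤ s → s ≤ t → t ≤ T → wass p (ν s) (ν t) ≤ ∫ τ in s..t, k τ)
    {s t : ℝ} (hs : s ∈ Icc 0 T) (ht : t ∈ Icc 0 T) :
    wass p (ν s) (ν t) ≤ |∫ τ in s..t, k τ| := by
  rcases le_total s t with h | h
  · exact (hk' s t hs.1 h ht.2).trans (le_abs_self _)
  · rw [wass_comm, intervalIntegral.integral_symm, abs_neg]
    exact (hk' t s ht.1 h hs.2).trans (le_abs_self _)

lemma IsACCurve.tendsto_wass {p T : ℝ} {ν : ℝ → Pc d} (hν : IsACCurve p T ν) {t : ℝ}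
    (ht : t ∈ Icc 0 T) : Tendsto (fun s => wass p (ν s) (ν t)) (𝓝[Icc 0 T] t) (𝓝 0) := by
  obtain ⟨k, hk, hk'⟩ := hν
  have h1 : Tendsto (fun s => |∫ τ in t..s, k τ|) (𝓝[Icc 0 T] t) (𝓝 0) := by
    have := (continuousOn_primitive_Icc hk.2 ht t ht).tendsto.abs
    simpa using this
  refine tendsto_of_tendsto_of_tendsto_of_le_of_le' tendsto_const_nhds h1
    (.of_forall fun _ => wass_nonneg _ _ _) ?_
  filter_upwards [self_mem_nhdsWithin] with s hs
  rw [wass_comm]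
  exact wass_le_of_abs_modulus hk' ht hs

end Measures

end WassLin

namespace WassLin

/-- First-order Taylor estimate for functions with Lipschitz derivative. -/
lemma norm_taylor_le {F G : Type*} [NormedAddCommGroup F] [NormedSpace ℝ F]
    [NormedAddCommGroup G] [NormedSpace ℝ G] {f : F → G} (hf : Differentiable ℝ f) {H : ℝ}
    (hH : ∀ x y, ‖fderiv ℝ f x - fderiv ℝ f y‖ ≤ H * ‖x - y‖) (hH0 : 0 ≤ H) (x y : F) :
    ‖f y - f x - fderiv ℝ f x (y - x)‖ ≤ H * ‖y - x‖ ^ 2 := by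
  have := Convex.norm_image_sub_le_of_norm_fderiv_le' (𝕜 := ℝ) (f := f) (C := H * ‖y - x‖)
    (s := segment ℝ x y) (x := x) (y := y) (φ := fderiv ℝ f x) (fun z _ => hf z)
    (fun z hz => (hH z x).trans (mul_le_mul_of_nonneg_left ?_ hH0)) (convex_segment x y)
    (left_mem_segment ℝ x y) (right_mem_segment ℝ x y)
  · rwa [mul_assoc, ← sq] at this
  · obtain ⟨θ, hθ, rfl⟩ := (segment_eq_image' ℝ x y ▸ hz : z ∈ _)
    simp only [add_sub_cancel_left, norm_smul, Real.norm_of_nonneg hθ.1]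
    exact mul_le_of_le_one_left (norm_nonneg _) hθ.2

/-! ### Wasserstein gradients expand to first order along arbitrary maps. -/

section Gradient

variable {d : ℕ}

/-- Smooth compactly supported functions have bounded, Lipschitz derivatives. -/
lemma exists_lipschitz_fderiv {F : Type*} [NormedAddCommGroup F] [NormedSpace ℝ F] {ζ : F → ℝ}
    (hζ : ContDiff ℝ (⊤ : ℕ∞) ζ) (hc : HasCompactSupport ζ) :
    ∃ H > 0, (∀ x, ‖fderiv ℝ ζ x‖ ≤ H) ∧ ∀ x y, ‖fderiv ℝ ζ x - fderiv ℝ ζ y‖ ≤ H * ‖x - y‖ := by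
  have h1 : ContDiff ℝ 1 (fderiv ℝ ζ) := hζ.fderiv_right (by norm_cast)
  obtain ⟨C, hC⟩ := h1.lipschitzWith_of_hasCompactSupport (hc.fderiv ℝ) one_ne_zero
  obtain ⟨D, hD⟩ := (hc.fderiv ℝ).exists_bound_of_continuous h1.continuous
  refine ⟨max (max C D) 1, by positivity,
    fun x => (hD x).trans ((le_max_right _ _).trans (le_max_left _ _)), fun x y => ?_⟩
  have := hC.dist_le_mul x y
  rw [dist_eq_norm, dist_eq_norm] at this
  exact this.trans (mul_le_mul_of_nonneg_right ((le_max_left _ _).trans (le_max_left _ _))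
    (norm_nonneg _))

lemma integrable_inner_of_mem_plans {μ ν : Pc d} {γ : Measure (E d × E d)} (hγ : γ ∈ plans μ ν)
    {ξ : E d → E d} (hξ : MemLp ξ 2 μ.meas) :
    Integrable (fun z : E d × E d => inner ℝ (ξ z.1) (z.2 - z.1)) γ := by
  have := isProbabilityMeasure_of_mem_plans hγ
  have h1 : Integrable (fun z : E d × E d => ξ z.1) γ := by
    have : Integrable ξ μ.meas := hξ.integrable (by norm_num)
    rw [← hγ.1] at this
    exact this.comp_measurable measurable_fst
  obtain ⟨C, hC⟩ := exists_ae_norm_le_of_mem_plans hγ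
  refine (h1.norm.mul_const (C + C)).mono' (h1.1.inner (by fun_prop)) (hC.mono fun z hz => ?_)
  refine (norm_inner_le_norm _ _).trans (mul_le_mul_of_nonneg_left ?_ (norm_nonneg _))
  exact (norm_sub_le _ _).trans (add_le_add ((norm_snd_le z).trans hz) ((norm_fst_le z).trans hz))

/-- For an element of the tangent space, the first-order term depends on the plan only to second
order. -/
lemma abs_integral_inner_sub_le {μ ν : Pc d} {ξ : E d → E d} (hξ : MemLp ξ 2 μ.meas) {ζ : E d → ℝ}
    (hζ : ContDiff ℝ (⊤ : ℕ∞) ζ) {ε H c : ℝ} (hε0 : 0 ≤ ε) (hH0 : 0 ≤ H) (hc : 0 ≤ c)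
    (hε : eLpNorm (fun x => ξ x - gradient ζ x) 2 μ.meas ≤ ENNReal.ofReal ε)
    (hH : ∀ x y, |ζ y - ζ x - fderiv ℝ ζ x (y - x)| ≤ H * ‖y - x‖ ^ 2)
    {γ : Measure (E d × E d)} (hγ : γ ∈ plans μ ν)
    (hcost : cost 2 γ ≤ ENNReal.ofReal c ^ (2 : ℝ)) :
    |∫ z, inner ℝ (ξ z.1) (z.2 - z.1) ∂γ - (∫ x, ζ x ∂ν.meas - ∫ x, ζ x ∂μ.meas)|
      ≤ ε * c + H * c ^ 2 := by
  have hζc : Continuous ζ := hζ.continuous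
  have hgc : Continuous (gradient ζ) :=
    (InnerProductSpace.toDual ℝ (E d)).symm.continuous.comp (hζ.continuous_fderiv (by simp))
  have hg2 : MemLp (gradient ζ) 2 μ.meas := by
    obtain ⟨C, -, hC⟩ := μ.exists_ae_norm_le_of_continuous hgc
    exact MemLp.of_bound hgc.aestronglyMeasurable C hC
  have hd2 : MemLp (fun x => ξ x - gradient ζ x) 2 μ.meas := hξ.sub hg2
  have i1 := integrable_inner_of_mem_plans hγ hξ
  have i2 := integrable_inner_of_mem_plans hγ hd2
  have i3 : Integrable (fun z : E d × E d => ζ z.2 - ζ z.1 - inner ℝ (gradient ζ z.1) (z.2 - z.1)) γ :=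
    integrable_of_mem_plans hγ (by fun_prop)
  have i4 : Integrable (fun z : E d × E d => ζ z.2) γ := integrable_of_mem_plans hγ (by fun_prop)
  have i5 : Integrable (fun z : E d × E d => ζ z.1) γ := integrable_of_mem_plans hγ (by fun_prop)
  have i6 : Integrable (fun z : E d × E d => ‖z.1 - z.2‖ ^ 2) γ :=
    integrable_of_mem_plans hγ (by fun_prop)
  -- The difference ζ(y) - ζ(x) integrates to a quantity that only involves the marginals. What is
  -- left is the replacement of ξ by ∇ζ, controlled by Cauchy–Schwarz, and the Taylor remainder of
  -- ζ, controlled by the quadratic cost.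
  have e : ∫ z, inner ℝ (ξ z.1) (z.2 - z.1) ∂γ - (∫ x, ζ x ∂ν.meas - ∫ x, ζ x ∂μ.meas)
      = ∫ z, inner ℝ (ξ z.1 - gradient ζ z.1) (z.2 - z.1) ∂γ
        - ∫ z, (ζ z.2 - ζ z.1 - inner ℝ (gradient ζ z.1) (z.2 - z.1)) ∂γ := by
    rw [← integral_snd_of_mem_plans hγ hζc.aestronglyMeasurable,
      ← integral_fst_of_mem_plans hγ hζc.aestronglyMeasurable, ← integral_sub i4 i5,
      ← integral_sub i1 (by exact i4.sub i5), ← integral_sub i2 i3]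
    refine integral_congr_ae (.of_forall fun z => ?_)
    simp only [inner_sub_left]
    ring
  have b1 : |∫ z, inner ℝ (ξ z.1 - gradient ζ z.1) (z.2 - z.1) ∂γ| ≤ ε * c := by
    rw [← ENNReal.ofReal_le_ofReal_iff (by positivity), ← Real.norm_eq_abs, ofReal_norm]
    refine (enorm_integral_le_lintegral_enorm _).trans ?_
    have h1 : ∫⁻ z, ‖(inner ℝ (ξ z.1 - gradient ζ z.1) (z.2 - z.1) : ℝ)‖ₑ ∂γ
        ≤ ∫⁻ z, ((fun z : E d × E d => ‖ξ z.1 - gradient ζ z.1‖ₑ) *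
            fun z : E d × E d => ‖z.1 - z.2‖ₑ) z ∂γ := by
      refine lintegral_mono fun z => ?_
      simp only [Pi.mul_apply]
      rw [← enorm_neg (z.1 - z.2), neg_sub, ← ofReal_norm, ← ofReal_norm, ← ofReal_norm,
        ← ENNReal.ofReal_mul (norm_nonneg _)]
      exact ENNReal.ofReal_le_ofReal (norm_inner_le_norm _ _)
    have hm : AEStronglyMeasurable (fun z : E d × E d => ξ z.1 - gradient ζ z.1) γ := by
      have := hd2.1
      rw [← hγ.1] at this
      exact this.comp_measurable measurable_fst
    refine h1.trans ((ENNReal.lintegral_mul_le_Lp_mul_Lq γ Real.HolderConjugate.two_two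
      hm.enorm (by fun_prop)).trans ?_)
    rw [ENNReal.ofReal_mul hε0]
    refine mul_le_mul' ?_ ?_
    · rw [eLpNorm_eq_lintegral_rpow_enorm_toReal (by norm_num) (by norm_num)] at hε
      simp only [ENNReal.toReal_ofNat] at hε
      refine le_trans (le_of_eq ?_) hε
      congr 1
      have hm2 : AEMeasurable (fun x => ‖ξ x - gradient ζ x‖ₑ ^ (2 : ℝ)) (γ.map Prod.fst) := by
        rw [hγ.1]; exact hd2.1.enorm.pow_const _
      have h3 := lintegral_map' hm2 measurable_fst.aemeasurable
      rw [hγ.1] at h3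
      exact h3.symm
    · refine (ENNReal.rpow_le_rpow hcost (by norm_num)).trans_eq ?_
      rw [← ENNReal.rpow_mul]; norm_num
  have b2 : |∫ z, (ζ z.2 - ζ z.1 - inner ℝ (gradient ζ z.1) (z.2 - z.1)) ∂γ| ≤ H * c ^ 2 := by
    have h1 : |∫ z, (ζ z.2 - ζ z.1 - inner ℝ (gradient ζ z.1) (z.2 - z.1)) ∂γ|
        ≤ ∫ z, H * ‖z.1 - z.2‖ ^ 2 ∂γ := by
      rw [← Real.norm_eq_abs]
      refine norm_integral_le_of_norm_le (i6.const_mul H) (.of_forall fun z => ?_)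
      rw [inner_gradient_left, Real.norm_eq_abs, norm_sub_rev]
      exact hH _ _
    refine h1.trans ?_
    rw [integral_const_mul]
    refine mul_le_mul_of_nonneg_left ?_ hH0
    rw [← ENNReal.ofReal_le_ofReal_iff (by positivity),
      ofReal_integral_eq_lintegral_ofReal i6 (.of_forall fun _ => by positivity)]
    calc _ = cost 2 γ := lintegral_congr fun z => by
          rw [ENNReal.ofReal_pow (norm_nonneg _), ofReal_norm]; norm_cast
      _ ≤ _ := hcost
      _ = _ := by rw [ENNReal.ofReal_pow hc]; norm_cast
  rw [e]
  exact (abs_sub _ _).trans (add_le_add b1 b2)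

/-- Makes push-forwards by nearby maps admissible in the localised inequality. The argument goes
through the open thickening of the support, which is measurable and is contained in the union of
closed balls. -/
lemma ae_mem_fattening {ρ : Pc d} {f g : C(E d, E d)} {R c : ℝ} (hcR : c < R)
    (h : ∀ᵐ x ∂ρ.meas, ‖f x - g x‖ ≤ c) : (ρ.push g).meas (fattening (ρ.push f) R)ᶜ = 0 := by
  set S := (ρ.push f).meas.support with hS
  have hsub : Metric.thickening R S ⊆ fattening (ρ.push f) R := by
    rw [Metric.thickening_eq_biUnion_ball]
    exact iUnion₂_mono fun x _ => Metric.ball_subset_closedBall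
  refine measure_mono_null (compl_subset_compl.2 hsub) ?_
  have hae : ∀ᵐ x ∂(ρ.push g).meas, x ∈ Metric.thickening R S := by
    refine (ae_map_iff (p := fun x => x ∈ Metric.thickening R S) g.continuous.aemeasurable
      Metric.isOpen_thickening.measurableSet).2 ?_
    have hs : ∀ᵐ x ∂ρ.meas, f x ∈ S :=
      ae_of_ae_map f.continuous.aemeasurable (Measure.support_mem_ae (μ := (ρ.push f).meas))
    filter_upwards [hs, h] with x h1 h2
    refine Metric.mem_thickening_iff.2 ⟨f x, h1, ?_⟩
    rw [dist_comm, dist_eq_norm]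
    exact h2.trans_lt hcR
  rw [ae_iff] at hae
  exact hae

/-- A localised subgradient lying in the tangent space gives a first-order lower bound along
arbitrary perturbations of the identity. -/
lemma IsLocSubgradient.lower_bound {φ : Pc d → ℝ} {ρ : Pc d} {f : C(E d, E d)} {ξ : E d → E d}
    (hs : IsLocSubgradient φ (ρ.push f) ξ) (ht : InTangent (ρ.push f) ξ) {δ : ℝ} (hδ : 0 < δ) :
    ∃ η > 0, ∀ (g : C(E d, E d)) (c : ℝ), 0 < c → c < η → (∀ᵐ x ∂ρ.meas, ‖f x - g x‖ ≤ c) →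
      ∫ x, inner ℝ (ξ (f x)) (g x - f x) ∂ρ.meas ≤ φ (ρ.push g) - φ (ρ.push f) + δ * c := by
  -- Budget for δ: a quarter for the o(W₂) term, a quarter for an almost minimising plan, and a
  -- quarter for each of the two comparisons with the potential ζ, in which gradient approximation
  -- and Taylor remainder take δ/8 each.
  obtain ⟨ζ, hζ, hζc, hζε⟩ := ht.2 (δ / 8) (by positivity)
  obtain ⟨H, hH0, -, hHl⟩ := exists_lipschitz_fderiv hζ hζc
  have hH := norm_taylor_le (hζ.differentiable (by simp)) hHl hH0.le
  obtain ⟨η₀, hη₀, hη⟩ := hs.2 1 one_pos (δ / 4) (by positivity)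
  refine ⟨min (min η₀ 1) (δ / (8 * H)), by positivity, fun g c hc hcη hfg => ?_⟩
  have hc1 : c < η₀ := hcη.trans_le ((min_le_left _ _).trans (min_le_left _ _))
  have hc2 : c < 1 := hcη.trans_le ((min_le_left _ _).trans (min_le_right _ _))
  have hc3 : c < δ / (8 * H) := hcη.trans_le (min_le_right _ _)
  have hW : wass 2 (ρ.push f) (ρ.push g) ≤ c := wass_push_le one_le_two hc.le hfg
  have h1 := hη (ρ.push g) (ae_mem_fattening hc2 hfg) (hW.trans_lt hc1)
  set r := φ (ρ.push g) - φ (ρ.push f) with hr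
  have h2 : (⨅ γ ∈ optPlans (ρ.push f) (ρ.push g),
      ((∫ z, inner ℝ (ξ z.1) (z.2 - z.1) ∂γ : ℝ) : EReal)) < ((r + δ / 2 * c : ℝ) : EReal) := by
    refine h1.trans_lt (EReal.coe_lt_coe_iff.2 ?_)
    nlinarith
  -- The strict inequality against the infimum already produces an optimal plan, since an empty
  -- infimum would be ⊤. Neither existence of optimal plans nor attainment has to be proved.
  simp only [iInf_lt_iff] at h2
  obtain ⟨γ, hγ, h3⟩ := h2
  rw [EReal.coe_lt_coe_iff] at h3
  set γ' := ρ.meas.map (fun x => (f x, g x)) with hγ'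
  have hγp : γ' ∈ plans (ρ.push f) (ρ.push g) := map_prodMk_mem_plans ρ f g
  have hcost : cost 2 γ' ≤ ENNReal.ofReal c ^ (2 : ℝ) := cost_map_prodMk_le two_pos.le hfg
  have a1 := abs_integral_inner_sub_le hs.1 hζ (by positivity) hH0.le hc.le hζε.le hH hγp hcost
  have a2 := abs_integral_inner_sub_le hs.1 hζ (by positivity) hH0.le hc.le hζε.le hH hγ.1
    ((hγ.2 γ' hγp).trans hcost)
  have e : ∫ z, inner ℝ (ξ z.1) (z.2 - z.1) ∂γ' = ∫ x, inner ℝ (ξ (f x)) (g x - f x) ∂ρ.meas :=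
    integral_map (by fun_prop) (integrable_inner_of_mem_plans hγp hs.1).1
  rw [e] at a1
  have h4 : H * c ^ 2 ≤ δ / 8 * c := by
    have : H * c ≤ δ / 8 := by
      rw [lt_div_iff₀ (by positivity)] at hc3
      linarith
    nlinarith
  rw [abs_le] at a1 a2
  linarith [a1.2, a2.1]

lemma InTangent.neg {μ : Pc d} {ξ : E d → E d} (h : InTangent μ ξ) :
    InTangent μ (fun x => -ξ x) := by
  refine ⟨h.1.neg, fun ε hε => ?_⟩
  obtain ⟨ζ, h1, h2, h3⟩ := h.2 ε hε
  refine ⟨fun x => -ζ x, h1.neg, h2.neg, ?_⟩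
  have : (fun x => -ξ x - gradient (fun x => -ζ x) x) = -(fun x => ξ x - gradient ζ x) := by
    funext x
    have : gradient (fun x => -ζ x) x = -gradient ζ x := by
      simp only [gradient, fderiv_fun_neg, map_neg]
    simp [this]; abel
  rwa [this, eLpNorm_neg]

/-- Wasserstein gradients are strong: first-order expansion along arbitrary perturbations. -/
lemma IsWassGradient.expansion {φ : Pc d → ℝ} {ρ : Pc d} {f : C(E d, E d)} {ξ : E d → E d}
    (h : IsWassGradient φ (ρ.push f) ξ) {δ : ℝ} (hδ : 0 < δ) :
    ∃ η > 0, ∀ (g : C(E d, E d)) (c : ℝ), 0 < c → c < η → (∀ᵐ x ∂ρ.meas, ‖f x - g x‖ ≤ c) →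
      |φ (ρ.push g) - φ (ρ.push f) - ∫ x, inner ℝ (ξ (f x)) (g x - f x) ∂ρ.meas| ≤ δ * c := by
  obtain ⟨η₁, h₁, H₁⟩ := h.2.1.lower_bound h.1 hδ
  obtain ⟨η₂, h₂, H₂⟩ := IsLocSubgradient.lower_bound h.2.2 h.1.neg hδ
  refine ⟨min η₁ η₂, lt_min h₁ h₂, fun g c hc hcη hfg => ?_⟩
  have a1 := H₁ g c hc (hcη.trans_le (min_le_left _ _)) hfg
  have a2 := H₂ g c hc (hcη.trans_le (min_le_right _ _)) hfg
  simp only [inner_neg_left, integral_neg] at a2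
  rw [abs_le]
  constructor <;> linarith

lemma IsWassGradient.hasDerivAt {φ : Pc d → ℝ} {ρ : Pc d} {f : C(E d, E d)} {ξ : E d → E d}
    (h : IsWassGradient φ (ρ.push f) ξ) (F : C(E d, E d)) :
    HasDerivAt (fun s : ℝ => φ (ρ.push (f + s • F))) (∫ x, inner ℝ (ξ (f x)) (F x) ∂ρ.meas) 0 := by
  obtain ⟨C, hC0, hC⟩ := ρ.exists_ae_norm_le_of_continuous F.continuous
  rw [hasDerivAt_iff_isLittleO_nhds_zero, Asymptotics.isLittleO_iff]
  intro ε hε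
  obtain ⟨η, hη, H⟩ := h.expansion (δ := ε / C) (by positivity)
  filter_upwards [Metric.ball_mem_nhds (0 : ℝ) (div_pos hη hC0)] with s hs
  rcases eq_or_ne s 0 with rfl | hs0
  · simp
  rw [mem_ball_zero_iff, lt_div_iff₀ hC0] at hs
  have := H (f + s • F) (‖s‖ * C) (by positivity) hs (hC.mono fun x hx => by
    simp only [ContinuousMap.coe_add, ContinuousMap.coe_smul, Pi.add_apply, Pi.smul_apply,
      sub_add_cancel_left, norm_neg, norm_smul]
    exact mul_le_mul_of_nonneg_left hx (norm_nonneg _))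
  have e : ∀ x, (inner ℝ (ξ (f x)) ((f + s • F) x - f x) : ℝ) = s * inner ℝ (ξ (f x)) (F x) := by
    intro x
    simp [inner_smul_right]
  simp only [e, integral_const_mul] at this
  have e0 : f + (0 : ℝ) • F = f := ContinuousMap.ext fun x => by simp
  simp only [zero_add, e0, smul_eq_mul]
  rw [Real.norm_eq_abs]
  refine this.trans_eq ?_
  field_simp

/-- Coordinate by coordinate, D(f(x))F(x) pairs F(x) with the gradient of a component of φ.
Measurability and integrability are thus inherited from the L² membership of these gradients, with
no regularity of D itself. -/
lemma integrable_differential_comp {φ : Pc d → E d} {ρ : Pc d} {f : C(E d, E d)}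
    {D : E d → E d →L[ℝ] E d} (h : IsWassDifferential φ (ρ.push f) D) (F : C(E d, E d)) :
    Integrable (fun x => D (f x) (F x)) ρ.meas ∧
    HasDerivAt (fun s : ℝ => φ (ρ.push (f + s • F))) (∫ x, D (f x) (F x) ∂ρ.meas) 0 := by
  have e1 : ∀ y : E d, ∑ i, y i • EuclideanSpace.single i (1 : ℝ) = y := fun y => by
    simpa using (EuclideanSpace.basisFun (Fin d) ℝ).sum_repr y
  have e2 : ∀ x i, D (f x) (F x) i = inner ℝ
      (ContinuousLinearMap.adjoint (D (f x)) (EuclideanSpace.single i 1)) (F x) := fun x i => by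
    rw [ContinuousLinearMap.adjoint_inner_left]; simp [EuclideanSpace.inner_single_left]
  have hi : ∀ i, Integrable (fun x => D (f x) (F x) i) ρ.meas := fun i => by
    simp only [e2]
    have h1 : MemLp (fun y => ContinuousLinearMap.adjoint (D y) (EuclideanSpace.single i 1)) 2
      (ρ.meas.map f) := (h i).1.1
    have h2 := (memLp_map_measure_iff h1.1 f.continuous.aemeasurable).1 h1
    obtain ⟨C, hC0, hC⟩ := ρ.exists_ae_norm_le_of_continuous F.continuous
    refine ((h2.integrable (by norm_num)).norm.mul_const C).mono'
      (h2.1.inner F.continuous.aestronglyMeasurable) (hC.mono fun x hx => ?_)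
    exact (norm_inner_le_norm _ _).trans (mul_le_mul_of_nonneg_left hx (norm_nonneg _))
  have e3 : (fun x => D (f x) (F x))
      = fun x => ∑ i, D (f x) (F x) i • EuclideanSpace.single i (1 : ℝ) := by
    funext x; exact (e1 _).symm
  have hi' : ∀ i ∈ Finset.univ, Integrable
      (fun x => D (f x) (F x) i • EuclideanSpace.single i (1 : ℝ)) ρ.meas :=
    fun i _ => (hi i).smul_const _
  constructor
  · rw [e3]; exact integrable_finsetSum _ hi'
  · rw [e3, integral_finsetSum _ hi']
    have e4 : (fun s : ℝ => φ (ρ.push (f + s • F)))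
        = fun s : ℝ => ∑ i, φ (ρ.push (f + s • F)) i • EuclideanSpace.single i (1 : ℝ) := by
      funext s; exact (e1 _).symm
    rw [e4]
    refine HasDerivAt.fun_sum fun i _ => ?_
    rw [integral_smul_const]
    simp only [e2]
    exact ((h i).hasDerivAt F).smul_const _

/-- Derivative of a Wasserstein differentiable map along a linear interpolation of maps. -/
lemma hasDerivAt_push {φ : Pc d → E d} {ρ : Pc d} {f F : C(E d, E d)} {θ : ℝ}
    {D : E d → E d →L[ℝ] E d} (h : IsWassDifferential φ (ρ.push (f + θ • F)) D) :
    HasDerivAt (fun s : ℝ => φ (ρ.push (f + s • F)))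
      (∫ x, D ((f + θ • F) x) (F x) ∂ρ.meas) θ := by
  have h1 := (integrable_differential_comp h F).2
  have h2 := HasDerivAt.comp_sub_const θ θ (f := fun s : ℝ => φ (ρ.push (f + θ • F + s • F)))
    (f' := ∫ x, D ((f + θ • F) x) (F x) ∂ρ.meas) (by simpa using h1)
  refine h2.congr_of_eventuallyEq (.of_forall fun s => ?_)
  simp only
  congr 1
  refine congrArg _ (ContinuousMap.ext fun x => ?_)
  simp only [ContinuousMap.add_apply, ContinuousMap.smul_apply, sub_smul]
  abel

end Gradient

end WassLin

namespace WassLin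

/-! ### The lifted field on the Banach space of Lagrangian maps. -/

section Lift

variable {d : ℕ} {p T ρ : ℝ}

/-- Continuous maps from the closed ball of radius `ρ` to `ℝ^d`. -/
abbrev BallMap (d : ℕ) (ρ : ℝ) : Type := C(Metric.closedBall (0 : E d) ρ, E d)

lemma retract_mem_closedBall (hρ : 0 < ρ) (x : E d) : retract ρ x ∈ Metric.closedBall (0 : E d) ρ := by
  simpa using norm_retract_le hρ x

/-- The radial retraction with values in the closed ball. -/
noncomputable def toBall (hρ : 0 < ρ) : C(E d, Metric.closedBall (0 : E d) ρ) where
  toFun x := ⟨retract ρ x, retract_mem_closedBall hρ x⟩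
  continuous_toFun := (continuous_retract hρ).subtype_mk _

lemma toBall_of_mem (hρ : 0 < ρ) (x : Metric.closedBall (0 : E d) ρ) : toBall hρ (x : E d) = x :=
  Subtype.ext (retract_of_le hρ (mem_closedBall_zero_iff.1 x.2))

/-- Extension of a map on a ball by radial retraction. -/
noncomputable def extend (hρ : 0 < ρ) (X : BallMap d ρ) : C(E d, E d) := X.comp (toBall hρ)

lemma extend_apply (hρ : 0 < ρ) (X : BallMap d ρ) (x : E d) :
    extend hρ X x = X (toBall hρ x) := rfl

lemma extend_coe (hρ : 0 < ρ) (X : BallMap d ρ) (x : Metric.closedBall (0 : E d) ρ) :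
    extend hρ X x = X x := by rw [extend_apply, toBall_of_mem]

lemma extend_of_norm_le (hρ : 0 < ρ) (X : BallMap d ρ) {x : E d} (hx : ‖x‖ ≤ ρ) :
    extend hρ X x = X ⟨x, by simpa using hx⟩ :=
  extend_coe hρ X ⟨x, by simpa using hx⟩

lemma norm_extend_le (hρ : 0 < ρ) (X : BallMap d ρ) (x : E d) : ‖extend hρ X x‖ ≤ ‖X‖ :=
  X.norm_coe_le_norm _

lemma norm_extend_sub_le (hρ : 0 < ρ) (X Y : BallMap d ρ) (x : E d) :
    ‖extend hρ X x - extend hρ Y x‖ ≤ ‖X - Y‖ :=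
  (X - Y).norm_coe_le_norm _

lemma push_extend_inBall (hρ : 0 < ρ) (μ : Pc d) {X : BallMap d ρ} {R : ℝ} (h : ‖X‖ ≤ R) :
    (μ.push (extend hρ X)).InBall R :=
  Pc.push_inBall (.of_forall fun x => (norm_extend_le hρ X x).trans h)

lemma wass_push_extend_le (hp : 1 ≤ p) (hρ : 0 < ρ) (μ : Pc d) (X Y : BallMap d ρ) :
    wass p (μ.push (extend hρ X)) (μ.push (extend hρ Y)) ≤ ‖X - Y‖ :=
  wass_push_le hp (norm_nonneg _) (.of_forall fun x => norm_extend_sub_le hρ X Y x)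

lemma HypCE.ae_continuous {v : ℝ → Pc d → E d → E d} (hv : HypCE p T v) :
    ∀ᵐ t ∂leb T, ∀ μ, Continuous (v t μ) := by
  choose l L hl hL H using fun n : ℕ => hv.lipschitz ((n : ℝ) + 1) (by positivity)
  filter_upwards [ae_all_iff.2 H] with t ht μ
  refine continuous_iff_continuousAt.2 fun x => ?_
  obtain ⟨R, hR0, hR⟩ := μ.exists_inBall
  obtain ⟨n, hn⟩ := exists_nat_gt (max R ‖x‖)
  have hn1 := (le_max_left _ _).trans_lt hn
  have hn2 := (le_max_right _ _).trans_lt hn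
  have hlip : LipschitzOnWith (Real.toNNReal (l n t)) (v t μ) (Metric.closedBall 0 ((n : ℝ) + 1)) :=
    LipschitzOnWith.of_dist_le_mul fun y hy z hz => by
      rw [dist_eq_norm, dist_eq_norm, Real.coe_toNNReal _ ((hl n).1 t)]
      exact (ht n μ μ (hR.mono (by linarith)) (hR.mono (by linarith)) y hy z hz).1
  refine hlip.continuousOn.continuousAt (Metric.closedBall_mem_nhds_of_mem ?_)
  simp only [mem_ball_zero_iff]; linarith

/-- A non-local velocity field, seen as a vector field on the space of (Lagrangian) maps. -/
noncomputable def liftField (v : ℝ → Pc d → E d → E d) (μ : Pc d) (hρ : 0 < ρ) (t : ℝ)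
    (X : BallMap d ρ) : BallMap d ρ :=
  -- The default value 0 is taken when the composite is not continuous. This can only happen for a
  -- null set of times, so it is invisible to integral equations.
  ContinuousMap.mkD (fun x => v t (μ.push (extend hρ X)) (X x)) 0

lemma liftField_apply {v : ℝ → Pc d → E d → E d} {μ : Pc d} {hρ : 0 < ρ} {t : ℝ}
    (h : ∀ μ, Continuous (v t μ)) (X : BallMap d ρ) (x : Metric.closedBall (0 : E d) ρ) :
    liftField v μ hρ t X x = v t (μ.push (extend hρ X)) (X x) :=
  ContinuousMap.mkD_apply_of_continuous ((h _).comp X.continuous)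

/-- The point is moved first at fixed measure, then the measure at fixed point; the second move
costs L·W_p ≤ L·‖X - Y‖, so the Lipschitz constant is l + L. The first moment of X_#μ is at most
‖X‖, whence the factor 2 in the growth bound. -/
lemma HypCE.caraField_lift (hp : 1 ≤ p) {v : ℝ → Pc d → E d → E d} (hv : HypCE p T v) (μ : Pc d)
    (hρ : 0 < ρ) : CaraField T (liftField v μ hρ) where
  meas X := by
    refine aestronglyMeasurable_of_eval fun x => ?_
    refine (hv.measurable (μ.push (extend hρ X)) (X x)).congr ?_
    filter_upwards [hv.ae_continuous] with t ht
    exact (liftField_apply ht X x).symm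
  growth := by
    obtain ⟨m, hm, hm'⟩ := hv.sublinear
    refine ⟨fun t => 2 * m t, hm.const_mul two_pos.le, ?_⟩
    filter_upwards [hv.ae_continuous, hm'] with t ht htm X
    have h0 : 0 ≤ 2 * m t * (1 + ‖X‖) := by have := hm.1 t; positivity
    refine (ContinuousMap.norm_le _ h0).2 fun x => ?_
    rw [liftField_apply ht]
    refine (htm _ _).trans ?_
    have h1 := X.norm_coe_le_norm x
    have h2 := (push_extend_inBall hρ μ (le_refl ‖X‖)).moment1_le
    have := hm.1 t
    nlinarith [mul_le_mul_of_nonneg_left h1 this, mul_le_mul_of_nonneg_left h2 this]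
  lip R hR := by
    obtain ⟨l, L, hl, hL, H⟩ := hv.lipschitz R hR
    refine ⟨fun t => l t + L t, hl.add hL, ?_⟩
    filter_upwards [hv.ae_continuous, H] with t ht H X hX Y hY
    have hX' : ‖X‖ ≤ R := by simpa using hX
    have hY' : ‖Y‖ ≤ R := by simpa using hY
    have h0 : 0 ≤ (l t + L t) * ‖X - Y‖ := by
      have := hl.1 t; have := hL.1 t; positivity
    refine (ContinuousMap.norm_le _ h0).2 fun x => ?_
    rw [ContinuousMap.sub_apply, liftField_apply ht, liftField_apply ht]
    have mX : X x ∈ Metric.closedBall (0 : E d) R := by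
      simpa using (X.norm_coe_le_norm x).trans hX'
    have mY : Y x ∈ Metric.closedBall (0 : E d) R := by
      simpa using (Y.norm_coe_le_norm x).trans hY'
    have bX := push_extend_inBall hρ μ hX'
    have bY := push_extend_inBall hρ μ hY'
    have h1 := (H _ _ bX bX _ mX _ mY).1
    have h2 := (H _ _ bX bY _ mY _ mY).2
    have h3 : ‖X x - Y x‖ ≤ ‖X - Y‖ := (X - Y).norm_coe_le_norm x
    have h4 := wass_push_extend_le hp hρ μ X Y
    calc _ = ‖(v t (μ.push (extend hρ X)) (X x) - v t (μ.push (extend hρ X)) (Y x))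
          + (v t (μ.push (extend hρ X)) (Y x) - v t (μ.push (extend hρ Y)) (Y x))‖ := by
            congr 1; abel
      _ ≤ l t * ‖X x - Y x‖ + L t * wass p (μ.push (extend hρ X)) (μ.push (extend hρ Y)) :=
        (norm_add_le _ _).trans (add_le_add h1 h2)
      _ ≤ _ := by
        rw [add_mul]
        exact add_le_add (mul_le_mul_of_nonneg_left h3 (hl.1 t))
          (mul_le_mul_of_nonneg_left h4 (hL.1 t))

/-- A Carathéodory field on `ℝ^d` is a non-local velocity field that ignores the measure. -/
lemma CaraField.hypCE {u : ℝ → E d → E d} (hu : CaraField T u) (p : ℝ) :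
    HypCE p T (fun t _ x => u t x) where
  measurable _ x := hu.meas x
  sublinear := by
    obtain ⟨m, hm, hm'⟩ := hu.growth
    refine ⟨m, hm, hm'.mono fun t ht μ x => (ht x).trans ?_⟩
    exact mul_le_mul_of_nonneg_left (by linarith [μ.moment1_nonneg]) (hm.1 t)
  lipschitz R hR := by
    obtain ⟨l, hl, hl'⟩ := hu.lip R hR
    refine ⟨l, fun _ => 0, hl, L1Nonneg.const le_rfl, hl'.mono fun t ht μ ν _ _ x hx y hy => ?_⟩
    exact ⟨ht x hx y hy, by simp⟩

lemma HypCELocal.caraField {w : ℝ → E d → E d} (hw : HypCELocal T w) : CaraField T w :=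
  ⟨hw.measurable, hw.sublinear, hw.lipschitz⟩

lemma CaraField.add {B : Type*} [NormedAddCommGroup B] [NormedSpace ℝ B] {f g : ℝ → B → B}
    (hf : CaraField T f) (hg : CaraField T g) : CaraField T (fun t x => f t x + g t x) where
  meas x := (hf.meas x).add (hg.meas x)
  growth := by
    obtain ⟨m, hm, hm'⟩ := hf.growth
    obtain ⟨n, hn, hn'⟩ := hg.growth
    refine ⟨_, hm.add hn, ?_⟩
    filter_upwards [hm', hn'] with t h1 h2 x
    exact (norm_add_le _ _).trans ((add_le_add (h1 x) (h2 x)).trans_eq (by ring))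
  lip R hR := by
    obtain ⟨m, hm, hm'⟩ := hf.lip R hR
    obtain ⟨n, hn, hn'⟩ := hg.lip R hR
    refine ⟨_, hm.add hn, ?_⟩
    filter_upwards [hm', hn'] with t h1 h2 x hx y hy
    rw [add_sub_add_comm]
    exact (norm_add_le _ _).trans ((add_le_add (h1 x hx y hy) (h2 x hx y hy)).trans_eq (by ring))

lemma CaraField.const_smul {B : Type*} [NormedAddCommGroup B] [NormedSpace ℝ B] {f : ℝ → B → B}
    (hf : CaraField T f) (c : ℝ) : CaraField T (fun t x => c • f t x) where
  meas x := (hf.meas x).const_smul c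
  growth := by
    obtain ⟨m, hm, hm'⟩ := hf.growth
    refine ⟨_, hm.const_mul (abs_nonneg c), ?_⟩
    filter_upwards [hm'] with t h1 x
    rw [norm_smul, Real.norm_eq_abs, mul_assoc]
    exact mul_le_mul_of_nonneg_left (h1 x) (abs_nonneg _)
  lip R hR := by
    obtain ⟨m, hm, hm'⟩ := hf.lip R hR
    refine ⟨_, hm.const_mul (abs_nonneg c), ?_⟩
    filter_upwards [hm'] with t h1 x hx y hy
    rw [← smul_sub, norm_smul, Real.norm_eq_abs, mul_assoc]
    exact mul_le_mul_of_nonneg_left (h1 x hx y hy) (abs_nonneg _)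

lemma HypCE.add_local {v : ℝ → Pc d → E d → E d} (hv : HypCE p T v) {w : ℝ → E d → E d}
    (hw : CaraField T w) : HypCE p T (fun t μ x => v t μ x + w t x) where
  measurable μ x := (hv.measurable μ x).add (hw.meas x)
  sublinear := by
    obtain ⟨m, hm, hm'⟩ := hv.sublinear
    obtain ⟨n, hn, hn'⟩ := (hw.hypCE p).sublinear
    refine ⟨_, hm.add hn, ?_⟩
    filter_upwards [hm', hn'] with t h1 h2 μ x
    exact (norm_add_le _ _).trans ((add_le_add (h1 μ x) (h2 μ x)).trans_eq (by ring))
  lipschitz R hR := by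
    obtain ⟨l, L, hl, hL, H⟩ := hv.lipschitz R hR
    obtain ⟨n, hn, hn'⟩ := hw.lip R hR
    refine ⟨_, L, hl.add hn, hL, ?_⟩
    filter_upwards [H, hn'] with t h1 h2 μ ν hμ hν x hx y hy
    refine ⟨?_, by simpa using (h1 μ ν hμ hν x hx y hy).2⟩
    rw [add_sub_add_comm]
    exact (norm_add_le _ _).trans ((add_le_add (h1 μ ν hμ hν x hx y hy).1
      (h2 x hx y hy)).trans_eq (by ring))

/-- Freezing the measure along a continuous curve of uniformly compactly supported measures. -/
lemma HypCE.caraField_frozen {v : ℝ → Pc d → E d → E d} (hv : HypCE p T v) {ν : ℝ → Pc d}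
    {R : ℝ} (hR : ∀ t ∈ Icc 0 T, (ν t).InBall R)
    (hc : ∀ t ∈ Icc 0 T, Tendsto (fun s => wass p (ν s) (ν t)) (𝓝[Icc 0 T] t) (𝓝 0)) :
    CaraField T (fun t x => v t (ν t) x) where
  meas x := by
    refine aestronglyMeasurable_diag (F := fun s t => v t (ν s) x) (fun s _ => hv.measurable _ _) ?_
    obtain ⟨l, L, hl, hL, H⟩ := hv.lipschitz (max (max R ‖x‖) 1) (by positivity)
    have hx : x ∈ Metric.closedBall (0 : E d) (max (max R ‖x‖) 1) := by simp
    have hRR : R ≤ max (max R ‖x‖) 1 := (le_max_left _ _).trans (le_max_left _ _)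
    filter_upwards [H, ae_leb_mem] with t ht htm
    have h1 := (hc t htm).const_mul (L t)
    rw [mul_zero] at h1
    refine tendsto_iff_norm_sub_tendsto_zero.2 (tendsto_of_tendsto_of_tendsto_of_le_of_le'
      tendsto_const_nhds h1 (.of_forall fun _ => norm_nonneg _) ?_)
    filter_upwards [self_mem_nhdsWithin] with s hs
    exact (ht _ _ ((hR s hs).mono hRR) ((hR t htm).mono hRR) x hx x hx).2
  growth := by
    obtain ⟨m, hm, hm'⟩ := hv.sublinear
    refine ⟨fun t => (1 + |R|) * m t, hm.const_mul (by positivity), ?_⟩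
    filter_upwards [hm', ae_leb_mem] with t ht htm x
    refine (ht _ _).trans ?_
    have h1 := (hR t htm).moment1_le.trans (le_abs_self R)
    have h2 : 1 + ‖x‖ + (ν t).moment1 ≤ (1 + |R|) * (1 + ‖x‖) := by
      nlinarith [norm_nonneg x, abs_nonneg R]
    nlinarith [mul_le_mul_of_nonneg_left h2 (hm.1 t)]
  lip r hr := by
    obtain ⟨l, L, hl, hL, H⟩ := hv.lipschitz (max r R) (lt_max_of_lt_left hr)
    refine ⟨l, hl, ?_⟩
    filter_upwards [H, ae_leb_mem] with t ht htm x hx y hy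
    have hb := (hR t htm).mono (le_max_right r R)
    exact (ht _ _ hb hb x (Metric.closedBall_subset_closedBall (le_max_left _ _) hx) y
      (Metric.closedBall_subset_closedBall (le_max_left _ _) hy)).1

lemma intervalIntegral_apply {K F : Type*} [TopologicalSpace K] [CompactSpace K]
    [NormedAddCommGroup F] [NormedSpace ℝ F] [CompleteSpace F] {f : ℝ → C(K, F)} {a b : ℝ}
    (hf : IntervalIntegrable f volume a b) (x : K) :
    (∫ s in a..b, f s) x = ∫ s in a..b, f s x :=
  ((ContinuousMap.evalCLM ℝ x).intervalIntegral_comp_comm hf).symm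

/-- Evaluations of a Lagrangian solution are characteristics. -/
lemma IsCaraSol.eval (hp : 1 ≤ p) {v : ℝ → Pc d → E d → E d} (hv : HypCE p T v) {μ : Pc d}
    {hρ : 0 < ρ} {r : ℝ} (hr : r ∈ Icc 0 T) {X₀ : BallMap d ρ} {X : ℝ → BallMap d ρ}
    (hX : IsCaraSol T (liftField v μ hρ) r X₀ X) (x : Metric.closedBall (0 : E d) ρ) :
    IsCaraSol T (fun t x => v t (μ.push (extend hρ (X t))) x) r (X₀ x) (fun t => X t x) where
  cont := (continuous_eval_const x).comp_continuousOn hX.cont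
  eqn t ht := by
    have hi := intervalIntegrable_of_mem_Icc
      ((hv.caraField_lift hp μ hρ).integrableOn_comp hX.cont) hr ht
    rw [hX.eqn t ht, ContinuousMap.add_apply, intervalIntegral_apply hi]
    congr 1
    refine intervalIntegral.integral_congr_ae_restrict ?_
    filter_upwards [ae_restrict_uIoc_of_ae_leb hv.ae_continuous hr ht] with s hs
    exact liftField_apply hs _ _

end Lift

end WassLin

namespace WassLin

/-! ### First-order dependence of Carathéodory solutions on the field and on the initial datum. -/

section AbstractDerivative

variable {B : Type*} [NormedAddCommGroup B] [NormedSpace ℝ B] {T : ℝ} {f g : ℝ → B → B}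

/-- The directional derivative of a Carathéodory field along a curve is, up to an integrable source
term, a Carathéodory field. -/
lemma CaraField.linearized (hf : CaraField T f) {X : ℝ → B} (hX : ContinuousOn X (Icc 0 T))
    {D : ℝ → B → B}
    (hD : ∀ᵐ t ∂leb T, ∀ Y, HasDerivAt (fun h : ℝ => f t (X t + h • Y)) (D t Y) 0)
    {b : ℝ → B} (hb : IntegrableOn b (Icc 0 T)) : CaraField T (fun t Y => D t Y + b t) := by
  obtain ⟨C, hC0, hC⟩ := exists_norm_le_of_continuousOn hX
  obtain ⟨l, hl, hl'⟩ := hf.lip (C + 1) (by positivity)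
  -- Difference quotients of f near X(t) are l(t)-Lipschitz in the direction, and this passes to the
  -- limit. Linearity of D in the direction is never needed.
  have lipD : ∀ᵐ t ∂leb T, ∀ Y Z, ‖D t Y - D t Z‖ ≤ l t * ‖Y - Z‖ := by
    filter_upwards [hl', hD, ae_leb_mem] with t ht hDt htm Y Z
    have h1 := ((hDt Y).sub (hDt Z)).tendsto_slope_zero.norm
    refine le_of_tendsto h1 ?_
    have hball : ∀ Y : B, ∀ᶠ h : ℝ in 𝓝[≠] 0, X t + h • Y ∈ Metric.closedBall (0 : B) (C + 1) := by
      intro Y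
      have hc : Tendsto (fun h : ℝ => X t + h • Y) (𝓝[≠] 0) (𝓝 (X t + (0 : ℝ) • Y)) :=
        (Continuous.tendsto (by fun_prop) 0).mono_left nhdsWithin_le_nhds
      rw [zero_smul, add_zero] at hc
      refine hc.eventually_mem (Metric.closedBall_mem_nhds_of_mem ?_)
      rw [mem_ball_zero_iff]; linarith [hC t htm]
    filter_upwards [hball Y, hball Z, self_mem_nhdsWithin] with h hY hZ h0
    have h0' : 0 < ‖h‖ := norm_pos_iff.2 h0
    simp only [Pi.sub_apply, zero_add, zero_smul, add_zero, sub_self, sub_zero]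
    rw [norm_smul, norm_inv, inv_mul_le_iff₀ h0']
    refine (ht _ hY _ hZ).trans_eq ?_
    rw [add_sub_add_left_eq_sub, ← smul_sub, norm_smul]; ring
  have D0 : ∀ᵐ t ∂leb T, D t 0 = 0 := by
    filter_upwards [hD] with t ht
    have h1 := ht 0
    simp only [smul_zero, add_zero] at h1
    exact h1.unique (hasDerivAt_const _ _)
  refine ⟨fun Y => ?_, ⟨fun t => l t + ‖b t‖, hl.add ⟨fun _ => norm_nonneg _, hb.norm⟩, ?_⟩,
    fun R _ => ⟨l, hl, ?_⟩⟩
  · refine AEStronglyMeasurable.add ?_ hb.1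
    refine aestronglyMeasurable_of_tendsto_ae (𝓝[≠] (0 : ℝ))
      (f := fun h t => h⁻¹ • (f t (X t + h • Y) - f t (X t))) (fun h => ?_) ?_
    · exact ((hf.aestronglyMeasurable_comp (hX.add continuousOn_const)).sub
        (hf.aestronglyMeasurable_comp hX)).const_smul _
    · filter_upwards [hD] with t ht
      simpa using (ht Y).tendsto_slope_zero
  · filter_upwards [lipD, D0] with t h1 h2 Y
    have h3 := h1 Y 0
    rw [h2, sub_zero, sub_zero] at h3
    refine (norm_add_le _ _).trans ?_
    nlinarith [hl.1 t, norm_nonneg (b t), mul_nonneg (norm_nonneg (b t)) (norm_nonneg Y)]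
  · filter_upwards [lipD] with t h1 Y _ Z _
    rw [add_sub_add_right_eq_sub]
    exact h1 Y Z

/-- The linearisation error along a curve is of first order, in the mean in time. -/
lemma CaraField.tendsto_consistency (hT : 0 ≤ T) (hf : CaraField T f) {X F : ℝ → B}
    (hX : ContinuousOn X (Icc 0 T)) (hF : ContinuousOn F (Icc 0 T)) {D : ℝ → B → B}
    (hD : ∀ᵐ t ∂leb T, ∀ Y, HasDerivAt (fun h : ℝ => f t (X t + h • Y)) (D t Y) 0) :
    IntegrableOn (fun s => D s (F s)) (Icc 0 T) ∧
    Tendsto (fun ε : ℝ => ∫ s in (0 : ℝ)..T,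
      |ε|⁻¹ * ‖f s (X s + ε • F s) - f s (X s) - ε • D s (F s)‖) (𝓝[≠] 0) (𝓝 0) := by
  have m0 : (0 : ℝ) ∈ Icc 0 T := left_mem_Icc.2 hT
  have mT : T ∈ Icc 0 T := right_mem_Icc.2 hT
  obtain ⟨C₂, hC₂, bX⟩ := exists_norm_le_of_continuousOn hX
  obtain ⟨C₃, hC₃, bF⟩ := exists_norm_le_of_continuousOn hF
  obtain ⟨l, hl, hl'⟩ := hf.lip (C₂ + C₃) (by positivity)
  have iX := hf.integrableOn_comp hX
  set r : ℝ → ℝ → B := fun ε s => f s (X s + ε • F s) - f s (X s) - ε • D s (F s) with hr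
  have hlin := hf.linearized hX hD (integrableOn_zero (μ := volume) (s := Icc 0 T))
  simp only [add_zero] at hlin
  have iD : IntegrableOn (fun s => D s (F s)) (Icc 0 T) := hlin.integrableOn_comp hF
  have ir : ∀ ε, IntegrableOn (r ε) (Icc 0 T) := fun ε =>
    ((hf.integrableOn_comp (hX.add (hF.const_smul ε))).sub iX).sub (iD.smul ε)
  refine ⟨iD, ?_⟩
  have rlim : Tendsto (fun ε : ℝ => ∫ s in (0 : ℝ)..T, |ε|⁻¹ * ‖r ε s‖) (𝓝[≠] 0)
      (𝓝 (∫ _ in (0 : ℝ)..T, (0 : ℝ))) := by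
    -- The pointwise limit is directional differentiability at time s. For |ε| < 1 the points X + εF
    -- stay in the ball of radius C₂ + C₃, and the Lipschitz bound there provides the dominating
    -- function.
    refine intervalIntegral.tendsto_integral_filter_of_dominated_convergence
      (fun s => C₃ * l s + ‖D s (F s)‖) ?_ ?_ ?_ ?_
    · exact .of_forall fun ε => (((intervalIntegrable_of_mem_Icc (ir ε) m0 mT).norm).const_mul _
        ).aestronglyMeasurable_restrict_uIoc
    · filter_upwards [self_mem_nhdsWithin,
        mem_nhdsWithin_of_mem_nhds (Metric.ball_mem_nhds (0 : ℝ) one_pos)] with ε h0 h1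
      have hε : 0 < |ε| := abs_pos.2 h0
      have h1' : |ε| < 1 := by simpa using h1
      refine (ae_restrict_iff' measurableSet_uIoc).1 (ae_restrict_uIoc_of_ae_leb ?_ m0 mT)
      filter_upwards [hl', ae_leb_mem] with s hs hsm
      rw [Real.norm_of_nonneg (by positivity), inv_mul_le_iff₀ hε]
      have hbF : |ε| * ‖F s‖ ≤ C₃ := (mul_le_of_le_one_left (norm_nonneg _) h1'.le).trans (bF s hsm)
      have h2 := hs (X s + ε • F s) (by
        rw [mem_closedBall_zero_iff]
        refine (norm_add_le _ _).trans ?_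
        rw [norm_smul, Real.norm_eq_abs]
        linarith [bX s hsm]) (X s) (by
        rw [mem_closedBall_zero_iff]; linarith [bX s hsm])
      rw [add_sub_cancel_left, norm_smul, Real.norm_eq_abs] at h2
      have h3 := _root_.norm_sub_le (f s (X s + ε • F s) - f s (X s)) (ε • D s (F s))
      rw [norm_smul, Real.norm_eq_abs] at h3
      have h4 := mul_le_mul_of_nonneg_left (bF s hsm) (mul_nonneg (hl.1 s) hε.le)
      simp only [hr]
      nlinarith
    · exact ((intervalIntegrable_of_mem_Icc hl.2 m0 mT).const_mul _).add
        (intervalIntegrable_of_mem_Icc iD m0 mT).norm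
    · refine (ae_restrict_iff' measurableSet_uIoc).1 (ae_restrict_uIoc_of_ae_leb ?_ m0 mT)
      filter_upwards [hD] with s hs
      have h1 := (hasDerivAt_iff_isLittleO_nhds_zero.1 (hs (F s)))
      have h2 := (h1.mono (nhdsWithin_le_nhds (s := {0}ᶜ))).norm_left.norm_right.tendsto_div_nhds_zero
      refine h2.congr fun ε => ?_
      simp only [hr, zero_add, zero_smul, add_zero, Real.norm_eq_abs]
      rw [div_eq_inv_mul]
  rwa [intervalIntegral.integral_zero] at rlim

set_option maxHeartbeats 1000000 in
/-- First-order dependence of Carathéodory solutions on a perturbation of the field and of the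
initial datum. -/
lemma CaraField.first_order (hT : 0 ≤ T) (hf : CaraField T f) (hg : CaraField T g)
    {X F : ℝ → B} {x₀ y₀ : B} (hX : IsCaraSol T f 0 x₀ X) {D : ℝ → B → B}
    (hD : ∀ᵐ t ∂leb T, ∀ Y, HasDerivAt (fun h : ℝ => f t (X t + h • Y)) (D t Y) 0)
    (hF : IsCaraSol T (fun t Y => D t Y + g t (X t)) 0 y₀ F) {Xε : ℝ → ℝ → B}
    (hXε : ∀ ε ∈ Icc (-1 : ℝ) 1,
      IsCaraSol T (fun t Y => f t Y + ε • g t Y) 0 (x₀ + ε • y₀) (Xε ε)) {δ : ℝ} (hδ : 0 < δ) :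
    ∃ η > 0, ∀ ε ∈ Icc (-1 : ℝ) 1, |ε| < η → ∀ t ∈ Icc 0 T,
      ‖Xε ε t - (X t + ε • F t)‖ ≤ δ * |ε| := by
  have m0 : (0 : ℝ) ∈ Icc 0 T := left_mem_Icc.2 hT
  have mT : T ∈ Icc 0 T := right_mem_Icc.2 hT
  obtain ⟨m, hm, hm'⟩ := hf.growth
  obtain ⟨n, hn, hn'⟩ := hg.growth
  set M := ∫ τ in (0 : ℝ)..T, (m τ + n τ) with hM
  set C₁ := 2 * (‖x₀‖ + ‖y₀‖ + M) * Real.exp (2 * M) with hC₁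
  have habs : ∀ ε ∈ Icc (-1 : ℝ) 1, |ε| ≤ 1 := fun ε hε => abs_le.2 ⟨hε.1, hε.2⟩
  have bXε : ∀ ε ∈ Icc (-1 : ℝ) 1, ∀ t ∈ Icc 0 T, ‖Xε ε t‖ ≤ C₁ := by
    intro ε hε t ht
    refine ((hXε ε hε).norm_le_of_growth (hm.add hn) ?_ m0 ht).trans ?_
    · filter_upwards [hm', hn'] with t h1 h2 x
      refine (norm_add_le _ _).trans ?_
      rw [norm_smul, add_mul]
      refine add_le_add (h1 x) ?_
      exact (mul_le_of_le_one_left (norm_nonneg _) (habs ε hε)).trans (h2 x)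
    · rw [hC₁]
      have : ‖x₀ + ε • y₀‖ ≤ ‖x₀‖ + ‖y₀‖ := by
        refine (norm_add_le _ _).trans (add_le_add_right ?_ _)
        rw [norm_smul]
        exact mul_le_of_le_one_left (norm_nonneg _) (habs ε hε)
      gcongr
  obtain ⟨C₂, hC₂, bX⟩ := exists_norm_le_of_continuousOn hX.cont
  obtain ⟨C₃, hC₃, bF⟩ := exists_norm_le_of_continuousOn hF.cont
  have hM0 : 0 ≤ M := (hm.add hn).integral_nonneg hT
  have hC₁0 : 0 ≤ C₁ := by positivity
  set ρ := C₁ + C₂ + C₃ with hρ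
  have hρ0 : 0 < ρ := by positivity
  obtain ⟨l, hl, hl'⟩ := hf.lip ρ hρ0
  obtain ⟨k, hk, hk'⟩ := hg.lip ρ hρ0
  set N := ∫ τ in (0 : ℝ)..T, n τ with hN
  set Λ := ∫ τ in (0 : ℝ)..T, l τ with hΛ
  have hN0 : 0 ≤ N := hn.integral_nonneg hT
  set C₄ := 2 * (‖y₀‖ + (1 + C₁) * N) * Real.exp (2 * Λ) with hC₄
  have hC₄0 : 0 ≤ C₄ := by positivity
  have iX := hf.integrableOn_comp hX.cont
  have igX := hg.integrableOn_comp hX.cont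
  have ifXε := fun ε hε => hf.integrableOn_comp (hXε ε hε).cont
  have igXε := fun ε hε => hg.integrableOn_comp (hXε ε hε).cont
  -- zeroth-order estimate
  have diff : ∀ ε ∈ Icc (-1 : ℝ) 1, ∀ t ∈ Icc 0 T, ‖Xε ε t - X t‖ ≤ |ε| * C₄ := by
    intro ε hε t ht
    have := norm_sub_le_of_lip (a := |ε| * (‖y₀‖ + (1 + C₁) * N)) hl m0 (hXε ε hε).cont hX.cont
      (Z := fun s => f s (Xε ε s) - f s (X s)) ?_ ?_ ht
    · refine this.trans_eq ?_
      rw [hC₄]; ring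
    · filter_upwards [hl', ae_leb_mem] with s hs hsm
      refine hs _ ?_ _ ?_ <;> rw [mem_closedBall_zero_iff]
      · linarith [bXε ε hε s hsm]
      · linarith [bX s hsm]
    · intro t ht
      have e : Xε ε t - X t = ε • y₀ + (∫ s in (0 : ℝ)..t, (f s (Xε ε s) - f s (X s)))
          + ε • ∫ s in (0 : ℝ)..t, g s (Xε ε s) := by
        have J := fun {φ : ℝ → B} (h : IntegrableOn φ (Icc 0 T)) =>
          intervalIntegrable_of_mem_Icc h m0 ht
        have j1 : IntervalIntegrable (fun s => ε • g s (Xε ε s)) volume 0 t := (J (igXε ε hε)).smul ε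
        rw [(hXε ε hε).eqn t ht, hX.eqn t ht, intervalIntegral.integral_sub
          (J (ifXε ε hε)) (J iX), intervalIntegral.integral_add (J (ifXε ε hε)) j1,
          intervalIntegral.integral_smul]
        abel
      have h1 : ‖∫ s in (0 : ℝ)..t, g s (Xε ε s)‖ ≤ (1 + C₁) * N := by
        refine (norm_integral_le_of_ae_leb (hn.const_mul (c := 1 + C₁) (by positivity)).2
          ?_ m0 ht).trans ?_
        · filter_upwards [hn', ae_leb_mem] with s hs hsm
          refine (hs _).trans ?_
          rw [mul_comm]
          exact mul_le_mul_of_nonneg_right (by linarith [bXε ε hε s hsm]) (hn.1 s)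
        · rw [intervalIntegral.integral_const_mul, abs_mul, abs_of_nonneg (by positivity)]
          exact mul_le_mul_of_nonneg_left (hn.integral_le_total m0 ht) (by positivity)
      rw [e]
      have h2 := mul_le_mul_of_nonneg_left h1 (abs_nonneg ε)
      refine (norm_add₃_le ..).trans ?_
      rw [norm_smul, norm_smul, Real.norm_eq_abs]
      linarith
  set r : ℝ → ℝ → B := fun ε s => f s (X s + ε • F s) - f s (X s) - ε • D s (F s) with hr
  obtain ⟨iD, rlim⟩ := hf.tendsto_consistency hT hX.cont hF.cont hD
  have ir : ∀ ε, IntegrableOn (r ε) (Icc 0 T) := fun ε =>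
    ((hf.integrableOn_comp (hX.cont.add (hF.cont.const_smul ε))).sub iX).sub (iD.smul ε)
  -- conclusion
  set κ := 2 * Real.exp (2 * Λ) with hκ
  have hκ0 : 0 < κ := by positivity
  set Q := ∫ τ in (0 : ℝ)..T, k τ with hQ
  have hQ0 : 0 ≤ Q := hk.integral_nonneg hT
  have ev : ∀ᶠ ε : ℝ in 𝓝[≠] 0, ∫ s in (0 : ℝ)..T, |ε|⁻¹ * ‖r ε s‖ < δ / (2 * κ) :=
    rlim.eventually_lt_const (by positivity)
  rw [eventually_nhdsWithin_iff, Metric.eventually_nhds_iff] at ev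
  obtain ⟨η₁, hη₁, H⟩ := ev
  -- The consistency error and the variation of the perturbing field, which is of order ε², are each
  -- made at most δ|ε|/(2κ), where κ is the Gronwall factor.
  refine ⟨min η₁ (δ / (2 * κ * (C₄ * Q + 1))), by positivity, fun ε hε hεη t ht => ?_⟩
  rcases eq_or_ne ε 0 with rfl | hε0
  · have := diff 0 hε t ht
    simpa using this
  have hεp : 0 < |ε| := abs_pos.2 hε0
  have hr1 : ∫ s in (0 : ℝ)..T, ‖r ε s‖ ≤ |ε| * (δ / (2 * κ)) := by
    have := H (y := ε) (by simpa using hεη.trans_le (min_le_left _ _)) hε0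
    rw [intervalIntegral.integral_const_mul, inv_mul_lt_iff₀ hεp] at this
    exact this.le
  have hq : |ε| * (C₄ * Q) ≤ δ / (2 * κ) := by
    have h1 : |ε| * (2 * κ * (C₄ * Q + 1)) < δ := by
      rw [← lt_div_iff₀ (by positivity)]; exact hεη.trans_le (min_le_right _ _)
    rw [le_div_iff₀ (by positivity)]
    nlinarith [mul_pos hεp hκ0]
  have := norm_sub_le_of_lip (a := |ε| * (δ / (2 * κ)) + |ε| * (|ε| * (C₄ * Q))) hl m0
    (hXε ε hε).cont (hX.cont.add (hF.cont.const_smul ε))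
    (Z := fun s => f s (Xε ε s) - f s (X s + ε • F s)) ?_ ?_ ht
  · refine this.trans ?_
    have h2 : 2 * (|ε| * (δ / (2 * κ)) + |ε| * (|ε| * (C₄ * Q))) * Real.exp (2 * Λ)
        = κ * (|ε| * (δ / (2 * κ)) + |ε| * (|ε| * (C₄ * Q))) := by rw [hκ]; ring
    rw [h2]
    have h3 := mul_le_mul_of_nonneg_left hq hεp.le
    have h4 : κ * (δ / (2 * κ)) = δ / 2 := by field_simp
    nlinarith [mul_le_mul_of_nonneg_left h3 hκ0.le]
  · filter_upwards [hl', ae_leb_mem] with s hs hsm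
    refine hs _ ?_ _ ?_ <;> rw [mem_closedBall_zero_iff]
    · linarith [bXε ε hε s hsm]
    · refine (norm_add_le _ _).trans ?_
      rw [norm_smul, Real.norm_eq_abs]
      linarith [bX s hsm, (mul_le_of_le_one_left (norm_nonneg _) (habs ε hε)).trans (bF s hsm)]
  · intro t ht
    have iXF := hf.integrableOn_comp (hX.cont.add (hF.cont.const_smul ε))
    -- Three contributions: a term absorbed by Gronwall, the consistency error of the linearisation
    -- along X, and the change of g between the perturbed and the reference solution.
    have e : Xε ε t - (X t + ε • F t) = (∫ s in (0 : ℝ)..t, (f s (Xε ε s) - f s (X s + ε • F s)))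
        + (∫ s in (0 : ℝ)..t, r ε s)
        + ε • ∫ s in (0 : ℝ)..t, (g s (Xε ε s) - g s (X s)) := by
      have J := fun {φ : ℝ → B} (h : IntegrableOn φ (Icc 0 T)) =>
        intervalIntegrable_of_mem_Icc h m0 ht
      have j1 : IntervalIntegrable (fun s => ε • g s (Xε ε s)) volume 0 t := (J (igXε ε hε)).smul ε
      have j2 : IntervalIntegrable (fun s => ε • D s (F s)) volume 0 t := (J iD).smul ε
      have j3 : IntervalIntegrable (fun s => f s (X s + ε • F s)) volume 0 t := J iXF
      have j4 : IntervalIntegrable (fun s => f s (X s + ε • F s) - f s (X s)) volume 0 t :=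
        j3.sub (J iX)
      simp only [hr]
      rw [(hXε ε hε).eqn t ht, hX.eqn t ht, hF.eqn t ht,
        intervalIntegral.integral_sub (J (ifXε ε hε)) j3,
        intervalIntegral.integral_sub j4 j2,
        intervalIntegral.integral_sub j3 (J iX), intervalIntegral.integral_smul,
        intervalIntegral.integral_sub (J (igXε ε hε)) (J igX),
        intervalIntegral.integral_add (J (ifXε ε hε)) j1,
        intervalIntegral.integral_smul, intervalIntegral.integral_add (J iD) (J igX)]
      simp only [smul_add, smul_sub]
      abel
    have h1 : ‖∫ s in (0 : ℝ)..t, r ε s‖ ≤ |ε| * (δ / (2 * κ)) := by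
      refine (intervalIntegral.norm_integral_le_integral_norm ht.1).trans (le_trans ?_ hr1)
      have := (L1Nonneg.integral_le_total (T := T) (l := fun s => ‖r ε s‖)
        ⟨fun _ => norm_nonneg _, (ir ε).norm⟩ m0 ht)
      exact (le_abs_self _).trans this
    have h2 : ‖∫ s in (0 : ℝ)..t, (g s (Xε ε s) - g s (X s))‖ ≤ |ε| * (C₄ * Q) := by
      refine (norm_integral_le_of_ae_leb (hk.const_mul (c := |ε| * C₄) (by positivity)).2
        ?_ m0 ht).trans ?_
      · filter_upwards [hk', ae_leb_mem] with s hs hsm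
        refine (hs _ ?_ _ ?_).trans ?_
        · rw [mem_closedBall_zero_iff]; linarith [bXε ε hε s hsm]
        · rw [mem_closedBall_zero_iff]; linarith [bX s hsm]
        · rw [mul_comm]
          exact mul_le_mul_of_nonneg_right (diff ε hε s hsm) (hk.1 s)
      · rw [intervalIntegral.integral_const_mul, abs_mul, abs_of_nonneg (by positivity), mul_assoc]
        gcongr
        exact hk.integral_le_total m0 ht
    change ‖Xε ε t - (X t + ε • F t)‖ ≤ _
    rw [e]
    refine (norm_add₃_le ..).trans ?_
    rw [norm_smul, Real.norm_eq_abs]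
    linarith [mul_le_mul_of_nonneg_left h2 hεp.le]

end AbstractDerivative

end WassLin

namespace WassLin

/-! ### Differentiability of the lifted field. -/

section Derivative

variable {d : ℕ} {p T ρ : ℝ}

lemma WContinuousOn.mono {X Y : Type} [PseudoMetricSpace X] [PseudoMetricSpace Y] {R R' : ℝ}
    {S S' : Set X} {f : Pc d → X → Y} (h : WContinuousOn p R' S' f) (hR : R ≤ R') (hS : S ⊆ S') :
    WContinuousOn p R S f := by
  intro μ hμ x hx ε hε
  obtain ⟨δ, hδ, H⟩ := h μ (hμ.mono hR) x (hS hx) ε hε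
  exact ⟨δ, hδ, fun ν hν y hy => H ν (hν.mono hR) y (hS hy)⟩

/-- The base measure is fixed, so only compactness of S is needed to obtain one δ for all points; no
compactness of the space of measures enters. The sets of the induction are not contained in S, which
is why the auxiliary statement carries membership in S separately. -/
lemma WContinuousOn.uniform (hp : 1 ≤ p) {X Y : Type} [PseudoMetricSpace X] [PseudoMetricSpace Y]
    {R : ℝ} {S : Set X} (hS : IsCompact S) {f : Pc d → X → Y} (h : WContinuousOn p R S f)
    {μ : Pc d} (hμ : μ.InBall R) {ε : ℝ} (hε : 0 < ε) :
    ∃ δ > 0, ∀ ν : Pc d, ν.InBall R → wass p μ ν < δ → ∀ x ∈ S, ∀ y ∈ S, dist x y < δ →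
      dist (f μ x) (f ν y) < ε := by
  suffices H : ∃ δ > 0, ∀ ν : Pc d, ν.InBall R → wass p μ ν < δ → ∀ x ∈ S, x ∈ S → ∀ y ∈ S,
      dist x y < δ → dist (f μ x) (f ν y) < ε by
    obtain ⟨δ, hδ, H⟩ := H
    exact ⟨δ, hδ, fun ν hν hw x hx => H ν hν hw x hx hx⟩
  refine hS.induction_on (p := fun A => ∃ δ > 0, ∀ ν : Pc d, ν.InBall R → wass p μ ν < δ →
    ∀ x ∈ A, x ∈ S → ∀ y ∈ S, dist x y < δ → dist (f μ x) (f ν y) < ε) ?_ ?_ ?_ ?_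
  · exact ⟨1, one_pos, fun _ _ _ x hx => hx.elim⟩
  · rintro A A' hA ⟨δ, hδ, H⟩
    exact ⟨δ, hδ, fun ν hν hw x hx => H ν hν hw x (hA hx)⟩
  · rintro A A' ⟨δ, hδ, H⟩ ⟨δ', hδ', H'⟩
    refine ⟨min δ δ', lt_min hδ hδ', fun ν hν hw x hx hxS y hy hxy => ?_⟩
    rcases hx with hx | hx
    · exact H ν hν (hw.trans_le (min_le_left _ _)) x hx hxS y hy (hxy.trans_le (min_le_left _ _))
    · exact H' ν hν (hw.trans_le (min_le_right _ _)) x hx hxS y hy (hxy.trans_le (min_le_right _ _))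
  · intro x hx
    obtain ⟨δ, hδ, H⟩ := h μ hμ x hx (ε / 2) (by positivity)
    refine ⟨Metric.ball x (δ / 2), mem_nhdsWithin_of_mem_nhds (Metric.ball_mem_nhds x (by positivity)),
      δ / 2, by positivity, fun ν hν hw z hz hzS y hy hzy => ?_⟩
    rw [Metric.mem_ball'] at hz
    have h1 := H μ hμ z hzS (by rw [wass_self hp]; exact hδ) (by linarith)
    have h2 := H ν hν y hy (by linarith) (by linarith [dist_triangle x z y])
    linarith [dist_triangle_left (f μ z) (f ν y) (f μ x)]

/-- Differentiability properties of a non-local velocity field at a fixed time. -/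
structure DiffField (p : ℝ) (v : Pc d → E d → E d) (D : Pc d → E d → E d → E d →L[ℝ] E d) :
    Prop where
  diff_x : ∀ μ, Differentiable ℝ (v μ)
  cont_x : ∀ R > 0, WContinuousOn p R (Metric.closedBall (0 : E d) R) (fun μ x => fderiv ℝ (v μ) x)
  diff_μ : ∀ μ x, IsWassDifferential (fun ν => v ν x) μ (D μ x)
  cont_μ : ∀ R > 0, WContinuousOn p R (Metric.closedBall (0 : E d) R ×ˢ Metric.closedBall (0 : E d) R)
      (fun μ z => D μ z.1 z.2)

/-- The null sets attached to the radii are merged over the integers, since the continuity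
conditions are monotone in the radius. -/
lemma HypH.ae_diffField {v : ℝ → Pc d → E d → E d} {Dμ : ℝ → Pc d → E d → E d → E d →L[ℝ] E d}
    (hv : HypH p T v Dμ) : ∀ᵐ t ∂leb T, DiffField p (v t) (Dμ t) := by
  filter_upwards [hv.diff_x, hv.diff_μ,
    ae_all_iff.2 fun n : ℕ => hv.cont_x ((n : ℝ) + 1) (by positivity),
    ae_all_iff.2 fun n : ℕ => hv.cont_μ ((n : ℝ) + 1) (by positivity)] with t h1 h2 h3 h4
  refine ⟨h1, fun R _ => ?_, h2, fun R _ => ?_⟩ <;> obtain ⟨n, hn⟩ := exists_nat_gt R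
  · exact (h3 n).mono (by linarith) (Metric.closedBall_subset_closedBall (by linarith))
  · exact (h4 n).mono (by linarith) (prod_mono (Metric.closedBall_subset_closedBall (by linarith))
      (Metric.closedBall_subset_closedBall (by linarith)))

lemma add_zero_smul_ballMap (X F : BallMap d ρ) : X + (0 : ℝ) • F = X :=
  ContinuousMap.ext fun x => by simp

/-- The derivative of the lifted field at `X` in the direction `F`. -/
noncomputable def liftDeriv (v : Pc d → E d → E d) (D : Pc d → E d → E d → E d →L[ℝ] E d) (μ : Pc d)
    (hρ : 0 < ρ) (X F : BallMap d ρ) (x : Metric.closedBall (0 : E d) ρ) : E d :=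
  fderiv ℝ (v (μ.push (extend hρ X))) (X x) (F x)
    + ∫ y, D (μ.push (extend hρ X)) (X x) (extend hρ X y) (extend hρ F y) ∂μ.meas

lemma norm_integral_diff_le {D D' : E d → E d →L[ℝ] E d} {μ : Pc d} {f f' F : C(E d, E d)}
    (h1 : Integrable (fun y => D (f y) (F y)) μ.meas)
    (h2 : Integrable (fun y => D' (f' y) (F y)) μ.meas) {e C : ℝ} (he : 0 ≤ e)
    (hF : ∀ y, ‖F y‖ ≤ C)
    (h : ∀ y, ‖D (f y) - D' (f' y)‖ ≤ e) :
    ‖(∫ y, D (f y) (F y) ∂μ.meas) - ∫ y, D' (f' y) (F y) ∂μ.meas‖ ≤ e * C := by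
  rw [← integral_sub h1 h2]
  refine (norm_integral_le_of_norm_le_const (C := e * C) (.of_forall fun y => ?_)).trans_eq
    (by simp)
  rw [← sub_apply]
  exact (ContinuousLinearMap.le_opNorm _ _).trans
    (mul_le_mul (h y) (hF y) (norm_nonneg _) he)

/-- The increment is cut at the perturbed measure with the unperturbed point: a move in space
followed by a move of the measure. Each is a mean value inequality in which the derivative is
compared with its value at h = 0 by uniform continuity. Uniformity in x is what yields a derivative
in the sup norm. -/
lemma DiffField.uniform_estimate (hp : 1 ≤ p) {v : Pc d → E d → E d}
    {D : Pc d → E d → E d → E d →L[ℝ] E d} (hv : DiffField p v D) (μ : Pc d) (hρ : 0 < ρ)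
    (X F : BallMap d ρ) {ε : ℝ} (hε : 0 < ε) :
    ∃ η > 0, ∀ h : ℝ, |h| < η → ∀ x,
      ‖v (μ.push (extend hρ (X + h • F))) ((X + h • F) x) - v (μ.push (extend hρ X)) (X x)
        - h • liftDeriv v D μ hρ X F x‖ ≤ ε * |h| := by
  set R := ‖X‖ + ‖F‖ + 1 with hR
  set M := ‖F‖ + 1 with hM
  have hM0 : 0 < M := by positivity
  have hR0 : 0 < R := by positivity
  have hε2 : 0 < ε / (2 * M) := by positivity
  have hb0 : (μ.push (extend hρ X)).InBall R :=
    push_extend_inBall hρ μ (by linarith [norm_nonneg F])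
  obtain ⟨δ₁, hδ₁, H₁⟩ := (hv.cont_x R hR0).uniform hp (isCompact_closedBall _ _) hb0 hε2
  obtain ⟨δ₂, hδ₂, H₂⟩ := (hv.cont_μ R hR0).uniform hp
    ((isCompact_closedBall _ _).prod (isCompact_closedBall _ _)) hb0 hε2
  refine ⟨min 1 (min δ₁ δ₂ / M), by positivity, fun h hh x => ?_⟩
  have hh1 : |h| ≤ 1 := (hh.trans_le (min_le_left _ _)).le
  have hhM : |h| * M < min δ₁ δ₂ := by
    rw [← lt_div_iff₀ hM0]; exact hh.trans_le (min_le_right _ _)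
  have small : ∀ θ : ℝ, |θ| ≤ |h| → ‖θ • F‖ < min δ₁ δ₂ := by
    intro θ hθ
    rw [norm_smul, Real.norm_eq_abs]
    refine lt_of_le_of_lt ?_ hhM
    exact mul_le_mul hθ (by linarith) (norm_nonneg _) (abs_nonneg _)
  have small1 : ∀ θ : ℝ, |θ| ≤ |h| → ‖θ • F‖ ≤ ‖F‖ := by
    intro θ hθ
    rw [norm_smul, Real.norm_eq_abs]
    exact mul_le_of_le_one_left (norm_nonneg _) (hθ.trans hh1)
  have bθ : ∀ θ : ℝ, |θ| ≤ |h| → ‖X + θ • F‖ ≤ R := fun θ hθ =>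
    (norm_add_le _ _).trans (by linarith [small1 θ hθ])
  have inb : ∀ θ : ℝ, |θ| ≤ |h| → (μ.push (extend hρ (X + θ • F))).InBall R := fun θ hθ =>
    push_extend_inBall hρ μ (bθ θ hθ)
  have wθ : ∀ θ : ℝ, |θ| ≤ |h| →
      wass p (μ.push (extend hρ X)) (μ.push (extend hρ (X + θ • F))) < min δ₁ δ₂ := by
    intro θ hθ
    refine (wass_push_extend_le hp hρ μ _ _).trans_lt ?_
    rw [sub_add_cancel_left, norm_neg]
    exact small θ hθ
  have memb : ∀ (Y : BallMap d ρ), ‖Y‖ ≤ R → ∀ x, Y x ∈ Metric.closedBall (0 : E d) R :=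
    fun Y hY x => mem_closedBall_zero_iff.2 ((Y.norm_coe_le_norm x).trans hY)
  have hXR : ‖X‖ ≤ R := by linarith [norm_nonneg F]
  have hFx : ‖F x‖ ≤ ‖F‖ := F.norm_coe_le_norm x
  -- variation in space
  have T1 : ‖v (μ.push (extend hρ (X + h • F))) ((X + h • F) x)
      - v (μ.push (extend hρ (X + h • F))) (X x)
      - h • fderiv ℝ (v (μ.push (extend hρ X))) (X x) (F x)‖ ≤ ε / 2 * |h| := by
    have h1 := Convex.norm_image_sub_le_of_norm_fderiv_le' (𝕜 := ℝ)
      (f := v (μ.push (extend hρ (X + h • F)))) (C := ε / (2 * M))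
      (s := segment ℝ (X x) ((X + h • F) x)) (x := X x) (y := (X + h • F) x)
      (φ := fderiv ℝ (v (μ.push (extend hρ X))) (X x)) (fun z _ => hv.diff_x _ z) ?_
      (convex_segment _ _) (left_mem_segment ℝ _ _) (right_mem_segment ℝ _ _)
    · have e : (X + h • F) x - X x = h • F x := by simp
      rw [e, map_smul, norm_smul, Real.norm_eq_abs] at h1
      refine h1.trans ?_
      have h2 : ‖F x‖ ≤ M := by linarith
      calc ε / (2 * M) * (|h| * ‖F x‖) ≤ ε / (2 * M) * (|h| * M) := by gcongr
        _ = _ := by field_simp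
    · intro z hz
      obtain ⟨θ, hθ, rfl⟩ := (segment_eq_image' ℝ (X x) ((X + h • F) x) ▸ hz : z ∈ _)
      have hθh : |θ * h| ≤ |h| := by
        rw [abs_mul, abs_of_nonneg hθ.1]
        exact mul_le_of_le_one_left (abs_nonneg _) hθ.2
      have ez : X x + θ • ((X + h • F) x - X x) = (X + (θ * h) • F) x := by
        simp [smul_smul]
      simp only [ez]
      rw [← dist_eq_norm, dist_comm]
      refine (H₁ _ (inb h le_rfl) ((wθ h le_rfl).trans_le (min_le_left _ _)) _ (memb X hXR x) _
        (memb _ (bθ _ hθh) x) ?_).le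
      rw [dist_comm, dist_eq_norm, ContinuousMap.add_apply, add_sub_cancel_left]
      exact ((((θ * h) • F).norm_coe_le_norm x).trans_lt (small _ hθh)).trans_le (min_le_left _ _)
  -- variation in the measure
  set I : ℝ → E d := fun θ => ∫ y, D (μ.push (extend hρ (X + θ • F))) (X x)
    (extend hρ (X + θ • F) y) (extend hρ F y) ∂μ.meas with hI
  have hI0 : I 0 = ∫ y, D (μ.push (extend hρ X)) (X x) (extend hρ X y) (extend hρ F y) ∂μ.meas := by
    have : X + (0 : ℝ) • F = X := add_zero_smul_ballMap X F
    simp only [hI, this]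
  have T2 : ‖v (μ.push (extend hρ (X + h • F))) (X x) - v (μ.push (extend hρ X)) (X x)
      - h • I 0‖ ≤ ε / 2 * |h| := by
    have hder : ∀ θ : ℝ, HasDerivAt (fun s : ℝ => v (μ.push (extend hρ (X + s • F))) (X x)) (I θ) θ :=
      fun θ => hasDerivAt_push (φ := fun ν => v ν (X x)) (ρ := μ) (f := extend hρ X)
        (F := extend hρ F) (θ := θ) (hv.diff_μ _ _)
    have hint : ∀ θ : ℝ, Integrable (fun y => D (μ.push (extend hρ (X + θ • F))) (X x)
        (extend hρ (X + θ • F) y) (extend hρ F y)) μ.meas := fun θ =>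
      (integrable_differential_comp (φ := fun ν => v ν (X x)) (ρ := μ)
        (f := extend hρ (X + θ • F)) (hv.diff_μ _ _) (extend hρ F)).1
    -- Subtracting the linear function s·I(0) leaves a function with derivative I(s) - I(0), which
    -- is small by continuity of the Wasserstein differential.
    have h1 := Convex.norm_image_sub_le_of_norm_hasDerivWithin_le
      (f := fun s : ℝ => v (μ.push (extend hρ (X + s • F))) (X x) - s • I 0)
      (f' := fun s => I s - (1 : ℝ) • I 0) (C := ε / (2 * M) * ‖F‖) (s := Metric.closedBall 0 |h|)
      (x := 0) (y := h)
      (fun θ _ => ((hder θ).sub ((hasDerivAt_id θ).smul_const (I 0))).hasDerivWithinAt) ?_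
      (convex_closedBall _ _) (by simp) (by simp)
    · have e0 : X + (0 : ℝ) • F = X := add_zero_smul_ballMap X F
      simp only [e0, zero_smul, sub_zero, Real.norm_eq_abs] at h1
      rw [sub_right_comm]
      refine h1.trans (mul_le_mul_of_nonneg_right ?_ (abs_nonneg _))
      have : ‖F‖ ≤ M := by linarith
      calc ε / (2 * M) * ‖F‖ ≤ ε / (2 * M) * M := by gcongr
        _ = _ := by field_simp
    · intro θ hθ
      have hθ' : |θ| ≤ |h| := by simpa using hθ
      rw [one_smul, hI0, ← norm_neg, neg_sub]
      have i0 := hint 0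
      have e0 : X + (0 : ℝ) • F = X := add_zero_smul_ballMap X F
      rw [e0] at i0
      refine norm_integral_diff_le i0 (hint θ) hε2.le (norm_extend_le hρ F) fun y => ?_
      rw [← dist_eq_norm]
      refine (H₂ _ (inb θ hθ') ((wθ θ hθ').trans_le (min_le_right _ _)) (X x, extend hρ X y)
        ⟨memb X hXR x, memb X hXR _⟩ (X x, extend hρ (X + θ • F) y)
        ⟨memb X hXR x, memb _ (bθ _ hθ') _⟩ ?_).le
      rw [Prod.dist_eq, dist_self]
      refine max_lt hδ₂ ?_
      rw [dist_comm, dist_eq_norm, extend_apply, extend_apply, ContinuousMap.add_apply,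
        add_sub_cancel_left]
      exact (((θ • F).norm_coe_le_norm _).trans_lt (small _ hθ')).trans_le (min_le_right _ _)
  have e : v (μ.push (extend hρ (X + h • F))) ((X + h • F) x) - v (μ.push (extend hρ X)) (X x)
        - h • liftDeriv v D μ hρ X F x
      = (v (μ.push (extend hρ (X + h • F))) ((X + h • F) x)
        - v (μ.push (extend hρ (X + h • F))) (X x)
        - h • fderiv ℝ (v (μ.push (extend hρ X))) (X x) (F x))
      + (v (μ.push (extend hρ (X + h • F))) (X x) - v (μ.push (extend hρ X)) (X x) - h • I 0) := by
    rw [liftDeriv, ← hI0, smul_add]; abel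
  rw [e]
  refine (norm_add_le _ _).trans ((add_le_add T1 T2).trans_eq (by ring))

/-- The lifted field is directionally differentiable. -/
lemma DiffField.hasDerivAt_lift (hp : 1 ≤ p) {v : ℝ → Pc d → E d → E d} {t : ℝ}
    {D : Pc d → E d → E d → E d →L[ℝ] E d} (hv : DiffField p (v t) D) (μ : Pc d) (hρ : 0 < ρ)
    (X F : BallMap d ρ) : Continuous (liftDeriv (v t) D μ hρ X F) ∧
    HasDerivAt (fun h : ℝ => liftField v μ hρ t (X + h • F))
      (ContinuousMap.mkD (liftDeriv (v t) D μ hρ X F) 0) 0 := by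
  have hc : ∀ μ, Continuous (v t μ) := fun μ => (hv.diff_x μ).continuous
  have hcont : Continuous (liftDeriv (v t) D μ hρ X F) := by
    -- The candidate derivative is continuous in x as a uniform limit of continuous difference
    -- quotients; no continuity under the integral sign has to be checked.
    have hu : TendstoUniformly (fun (h : ℝ) x => h⁻¹ • (liftField v μ hρ t (X + h • F) x
        - liftField v μ hρ t X x)) (liftDeriv (v t) D μ hρ X F) (𝓝[≠] 0) := by
      rw [Metric.tendstoUniformly_iff]
      intro ε hε
      obtain ⟨η, hη, H⟩ := hv.uniform_estimate hp μ hρ X F (half_pos hε)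
      filter_upwards [self_mem_nhdsWithin,
        mem_nhdsWithin_of_mem_nhds (Metric.ball_mem_nhds (0 : ℝ) hη)] with h h0 h1 x
      have h0' : 0 < |h| := abs_pos.2 h0
      have := H h (by simpa using h1) x
      rw [dist_comm, dist_eq_norm, liftField_apply hc, liftField_apply hc]
      have e : h⁻¹ • (v t (μ.push (extend hρ (X + h • F))) ((X + h • F) x)
          - v t (μ.push (extend hρ X)) (X x)) - liftDeriv (v t) D μ hρ X F x
          = h⁻¹ • (v t (μ.push (extend hρ (X + h • F))) ((X + h • F) x)
          - v t (μ.push (extend hρ X)) (X x) - h • liftDeriv (v t) D μ hρ X F x) := by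
        rw [smul_sub h⁻¹ _ (h • _), smul_smul, inv_mul_cancel₀ h0, one_smul]
      rw [e, norm_smul, norm_inv, Real.norm_eq_abs, inv_mul_lt_iff₀ h0']
      nlinarith
    exact hu.continuous (.of_forall fun h => by fun_prop)
  refine ⟨hcont, ?_⟩
  rw [hasDerivAt_iff_isLittleO_nhds_zero, Asymptotics.isLittleO_iff]
  intro ε hε
  obtain ⟨η, hη, H⟩ := hv.uniform_estimate hp μ hρ X F hε
  filter_upwards [Metric.ball_mem_nhds (0 : ℝ) hη] with h h1
  rw [Real.norm_eq_abs]
  refine (ContinuousMap.norm_le _ (by positivity)).2 fun x => ?_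
  have e0 : X + (0 : ℝ) • F = X := add_zero_smul_ballMap X F
  simp only [zero_add, e0]
  rw [ContinuousMap.sub_apply, ContinuousMap.sub_apply, ContinuousMap.smul_apply,
    ContinuousMap.mkD_apply_of_continuous hcont, liftField_apply hc, liftField_apply hc]
  exact H h (by simpa using h1) x

end Derivative

end WassLin

namespace WassLin

/-! ### From the distributional equation to an integral identity for spatial test functions. -/

section WeakForm

variable {d : ℕ} {p T : ℝ}

/-- A function whose increments are controlled by an integral is absolutely continuous. -/
lemma absolutelyContinuousOnInterval_of_increment_le {f k : ℝ → ℝ} (hT : 0 ≤ T)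
    (hk : IntegrableOn k (Icc 0 T))
    (h : ∀ s ∈ Icc 0 T, ∀ t ∈ Icc 0 T, |f s - f t| ≤ |∫ τ in s..t, k τ|) :
    AbsolutelyContinuousOnInterval f 0 T := by
  have m0 : (0 : ℝ) ∈ Icc 0 T := left_mem_Icc.2 hT
  have hK := (intervalIntegrable_of_mem_Icc hk m0
    (right_mem_Icc.2 hT)).absolutelyContinuousOnInterval_intervalIntegral (c := 0) (by simp)
  rw [absolutelyContinuousOnInterval_iff] at hK ⊢
  intro ε hε
  obtain ⟨δ, hδ, H⟩ := hK ε hε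
  refine ⟨δ, hδ, fun E hE hs => lt_of_le_of_lt (Finset.sum_le_sum fun i hi => ?_) (H E hE hs)⟩
  have hi' := hE.1 i hi
  rw [uIcc_of_le hT] at hi'
  rw [Real.dist_eq, dist_comm, Real.dist_eq, integral_sub_integral hk m0 hi'.1 hi'.2]
  exact h _ hi'.1 _ hi'.2

lemma IsACCurve.abs_integral_sub_le (hp : 1 ≤ p) {ν : ℝ → Pc d} {k : ℝ → ℝ}
    (hk' : ∀ s t, 0 ≤ s → s ≤ t → t ≤ T → wass p (ν s) (ν t) ≤ ∫ τ in s..t, k τ)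
    {ζ : E d → ℝ} (hζ : Continuous ζ) {C : ℝ} (hC : 0 ≤ C)
    (hL : ∀ x y, |ζ x - ζ y| ≤ C * ‖x - y‖) {s t : ℝ} (hs : s ∈ Icc 0 T) (ht : t ∈ Icc 0 T) :
    |∫ x, ζ x ∂(ν s).meas - ∫ x, ζ x ∂(ν t).meas| ≤ |∫ τ in s..t, C * k τ| := by
  refine (abs_integral_sub_le_wass_of_continuous hp hζ hC hL _ _).trans ?_
  rw [intervalIntegral.integral_const_mul, abs_mul, abs_of_nonneg hC]
  exact mul_le_mul_of_nonneg_left (wass_le_of_abs_modulus hk' hs ht) hC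

lemma abs_sub_le_of_fderiv {F : Type*} [NormedAddCommGroup F] [NormedSpace ℝ F] {ζ : F → ℝ}
    (hζ : Differentiable ℝ ζ) {C : ℝ} (hC : ∀ x, ‖fderiv ℝ ζ x‖ ≤ C) (x y : F) :
    |ζ x - ζ y| ≤ C * ‖x - y‖ := by
  have := Convex.norm_image_sub_le_of_norm_fderiv_le (𝕜 := ℝ) (f := ζ) (C := C) (s := univ)
    (x := y) (y := x) (fun z _ => hζ z) (fun z _ => hC z) convex_univ (mem_univ _) (mem_univ _)
  simpa using this

/-- Weak formulation with test functions `η(t) ζ(x)`. -/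
lemma SolvesNonlocalCE.separated (hT : 0 < T) {v : ℝ → Pc d → E d → E d} (hv : HypCE p T v)
    {ν : ℝ → Pc d} (h : SolvesNonlocalCE T v ν) {ζ : E d → ℝ} (hζ : ContDiff ℝ (⊤ : ℕ∞) ζ)
    (hζc : HasCompactSupport ζ) {η : ℝ → ℝ} (hη : ContDiff ℝ (⊤ : ℕ∞) η)
    (hηc : HasCompactSupport η) (hηs : tsupport η ⊆ Ioo 0 T) :
    IntervalIntegrable (fun t => deriv η t * (∫ x, ζ x ∂(ν t).meas)
      + η t * ∫ x, fderiv ℝ ζ x (v t (ν t) x) ∂(ν t).meas) volume 0 T ∧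
    ∫ t in (0 : ℝ)..T, (deriv η t * (∫ x, ζ x ∂(ν t).meas)
      + η t * ∫ x, fderiv ℝ ζ x (v t (ν t) x) ∂(ν t).meas) = 0 := by
  set ξ : ℝ × E d → ℝ := fun z => η z.1 * ζ z.2 with hξ
  have h1 : ContDiff ℝ (⊤ : ℕ∞) ξ := (hη.comp contDiff_fst).mul (hζ.comp contDiff_snd)
  have hsup : Function.support ξ ⊆ tsupport η ×ˢ tsupport ζ := fun z hz =>
    ⟨subset_tsupport _ (left_ne_zero_of_mul hz), subset_tsupport _ (right_ne_zero_of_mul hz)⟩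
  have h2 : HasCompactSupport ξ :=
    HasCompactSupport.of_support_subset_isCompact (hηc.isCompact.prod hζc.isCompact) hsup
  have h3 : tsupport ξ ⊆ Ioo 0 T ×ˢ univ :=
    (closure_minimal hsup ((isClosed_tsupport _).prod (isClosed_tsupport _))).trans
      (prod_mono hηs (subset_univ _))
  obtain ⟨i1, i2⟩ := h ξ h1 h2 h3
  have key : ∀ᵐ t ∂leb T, (∫ x, (deriv (fun s => ξ (s, x)) t
      + inner ℝ (gradient (fun y => ξ (t, y)) x) (v t (ν t) x)) ∂(ν t).meas)
      = deriv η t * (∫ x, ζ x ∂(ν t).meas)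
        + η t * ∫ x, fderiv ℝ ζ x (v t (ν t) x) ∂(ν t).meas := by
    filter_upwards [hv.ae_continuous] with t ht
    have e1 : ∀ x, deriv (fun s => ξ (s, x)) t
        + inner ℝ (gradient (fun y => ξ (t, y)) x) (v t (ν t) x)
        = deriv η t * ζ x + η t * fderiv ℝ ζ x (v t (ν t) x) := by
      intro x
      simp only [hξ]
      rw [inner_gradient_left, deriv_mul_const (hη.differentiable (by simp) t),
        fderiv_const_mul (hζ.differentiable (by simp) x)]
      simp
    simp only [e1]
    have c1 : Continuous fun x => fderiv ℝ ζ x (v t (ν t) x) :=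
      (hζ.continuous_fderiv (by simp)).clm_apply (ht (ν t))
    rw [integral_add (((ν t).integrable_of_continuous hζ.continuous).const_mul _)
      (((ν t).integrable_of_continuous c1).const_mul _), integral_const_mul, integral_const_mul]
  have m0 : (0 : ℝ) ∈ Icc 0 T := left_mem_Icc.2 hT.le
  have mT : T ∈ Icc 0 T := right_mem_Icc.2 hT.le
  have key' := ae_restrict_uIoc_of_ae_leb key m0 mT
  refine ⟨i1.congr_ae key', ?_⟩
  rw [← intervalIntegral.integral_congr_ae_restrict key']
  exact i2

/-- Along an absolutely continuous solution of a continuity equation, integrals of test functions are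
absolutely continuous, with the expected derivative. -/
lemma SolvesNonlocalCE.integral_sub (hT : 0 < T) (hp : 1 ≤ p) {v : ℝ → Pc d → E d → E d}
    (hv : HypCE p T v) {ν : ℝ → Pc d} (hac : IsACCurve p T ν) (h : SolvesNonlocalCE T v ν)
    {ζ : E d → ℝ} (hζ : ContDiff ℝ (⊤ : ℕ∞) ζ) (hζc : HasCompactSupport ζ) :
    IntegrableOn (fun t => ∫ x, fderiv ℝ ζ x (v t (ν t) x) ∂(ν t).meas) (Icc 0 T) ∧
    ∀ s ∈ Icc 0 T, ∀ t ∈ Icc 0 T, ∫ x, ζ x ∂(ν t).meas - ∫ x, ζ x ∂(ν s).meas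
      = ∫ τ in s..t, ∫ x, fderiv ℝ ζ x (v τ (ν τ) x) ∂(ν τ).meas := by
  have m0 : (0 : ℝ) ∈ Icc 0 T := left_mem_Icc.2 hT.le
  have mT : T ∈ Icc 0 T := right_mem_Icc.2 hT.le
  set f : ℝ → ℝ := fun t => ∫ x, ζ x ∂(ν t).meas with hf
  set g : ℝ → ℝ := fun t => ∫ x, fderiv ℝ ζ x (v t (ν t) x) ∂(ν t).meas with hg
  obtain ⟨H, hH0, hH, -⟩ := exists_lipschitz_fderiv hζ hζc
  obtain ⟨k, hk, hk'⟩ := hac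
  have fac : AbsolutelyContinuousOnInterval f 0 T :=
    absolutelyContinuousOnInterval_of_increment_le (k := fun τ => H * k τ) hT.le
      (hk.const_mul hH0.le).2 fun s hs t ht =>
        IsACCurve.abs_integral_sub_le hp hk' hζ.continuous hH0.le
          (abs_sub_le_of_fderiv (hζ.differentiable (by simp)) hH) hs ht
  have fi : IntegrableOn (deriv f) (Icc 0 T) :=
    (intervalIntegrable_iff_integrableOn_Icc_of_le hT.le).1 fac.intervalIntegrable_deriv
  have fc : ContinuousOn f (Icc 0 T) := by simpa [uIcc_of_le hT.le] using fac.continuousOn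
  have sep := fun (η : ℝ → ℝ) (h1 : ContDiff ℝ (⊤ : ℕ∞) η) h2 h3 =>
    h.separated hT hv hζ hζc (η := η) h1 h2 h3
  have gmul : ∀ η : ℝ → ℝ, ContDiff ℝ (⊤ : ℕ∞) η → HasCompactSupport η → tsupport η ⊆ Ioo 0 T →
      IntervalIntegrable (fun t => η t * g t) volume 0 T := by
    intro η h1 h2 h3
    have i1 : IntervalIntegrable (fun t => deriv η t * f t) volume 0 T := by
      rw [intervalIntegrable_iff_integrableOn_Icc_of_le hT.le]
      exact (((h1.continuous_deriv (by simp)).continuousOn (s := Icc 0 T)).mul fc).integrableOn_compact isCompact_Icc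
    have := (sep η h1 h2 h3).1.sub i1
    refine this.congr_ae (.of_forall fun t => ?_)
    simp [hf, hg]
  have ηac : ∀ η : ℝ → ℝ, ContDiff ℝ (⊤ : ℕ∞) η → AbsolutelyContinuousOnInterval η 0 T := by
    intro η h1
    have := IntervalIntegrable.absolutelyContinuousOnInterval_intervalIntegral (f := deriv η)
      (a := 0) (b := T) (c := 0) ((h1.continuous_deriv (by simp)).intervalIntegrable _ _) (by simp)
    refine absolutelyContinuousOnInterval_of_increment_le (k := deriv η) hT.le
      (h1.continuous_deriv (by simp)).continuousOn.integrableOn_Icc fun s hs t ht => ?_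
    rw [intervalIntegral.integral_deriv_eq_sub (fun x _ => h1.differentiable (by simp) x)
      ((h1.continuous_deriv (by simp)).intervalIntegrable _ _), abs_sub_comm]
  -- The weak form only gives integrability of η·g for cutoffs η. Near t₀ a cutoff exceeding 1/2 can
  -- be divided out.
  have hloc : LocallyIntegrableOn (fun t => g t - deriv f t) (Ioo 0 T) := by
    intro t₀ ht₀
    obtain ⟨η, e1, e2, e3, e4, e5⟩ := exists_contDiff_tsupport_subset (n := ⊤)
      (isOpen_Ioo.mem_nhds ht₀)
    have hV : IsOpen {t | 1 / 2 < η t} := isOpen_lt continuous_const e3.continuous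
    refine ⟨{t | 1 / 2 < η t} ∩ Ioo 0 T, inter_mem (mem_nhdsWithin_of_mem_nhds
      (hV.mem_nhds (by show 1 / 2 < η t₀; rw [e5]; norm_num))) self_mem_nhdsWithin, ?_⟩
    have hmV := hV.measurableSet.inter (measurableSet_Ioo (a := (0 : ℝ)) (b := T))
    refine Integrable.sub ?_ (fi.mono_set (inter_subset_right.trans Ioo_subset_Icc_self))
    have i0 : IntegrableOn (fun t => η t * g t) ({t | 1 / 2 < η t} ∩ Ioo 0 T) :=
      ((intervalIntegrable_iff_integrableOn_Icc_of_le hT.le).1 (gmul η e3 e2 e1)).mono_set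
        (inter_subset_right.trans Ioo_subset_Icc_self)
    have hpos : ∀ᵐ t ∂volume.restrict ({t | 1 / 2 < η t} ∩ Ioo 0 T), 1 / 2 < η t :=
      (ae_restrict_mem hmV).mono fun t ht => ht.1
    refine (i0.norm.const_mul 2).mono' ?_ (hpos.mono fun t ht => ?_)
    · refine ((e3.continuous.measurable.inv.aestronglyMeasurable).mul i0.1).congr
        (hpos.mono fun t ht => ?_)
      have : η t ≠ 0 := by linarith
      simp [this]
    · rw [norm_mul, Real.norm_of_nonneg (by linarith : 0 ≤ η t)]
      nlinarith [norm_nonneg (g t)]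
  -- Integration by parts for the absolutely continuous f shows that g and f' agree as
  -- distributions, hence almost everywhere.
  have hz : ∀ᵐ t, t ∈ Ioo 0 T → g t - deriv f t = 0 := by
    refine isOpen_Ioo.ae_eq_zero_of_integral_contDiff_smul_eq_zero hloc fun η h1 h2 h3 => ?_
    have a1 := (sep η h1 h2 h3).2
    have a2 := (ηac η h1).integral_mul_deriv_eq_deriv_mul fac
    have z0 : η 0 = 0 := image_eq_zero_of_notMem_tsupport fun h => (h3 h).1.ne rfl
    have zT : η T = 0 := image_eq_zero_of_notMem_tsupport fun h => (h3 h).2.ne rfl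
    rw [z0, zT] at a2
    have i1 : IntervalIntegrable (fun t => deriv η t * f t) volume 0 T := by
      rw [intervalIntegrable_iff_integrableOn_Icc_of_le hT.le]
      exact (((h1.continuous_deriv (by simp)).continuousOn (s := Icc 0 T)).mul fc).integrableOn_compact isCompact_Icc
    have i2 := gmul η h1 h2 h3
    have i3 : IntervalIntegrable (fun t => η t * deriv f t) volume 0 T :=
      fac.intervalIntegrable_deriv.continuousOn_mul h1.continuous.continuousOn
    have a3 : ∫ t in (0 : ℝ)..T, (deriv η t * f t + η t * g t) = 0 := a1
    rw [intervalIntegral.integral_add i1 i2] at a3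
    have a4 : ∫ t in (0 : ℝ)..T, η t • (g t - deriv f t) = 0 := by
      simp only [smul_eq_mul, mul_sub]
      rw [intervalIntegral.integral_sub i2 i3]
      linarith
    rw [← a4, intervalIntegral.integral_of_le hT.le]
    refine (setIntegral_eq_integral_of_forall_compl_eq_zero fun t ht => ?_).symm
    rw [image_eq_zero_of_notMem_tsupport fun h => ht (Ioo_subset_Ioc_self (h3 h)), zero_smul]
  have hae : g =ᵐ[leb T] deriv f := by
    rw [leb, ← restrict_Ioo_eq_restrict_Icc, EventuallyEq, ae_restrict_iff' measurableSet_Ioo]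
    filter_upwards [hz] with t ht hm using sub_eq_zero.1 (ht hm)
  refine ⟨fi.congr hae.symm, fun s hs t ht => ?_⟩
  have := (fac.mono (c := s) (d := t) (by
    rw [uIcc_of_le hT.le]
    exact (convex_Icc (0 : ℝ) T).ordConnected.uIcc_subset hs ht)).integral_deriv_eq_sub
  rw [← this]
  refine intervalIntegral.integral_congr_ae_restrict ?_
  filter_upwards [ae_restrict_uIoc_of_ae_leb hae hs ht] with t ht using ht.symm

end WeakForm

end WassLin

namespace WassLin

/-! ### A priori bound on the supports of solutions. -/

section SupportBound

variable {d : ℕ} {p T : ℝ}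

/-- The derivative of the transition function is C¹ and vanishes off [0,1], hence is Lipschitz; the
quadratic remainder is Taylor's formula. These are the bounds needed for the cutoff in the support
estimate. -/
lemma exists_smoothTransition_bounds : ∃ C > 0,
    (∀ a b : ℝ, |deriv Real.smoothTransition a - deriv Real.smoothTransition b| ≤ C * |a - b|) ∧
    ∀ a b : ℝ, |Real.smoothTransition b - Real.smoothTransition a
      - deriv Real.smoothTransition a * (b - a)| ≤ C * |b - a| ^ 2 := by
  have hs : ContDiff ℝ (⊤ : ℕ∞) Real.smoothTransition := Real.smoothTransition.contDiff
  have hd : ContDiff ℝ 1 (deriv Real.smoothTransition) := by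
    have : ContDiff ℝ (1 + 1) Real.smoothTransition := hs.of_le (by norm_cast)
    exact (contDiff_succ_iff_deriv.1 this).2.2
  have hc : HasCompactSupport (deriv Real.smoothTransition) := by
    refine HasCompactSupport.intro (K := Icc 0 1) isCompact_Icc fun x hx => ?_
    rw [mem_Icc, not_and_or, not_le, not_le] at hx
    rcases hx with hx | hx
    · have : Real.smoothTransition =ᶠ[𝓝 x] fun _ => 0 := by
        filter_upwards [Iio_mem_nhds hx] with y hy
        exact Real.smoothTransition.zero_of_nonpos (le_of_lt hy)
      rw [this.deriv_eq, deriv_const]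
    · have : Real.smoothTransition =ᶠ[𝓝 x] fun _ => 1 := by
        filter_upwards [Ioi_mem_nhds hx] with y hy
        exact Real.smoothTransition.one_of_one_le (le_of_lt hy)
      rw [this.deriv_eq, deriv_const]
  obtain ⟨C, hC⟩ := hd.lipschitzWith_of_hasCompactSupport hc one_ne_zero
  have h1 : ∀ a b : ℝ, |deriv Real.smoothTransition a - deriv Real.smoothTransition b|
      ≤ (C + 1) * |a - b| := fun a b => by
    have := hC.dist_le_mul a b
    rw [Real.dist_eq, Real.dist_eq] at this
    nlinarith [abs_nonneg (a - b)]
  refine ⟨C + 1, by positivity, h1, fun a b => ?_⟩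
  have h2 : Differentiable ℝ Real.smoothTransition := hs.differentiable (by simp)
  have h3 := norm_taylor_le h2 (H := C + 1) (fun x y => ?_) (by positivity) a b
  · have e : fderiv ℝ Real.smoothTransition a (b - a)
        = deriv Real.smoothTransition a * (b - a) := by
      rw [← toSpanSingleton_deriv]; simp [mul_comm]
    rwa [e] at h3
  · rw [← toSpanSingleton_deriv, ← toSpanSingleton_deriv]
    refine ContinuousLinearMap.opNorm_le_bound _ (by positivity) fun z => ?_
    have := mul_le_mul_of_nonneg_right (h1 x y) (norm_nonneg z)
    simpa [← mul_sub, mul_comm] using this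

/-- The logarithmic Lyapunov function used to bound supports. -/
noncomputable def logNorm (x : E d) : ℝ := Real.log (1 + ‖x‖ ^ 2) / 2

lemma contDiff_logNorm : ContDiff ℝ (⊤ : ℕ∞) (logNorm (d := d)) := by
  have : ContDiff ℝ (⊤ : ℕ∞) (fun x : E d => 1 + ‖x‖ ^ 2) := contDiff_const.add (contDiff_norm_sq ℝ)
  exact (this.log fun x => by positivity).div_const 2

lemma fderiv_logNorm (x w : E d) : fderiv ℝ logNorm x w = inner ℝ x w / (1 + ‖x‖ ^ 2) := by
  have h1 : HasFDerivAt (fun x : E d => 1 + ‖x‖ ^ 2) (2 • innerSL ℝ x) x :=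
    (hasStrictFDerivAt_norm_sq x).hasFDerivAt.const_add 1
  have h2 := (h1.log (by positivity)).mul_const (1 / 2)
  have h3 : (logNorm : E d → ℝ) = fun x => Real.log (1 + ‖x‖ ^ 2) * (1 / 2) := by
    funext x; rw [logNorm]; ring
  rw [h3, h2.fderiv]
  simp
  ring

lemma norm_fderiv_logNorm_le (x : E d) : ‖fderiv ℝ logNorm x‖ ≤ 1 := by
  refine ContinuousLinearMap.opNorm_le_bound _ zero_le_one fun w => ?_
  rw [fderiv_logNorm, norm_div, Real.norm_eq_abs, Real.norm_of_nonneg (by positivity),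
    div_le_iff₀ (by positivity)]
  have := abs_real_inner_le_norm x w
  nlinarith [norm_nonneg w, norm_nonneg x, mul_nonneg (norm_nonneg w) (sq_nonneg (‖x‖ - 1)),
    mul_nonneg (norm_nonneg w) (sq_nonneg ‖x‖)]

/-- Since |x|(1 + |x|) ≤ 2(1 + |x|²), a field of size n(1 + |x|) changes the logarithmic norm at
speed at most 2n, independently of x. -/
lemma abs_fderiv_logNorm_le {x w : E d} {n : ℝ} (h : ‖w‖ ≤ n * (1 + ‖x‖)) :
    |fderiv ℝ logNorm x w| ≤ 2 * n := by
  rw [fderiv_logNorm, abs_div, abs_of_nonneg (by positivity : (0 : ℝ) ≤ 1 + ‖x‖ ^ 2),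
    div_le_iff₀ (by positivity)]
  have h1 := abs_real_inner_le_norm x w
  have h2 := mul_le_mul_of_nonneg_left h (norm_nonneg x)
  have h3 : 0 ≤ n := by
    have := (norm_nonneg w).trans h
    exact nonneg_of_mul_nonneg_left this (by positivity)
  nlinarith [mul_nonneg h3 (sq_nonneg (‖x‖ - 1)), mul_nonneg h3 (sq_nonneg ‖x‖)]

lemma norm_le_of_logNorm_le {x : E d} {r : ℝ} (h : logNorm x ≤ r) : ‖x‖ ≤ Real.exp r := by
  have h1 : Real.log (1 + ‖x‖ ^ 2) ≤ 2 * r := by rw [logNorm] at h; linarith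
  rw [Real.log_le_iff_le_exp (by positivity), two_mul, Real.exp_add, ← sq] at h1
  exact le_of_sq_le_sq (by linarith) (Real.exp_pos r).le

lemma logNorm_le_of_norm_le {x : E d} {r : ℝ} (h : ‖x‖ ≤ r) :
    logNorm x ≤ Real.log (1 + r ^ 2) / 2 := by
  rw [logNorm]
  gcongr

/-- Along an absolutely continuous curve a nonlocal field has sublinear growth. -/
lemma HypCE.growth_along {v : ℝ → Pc d → E d → E d} (hp : 1 ≤ p) (hv : HypCE p T v)
    {ν : ℝ → Pc d} (hac : IsACCurve p T ν) :
    ∃ N, L1Nonneg T N ∧ ∀ᵐ t ∂leb T, ∀ x, ‖v t (ν t) x‖ ≤ N t * (1 + ‖x‖) := by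
  obtain ⟨m, hm, hm'⟩ := hv.sublinear
  obtain ⟨k, hk, hk'⟩ := hac
  set M := (ν 0).moment1 + ∫ τ in (0 : ℝ)..T, k τ with hM
  have hb : ∀ t ∈ Icc 0 T, (ν t).moment1 ≤ M := by
    intro t ht
    have h0 : (0 : ℝ) ∈ Icc 0 T := ⟨le_rfl, ht.1.trans ht.2⟩
    have h1 := abs_moment1_sub_le hp (ν t) (ν 0)
    have h2 := wass_le_of_abs_modulus hk' ht h0
    have h3 := hk.integral_le_total ht h0
    have := le_abs_self ((ν t).moment1 - (ν 0).moment1)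
    linarith
  by_cases hT : 0 ≤ T
  swap
  · refine ⟨fun _ => 0, L1Nonneg.const le_rfl, ?_⟩
    have : leb T = 0 := by simp [leb, Icc_eq_empty hT]
    simp [this]
  have hM0 : 0 ≤ M := (Pc.moment1_nonneg _).trans (hb 0 (left_mem_Icc.2 hT))
  refine ⟨fun t => (1 + M) * m t, hm.const_mul (by linarith), ?_⟩
  filter_upwards [hm', ae_leb_mem] with t h1 ht x
  refine (h1 _ x).trans ?_
  have h2 := hb t ht
  have : m t * (1 + ‖x‖ + (ν t).moment1) ≤ m t * ((1 + M) * (1 + ‖x‖)) :=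
    mul_le_mul_of_nonneg_left (by nlinarith [norm_nonneg x, mul_nonneg hM0 (norm_nonneg x)]) (hm.1 t)
  linarith

/-- Solutions of a nonlocal continuity equation remain in a fixed ball. -/
lemma SolvesNonlocalCE.exists_inBall (hT : 0 < T) (hp : 1 ≤ p) {v : ℝ → Pc d → E d → E d}
    (hv : HypCE p T v) {ν : ℝ → Pc d} (hac : IsACCurve p T ν) (h : SolvesNonlocalCE T v ν) :
    ∃ R > 0, ∀ t ∈ Icc 0 T, (ν t).InBall R := by
  obtain ⟨N, hN, hN'⟩ := hv.growth_along hp hac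
  have hac' := hac
  obtain ⟨k, hk, hk'⟩ := hac'
  obtain ⟨C, hC0, hC1, hC2⟩ := exists_smoothTransition_bounds
  obtain ⟨R₀, hR₀, hR₀'⟩ := (ν 0).exists_inBall
  have m0 : (0 : ℝ) ∈ Icc 0 T := left_mem_Icc.2 hT.le
  have hN2 := hN.const_mul (c := 2) two_pos.le
  set χ := Real.smoothTransition with hχ
  set β := deriv χ with hβ
  have hχs : ContDiff ℝ (⊤ : ℕ∞) χ := Real.smoothTransition.contDiff
  have hβ0 : ∀ a, 0 ≤ β a := fun a => Real.smoothTransition.monotone.deriv_nonneg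
  have hβc : Continuous β := hχs.continuous_deriv (by simp)
  have hqc : Continuous (logNorm (d := d)) := contDiff_logNorm.continuous
  set r₀ := Real.log (1 + R₀ ^ 2) / 2 with hr₀
  set Λ : ℝ → ℝ := fun t => ∫ τ in (0 : ℝ)..t, 2 * N τ with hΛ
  -- f(t) weighs the mass above the moving level r₀ + Λ(t). The level rises at speed 2N, no slower
  -- than the field can raise the logarithmic norm, so f does not increase from f(0) = 0. As χ
  -- vanishes exactly on the nonpositive reals, f(t) = 0 bounds the support.
  set f : ℝ → ℝ := fun t => ∫ x, χ (logNorm x - (r₀ + Λ t)) ∂(ν t).meas with hf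
  have hK := hN2.add hk
  set K : ℝ → ℝ := fun t => ∫ τ in (0 : ℝ)..t, (2 * N τ + k τ) with hKdef
  have hqL : ∀ x y : E d, |logNorm x - logNorm y| ≤ 1 * ‖x - y‖ :=
    abs_sub_le_of_fderiv (contDiff_logNorm.differentiable (by simp)) norm_fderiv_logNorm_le
  -- The level is frozen at its final value c. Moving the measure below that level costs at most
  -- about Bs·(Λ t - Λ s), and moving the level gains the same amount; only second-order terms
  -- survive.
  have incr : ∀ s t, 0 ≤ s → s ≤ t → t ≤ T → f t - f s ≤ 2 * C * (K t - K s) ^ 2 := by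
    intro s t hs hst htT
    have hsm : s ∈ Icc 0 T := ⟨hs, hst.trans htT⟩
    have htm : t ∈ Icc 0 T := ⟨hs.trans hst, htT⟩
    set c := r₀ + Λ t with hc
    have dK : K t - K s = (∫ τ in s..t, 2 * N τ) + ∫ τ in s..t, k τ := by
      rw [hKdef, integral_sub_integral hK.2 m0 hsm htm, intervalIntegral.integral_add
        (intervalIntegrable_of_mem_Icc hN2.2 hsm htm) (intervalIntegrable_of_mem_Icc hk.2 hsm htm)]
    have dΛ : Λ t - Λ s = ∫ τ in s..t, 2 * N τ := integral_sub_integral hN2.2 m0 hsm htm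
    have p1 := hN2.integral_nonneg hst
    have p2 := hk.integral_nonneg hst
    -- The complement of the cutoff is compactly supported, hence an admissible test function, while
    -- the cutoff itself is not.
    set ζ : E d → ℝ := fun x => 1 - χ (logNorm x - c) with hζ
    have ζs : ContDiff ℝ (⊤ : ℕ∞) ζ :=
      contDiff_const.sub (hχs.comp (contDiff_logNorm.sub contDiff_const))
    have ζc : HasCompactSupport ζ := by
      refine HasCompactSupport.intro (isCompact_closedBall (0 : E d) (Real.exp (c + 1)))
        fun x hx => ?_
      have : c + 1 < logNorm x := by
        by_contra! hcon
        exact hx (by simpa using norm_le_of_logNorm_le hcon)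
      simp only [hζ, hχ]
      rw [Real.smoothTransition.one_of_one_le (by linarith), sub_self]
    have ζd : ∀ x w, fderiv ℝ ζ x w = -(β (logNorm x - c) * fderiv ℝ logNorm x w) := by
      intro x w
      have h1 : HasFDerivAt (fun x : E d => logNorm x - c) (fderiv ℝ logNorm x) x :=
        (contDiff_logNorm.differentiable (by simp) x).hasFDerivAt.sub_const c
      have h2 := ((hχs.differentiable (by simp)
        (logNorm x - c)).hasDerivAt.comp_hasFDerivAt x h1).const_sub 1
      have h3 : fderiv ℝ ζ x = _ := h2.fderiv
      rw [h3]; simp [hβ]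
    obtain ⟨gi, gint⟩ := h.integral_sub hT hp hv hac ζs ζc
    set Bs := ∫ x, β (logNorm x - c) ∂(ν s).meas with hBs
    have hBc : Continuous fun x : E d => β (logNorm x - c) := hβc.comp (hqc.sub continuous_const)
    have Bbound : ∀ τ ∈ Icc s t, ∫ x, β (logNorm x - c) ∂(ν τ).meas ≤ Bs + C * (K t - K s) := by
      intro τ hτ
      have hτm : τ ∈ Icc 0 T := ⟨hs.trans hτ.1, hτ.2.trans htT⟩
      have e1 := abs_integral_sub_le_wass_of_continuous hp hBc hC0.le
        (fun x y => (hC1 _ _).trans (by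
          have := hqL x y
          rw [sub_sub_sub_cancel_right]
          exact mul_le_mul_of_nonneg_left (by linarith) hC0.le)) (ν τ) (ν s)
      have e2 : wass p (ν τ) (ν s) ≤ K t - K s := by
        rw [wass_comm]
        refine (hk' s τ hs hτ.1 hτm.2).trans ?_
        have e3 := hk.integral_nonneg hτ.2
        have e4 := intervalIntegral.integral_add_adjacent_intervals
          (intervalIntegrable_of_mem_Icc hk.2 hsm hτm) (intervalIntegrable_of_mem_Icc hk.2 hτm htm)
        linarith
      have e5 := (le_abs_self _).trans e1
      have := mul_le_mul_of_nonneg_left e2 hC0.le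
      linarith
    have first : ∫ x, χ (logNorm x - c) ∂(ν t).meas - ∫ x, χ (logNorm x - c) ∂(ν s).meas
        ≤ (Λ t - Λ s) * (Bs + C * (K t - K s)) := by
      have hcc : Continuous fun x : E d => χ (logNorm x - c) :=
        hχs.continuous.comp (hqc.sub continuous_const)
      have e1 : ∀ τ, ∫ x, ζ x ∂(ν τ).meas = 1 - ∫ x, χ (logNorm x - c) ∂(ν τ).meas := fun τ => by
        rw [hζ, MeasureTheory.integral_sub (integrable_const _) ((ν τ).integrable_of_continuous hcc)]
        simp
      have e2 := gint s hsm t htm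
      rw [e1, e1] at e2
      have e3 : -∫ τ in s..t, (∫ x, fderiv ℝ ζ x (v τ (ν τ) x) ∂(ν τ).meas)
          ≤ ∫ τ in s..t, 2 * N τ * (Bs + C * (K t - K s)) := by
        rw [← intervalIntegral.integral_neg]
        refine intervalIntegral.integral_mono_ae_restrict hst
          (intervalIntegrable_of_mem_Icc gi hsm htm).neg
          ((intervalIntegrable_of_mem_Icc hN2.2 hsm htm).mul_const _) ?_
        have := ae_mono (Measure.restrict_mono (Icc_subset_Icc hs htT) le_rfl)
          (hN'.and hv.ae_continuous)
        filter_upwards [this, ae_restrict_mem measurableSet_Icc] with τ h1 hτ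
        have c1 : Continuous fun x => fderiv ℝ ζ x (v τ (ν τ) x) :=
          (ζs.continuous_fderiv (by simp)).clm_apply (h1.2 (ν τ))
        have e4 : -∫ x, fderiv ℝ ζ x (v τ (ν τ) x) ∂(ν τ).meas
            ≤ ∫ x, 2 * N τ * β (logNorm x - c) ∂(ν τ).meas := by
          rw [← MeasureTheory.integral_neg]
          refine integral_mono ((ν τ).integrable_of_continuous c1.neg)
            (((ν τ).integrable_of_continuous hBc).const_mul _) fun x => ?_
          simp only [ζd, neg_neg]
          have := (le_abs_self _).trans (abs_fderiv_logNorm_le (h1.1 x))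
          rw [mul_comm]
          exact mul_le_mul_of_nonneg_right this (hβ0 _)
        rw [integral_const_mul] at e4
        exact e4.trans (mul_le_mul_of_nonneg_left (Bbound τ hτ) (hN2.1 τ))
      rw [intervalIntegral.integral_mul_const] at e3
      rw [dΛ]
      linarith
    have second : ∫ x, χ (logNorm x - c) ∂(ν s).meas - f s
        ≤ -(Bs * (Λ t - Λ s)) + C * (Λ t - Λ s) ^ 2 := by
      have hc1 : Continuous fun x : E d => χ (logNorm x - c) :=
        hχs.continuous.comp (hqc.sub continuous_const)
      have hc2 : Continuous fun x : E d => χ (logNorm x - (r₀ + Λ s)) :=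
        hχs.continuous.comp (hqc.sub continuous_const)
      rw [hf, ← MeasureTheory.integral_sub ((ν s).integrable_of_continuous hc1)
        ((ν s).integrable_of_continuous hc2)]
      have e1 : ∫ x, (χ (logNorm x - c) - χ (logNorm x - (r₀ + Λ s))) ∂(ν s).meas
          ≤ ∫ x, (-(β (logNorm x - c) * (Λ t - Λ s)) + C * (Λ t - Λ s) ^ 2) ∂(ν s).meas := by
        refine integral_mono ((ν s).integrable_of_continuous (hc1.sub hc2))
          ((ν s).integrable_of_continuous ((hBc.mul continuous_const).neg.add continuous_const))
          fun x => ?_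
        have := hC2 (logNorm x - c) (logNorm x - (r₀ + Λ s))
        have e2 : logNorm x - (r₀ + Λ s) - (logNorm x - c) = Λ t - Λ s := by rw [hc]; ring
        rw [e2, sq_abs] at this
        have := (abs_le.1 this).1
        simp only [hβ]
        linarith
      have e3 : ∫ x, (-(β (logNorm x - c) * (Λ t - Λ s)) + C * (Λ t - Λ s) ^ 2) ∂(ν s).meas
          = -(Bs * (Λ t - Λ s)) + C * (Λ t - Λ s) ^ 2 := by
        have i1 : Integrable (fun x => -(β (logNorm x - c) * (Λ t - Λ s))) (ν s).meas :=
          (((ν s).integrable_of_continuous hBc).mul_const _).neg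
        rw [integral_add i1 (integrable_const _), MeasureTheory.integral_neg, integral_mul_const]
        simp [hBs]
      rwa [e3] at e1
    have hft : f t = ∫ x, χ (logNorm x - c) ∂(ν t).meas := rfl
    have q1 : (Λ t - Λ s) * (K t - K s) ≤ (K t - K s) ^ 2 := by
      rw [sq]; exact mul_le_mul_of_nonneg_right (by linarith) (by linarith)
    have q2 : (Λ t - Λ s) ^ 2 ≤ (K t - K s) ^ 2 := by
      refine pow_le_pow_left₀ (by linarith) (by linarith) 2
    have q3 := mul_le_mul_of_nonneg_left (add_le_add q1 q2) hC0.le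
    nlinarith
  have f0 : f 0 = 0 := by
    refine integral_eq_zero_of_ae (hR₀'.ae_norm_le.mono fun x hx => ?_)
    have := logNorm_le_of_norm_le hx
    refine Real.smoothTransition.zero_of_nonpos ?_
    simp only [hΛ, intervalIntegral.integral_same]
    linarith
  refine ⟨Real.exp (r₀ + Λ T), Real.exp_pos _, fun t ht => Pc.inBall_of_ae ?_⟩
  have ft : f t ≤ 0 := by
    rw [← f0]
    have sub : Icc 0 t ⊆ Icc 0 T := Icc_subset_Icc_right ht.2
    exact le_of_increment_le_sq ht.1 (hK.monotoneOn.mono sub)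
      ((continuousOn_primitive_Icc hK.2 m0).mono sub) (by positivity)
      fun s r hs hsr hrt => incr s r hs hsr (hrt.trans ht.2)
  have hcc : Continuous fun x : E d => χ (logNorm x - (r₀ + Λ t)) :=
    hχs.continuous.comp (hqc.sub continuous_const)
  have hz := (integral_eq_zero_iff_of_nonneg (fun x => Real.smoothTransition.nonneg _)
    ((ν t).integrable_of_continuous hcc)).1
    (le_antisymm ft (integral_nonneg fun x => Real.smoothTransition.nonneg _))
  filter_upwards [hz] with x hx
  have h1 := Real.smoothTransition.zero_iff_nonpos.1 hx
  refine (norm_le_of_logNorm_le (r := r₀ + Λ t) (by linarith)).trans (Real.exp_le_exp.2 ?_)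
  have := hN2.monotoneOn ht (right_mem_Icc.2 hT.le) ht.2
  simp only [hΛ]
  linarith

end SupportBound

end WassLin

namespace WassLin

/-! ### Mollification of Lipschitz functions; separation of measures. -/

section Mollification

variable {d : ℕ}

/-- Mollification at scale `δ` of Lipschitz functions, with estimates uniform in the function. -/
lemma exists_mollification {δ G : ℝ} (hδ : 0 < δ) (hG : 0 ≤ G) :
    ∃ H ≥ 0, ∃ M : (E d → ℝ) → E d → ℝ,
      (∀ g, (∀ x y, |g x - g y| ≤ G * ‖x - y‖) → ContDiff ℝ (⊤ : ℕ∞) (M g) ∧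
        (∀ x, ‖fderiv ℝ (M g) x‖ ≤ G) ∧
        (∀ x y, ‖fderiv ℝ (M g) x - fderiv ℝ (M g) y‖ ≤ H * ‖x - y‖) ∧
        ∀ x, |M g x - g x| ≤ G * δ) ∧
      ∀ g₁ g₂, (∀ x y, |g₁ x - g₁ y| ≤ G * ‖x - y‖) → (∀ x y, |g₂ x - g₂ y| ≤ G * ‖x - y‖) →
        ∀ x y c, (∀ z, ‖z‖ ≤ δ → |g₁ (x - z) - g₂ (y - z)| ≤ c) → |M g₁ x - M g₂ y| ≤ c := by
  let φ : ContDiffBump (0 : E d) := ⟨δ / 2, δ, half_pos hδ, half_lt_self hδ⟩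
  set f : E d → ℝ := φ.normed volume with hf
  have hf0 : ∀ z, 0 ≤ f z := φ.nonneg_normed
  have hfs : ContDiff ℝ (⊤ : ℕ∞) f := φ.contDiff_normed
  have hfc : HasCompactSupport f := φ.hasCompactSupport_normed
  have hfi : Integrable f := φ.integrable_normed
  have hf1 : ∫ z, f z = 1 := φ.integral_normed
  have hfz : ∀ z, δ < ‖z‖ → f z = 0 := fun z hz => by
    rw [← Function.notMem_support, hf, φ.support_normed_eq]
    simpa [φ] using hz.le
  set L := ContinuousLinearMap.lsmul ℝ ℝ (E := ℝ) with hL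
  set M : (E d → ℝ) → E d → ℝ := fun g => convolution f g L volume with hM
  have hMx : ∀ g x, M g x = ∫ z, f z * g (x - z) := fun g x => rfl
  have hcont : ∀ g : E d → ℝ, (∀ x y, |g x - g y| ≤ G * ‖x - y‖) → Continuous g := by
    intro g hg
    refine (LipschitzWith.of_dist_le_mul (K := ⟨G, hG⟩) fun x y => ?_).continuous
    rw [Real.dist_eq, dist_eq_norm]
    exact hg x y
  have hint : ∀ g : E d → ℝ, Continuous g → ∀ x, Integrable (fun z => f z * g (x - z)) :=
    fun g hg x => (hfs.continuous.mul (hg.comp (by fun_prop))).integrable_of_hasCompactSupport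
      hfc.mul_right
  -- Mollification averages translates over the ball of radius δ, so a bound on the translates
  -- passes to the averages. Comparing g with itself or with a constant yields the gradient bound
  -- and the approximation error.
  have cmp : ∀ g₁ g₂ : E d → ℝ, Continuous g₁ → Continuous g₂ →
      ∀ x y c, (∀ z, ‖z‖ ≤ δ → |g₁ (x - z) - g₂ (y - z)| ≤ c) → |M g₁ x - M g₂ y| ≤ c := by
    intro g₁ g₂ h₁ h₂ x y c hc
    rw [hMx, hMx, ← integral_sub (hint g₁ h₁ x) (hint g₂ h₂ y)]
    have : ‖∫ z, (f z * g₁ (x - z) - f z * g₂ (y - z))‖ ≤ ∫ z, f z * c := by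
      refine norm_integral_le_of_norm_le (hfi.mul_const c) (.of_forall fun z => ?_)
      rw [← mul_sub, norm_mul, Real.norm_of_nonneg (hf0 z), Real.norm_eq_abs]
      rcases le_or_gt ‖z‖ δ with hz | hz
      · exact mul_le_mul_of_nonneg_left (hc z hz) (hf0 z)
      · simp [hfz z hz]
    rwa [integral_mul_const, hf1, one_mul, Real.norm_eq_abs] at this
  refine ⟨G * ∫ z, ‖fderiv ℝ f z‖, by positivity, M, fun g hg => ?_,
    fun g₁ g₂ h₁ h₂ => cmp g₁ g₂ (hcont _ h₁) (hcont _ h₂)⟩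
  have hgc := hcont g hg
  refine ⟨hfc.contDiff_convolution_left L hfs hgc.locallyIntegrable, fun x => ?_, fun x y => ?_,
    fun x => ?_⟩
  · refine norm_fderiv_le_of_lipschitz ℝ (C := ⟨G, hG⟩) (LipschitzWith.of_dist_le_mul fun x y => ?_)
    rw [Real.dist_eq, dist_eq_norm]
    refine cmp g g hgc hgc x y _ fun z _ => (hg _ _).trans_eq ?_
    rw [sub_sub_sub_cancel_right]; rfl
  · have hd := fun x => (hfc.hasFDerivAt_convolution_left (μ := volume) L (hfs.of_le (by norm_cast))
      hgc.locallyIntegrable x).fderiv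
    have hfd : Continuous (fderiv ℝ f) := hfs.continuous_fderiv (by simp)
    have hfdi : Integrable (fun z => ‖fderiv ℝ f z‖) :=
      hfd.norm.integrable_of_hasCompactSupport (hfc.fderiv ℝ).norm
    have hi : ∀ x, Integrable (fun z => g (x - z) • fderiv ℝ f z) := fun x =>
      ((hgc.comp (by fun_prop : Continuous fun z => x - z)).smul hfd).integrable_of_hasCompactSupport
        (hfc.fderiv ℝ).smul_left
    have e : ∀ x, fderiv ℝ (M g) x = ∫ z, g (x - z) • fderiv ℝ f z := fun x => by
      refine (hd x).trans (integral_congr_ae (.of_forall fun z => ?_))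
      ext w
      simp [hL, ContinuousLinearMap.precompL_apply, mul_comm]
    rw [e, e, ← integral_sub (hi x) (hi y)]
    have h3 : ‖∫ z, (g (x - z) • fderiv ℝ f z - g (y - z) • fderiv ℝ f z)‖
        ≤ ∫ z, ‖fderiv ℝ f z‖ * (G * ‖x - y‖) := by
      refine norm_integral_le_of_norm_le (hfdi.mul_const _) (.of_forall fun z => ?_)
      rw [← sub_smul, norm_smul, mul_comm]
      refine mul_le_mul_of_nonneg_left ?_ (norm_nonneg _)
      have := hg (x - z) (y - z)
      rwa [sub_sub_sub_cancel_right] at this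
    rw [integral_mul_const] at h3
    exact h3.trans_eq (by ring)
  · have hc : M (fun _ => g x) x = g x := by
      rw [hMx, integral_mul_const, hf1, one_mul]
    have := cmp g (fun _ => g x) hgc continuous_const x x (G * δ) fun z hz => (hg _ _).trans ?_
    · rwa [hc] at this
    rw [sub_sub_cancel_left, norm_neg]
    exact mul_le_mul_of_nonneg_left hz hG

/-- Finite measures are determined by the integrals of bounded Lipschitz functions. -/
lemma Pc.ext_of_lipschitz {μ ν : Pc d} (h : ∀ f : E d → ℝ, (∃ G ≥ 0, ∀ x y, |f x - f y| ≤ G * ‖x - y‖) →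
    ∫ x, f x ∂μ.meas = ∫ x, f x ∂ν.meas) : μ = ν := by
  let P : ProbabilityMeasure (E d) := ⟨μ.meas, inferInstance⟩
  let Q : ProbabilityMeasure (E d) := ⟨ν.meas, inferInstance⟩
  have ht : Tendsto (fun _ : ℕ => P) atTop (𝓝 Q) := by
    rw [tendsto_iff_forall_lipschitz_integral_tendsto]
    rintro f - ⟨L, hL⟩
    have : ∫ x, f x ∂μ.meas = ∫ x, f x ∂ν.meas := h f ⟨L, L.2, fun x y => by
      have := hL.dist_le_mul x y
      rwa [Real.dist_eq, dist_eq_norm] at this⟩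
    change Tendsto (fun _ : ℕ => ∫ x, f x ∂μ.meas) atTop (𝓝 (∫ x, f x ∂ν.meas))
    rw [this]
    exact tendsto_const_nhds
  have hPQ : P = Q := tendsto_nhds_unique tendsto_const_nhds ht
  exact Pc.ext_meas (congrArg (fun P : ProbabilityMeasure (E d) => (P : Measure (E d))) hPQ)

end Mollification

/-! ### Integral functionals on maps as continuous linear forms, so that they commute with integrals
in time. -/

section Pairing

variable {d : ℕ} {ρ : ℝ}

lemma exists_bound_integral_apply (μ : Pc d) (hρ : 0 < ρ) (D : C(E d, E d →L[ℝ] ℝ)) :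
    ∃ C, ∀ Y : BallMap d ρ, ‖∫ x, D x (extend hρ Y x) ∂μ.meas‖ ≤ C * ‖Y‖ := by
  obtain ⟨C, hC0, hC⟩ := μ.exists_ae_norm_le_of_continuous D.continuous
  refine ⟨C, fun Y => ?_⟩
  have := norm_integral_le_of_norm_le_const (μ := μ.meas) (C := C * ‖Y‖)
    (f := fun x => D x (extend hρ Y x)) (hC.mono fun x hx => ?_)
  · simpa using this
  · exact ((D x).le_opNorm _).trans
      (mul_le_mul hx (norm_extend_le hρ Y x) (norm_nonneg _) hC0.le)

/-- The functional `Y ↦ ∫ D(x) Y(x) dμ(x)` on maps defined on a ball. -/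
noncomputable def pairing (μ : Pc d) (hρ : 0 < ρ) (D : C(E d, E d →L[ℝ] ℝ)) :
    BallMap d ρ →L[ℝ] ℝ :=
  LinearMap.mkContinuousOfExistsBound
    { toFun := fun Y => ∫ x, D x (extend hρ Y x) ∂μ.meas
      map_add' := fun Y Z => by
        rw [← integral_add (μ.integrable_of_continuous (by fun_prop))
          (μ.integrable_of_continuous (by fun_prop))]
        refine integral_congr_ae (.of_forall fun x => ?_)
        simp [extend_apply]
      map_smul' := fun c Y => by
        rw [RingHom.id_apply, smul_eq_mul, ← integral_const_mul]
        refine integral_congr_ae (.of_forall fun x => ?_)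
        simp [extend_apply] }
    (exists_bound_integral_apply μ hρ D)

lemma pairing_apply (μ : Pc d) (hρ : 0 < ρ) (D : C(E d, E d →L[ℝ] ℝ)) (Y : BallMap d ρ) :
    pairing μ hρ D Y = ∫ x, D x (extend hρ Y x) ∂μ.meas := rfl

end Pairing

end WassLin

namespace WassLin

/-! ### Weak solutions are transported by the characteristics. -/

section Representation

variable {d : ℕ} {p T ρ : ℝ}

/-- `ν` is an absolutely continuous curve in `𝒫(B(0,ρ))` solving weakly the continuity equation with
field `u`. -/
structure IsWeakSol (p T ρ : ℝ) (u : ℝ → E d → E d) (ν : ℝ → Pc d) : Prop where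
  ac : IsACCurve p T ν
  inBall : ∀ t ∈ Icc 0 T, (ν t).InBall ρ
  eqn : ∀ ζ : E d → ℝ, ContDiff ℝ (⊤ : ℕ∞) ζ → HasCompactSupport ζ →
    IntegrableOn (fun t => ∫ x, fderiv ℝ ζ x (u t x) ∂(ν t).meas) (Icc 0 T) ∧
    ∀ s ∈ Icc 0 T, ∀ t ∈ Icc 0 T, ∫ x, ζ x ∂(ν t).meas - ∫ x, ζ x ∂(ν s).meas
      = ∫ τ in s..t, ∫ x, fderiv ℝ ζ x (u τ x) ∂(ν τ).meas

/-- Smooth test functions need not be compactly supported. -/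
lemma IsWeakSol.eqn_of_contDiff {u : ℝ → E d → E d} {ν : ℝ → Pc d} (h : IsWeakSol p T ρ u ν)
    {ζ : E d → ℝ} (hζ : ContDiff ℝ (⊤ : ℕ∞) ζ) :
    IntegrableOn (fun t => ∫ x, fderiv ℝ ζ x (u t x) ∂(ν t).meas) (Icc 0 T) ∧
    ∀ s ∈ Icc 0 T, ∀ t ∈ Icc 0 T, ∫ x, ζ x ∂(ν t).meas - ∫ x, ζ x ∂(ν s).meas
      = ∫ τ in s..t, ∫ x, fderiv ℝ ζ x (u τ x) ∂(ν τ).meas := by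
  let φ : ContDiffBump (0 : E d) := ⟨|ρ| + 1, |ρ| + 2, by positivity, by linarith⟩
  have h1 : ContDiff ℝ (⊤ : ℕ∞) (fun x => φ x * ζ x) := φ.contDiff.mul hζ
  have h2 : HasCompactSupport (fun x => φ x * ζ x) := φ.hasCompactSupport.mul_right
  obtain ⟨e1, e2⟩ := h.eqn _ h1 h2
  have heq : ∀ x : E d, ‖x‖ ≤ ρ → (fun x => φ x * ζ x) =ᶠ[𝓝 x] ζ := by
    intro x hx
    have : Metric.ball (0 : E d) (|ρ| + 1) ∈ 𝓝 x :=
      Metric.isOpen_ball.mem_nhds (by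
        rw [mem_ball_zero_iff]; linarith [le_abs_self ρ])
    filter_upwards [this] with y hy
    rw [φ.one_of_mem_closedBall (Metric.ball_subset_closedBall hy), one_mul]
  have g1 : ∀ t ∈ Icc 0 T, ∫ x, φ x * ζ x ∂(ν t).meas = ∫ x, ζ x ∂(ν t).meas := fun t ht =>
    integral_congr_ae ((h.inBall t ht).ae_norm_le.mono fun x hx => (heq x hx).eq_of_nhds)
  have g2 : ∀ t ∈ Icc 0 T, ∫ x, fderiv ℝ (fun x => φ x * ζ x) x (u t x) ∂(ν t).meas
      = ∫ x, fderiv ℝ ζ x (u t x) ∂(ν t).meas := fun t ht =>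
    integral_congr_ae ((h.inBall t ht).ae_norm_le.mono fun x hx => by
      simp only [(heq x hx).fderiv_eq])
  refine ⟨e1.congr_fun g2 measurableSet_Icc, fun s hs t ht => ?_⟩
  rw [← g1 s hs, ← g1 t ht, e2 s hs t ht]
  refine intervalIntegral.integral_congr fun τ hτ => ?_
  exact g2 τ ((convex_Icc (0 : ℝ) T).ordConnected.uIcc_subset hs ht hτ)

/-- The restriction to a ball of a field on the whole space. -/
noncomputable def ballField (u : ℝ → E d → E d) (ρ t : ℝ) : BallMap d ρ :=
  ContinuousMap.mkD (fun x => u t x) 0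

lemma extend_ballField {u : ℝ → E d → E d} (hρ : 0 < ρ) {t : ℝ} (ht : Continuous (u t)) (x : E d) :
    extend hρ (ballField u ρ t) x = u t (retract ρ x) :=
  ContinuousMap.mkD_apply_of_continuous (ht.comp continuous_subtype_val)

lemma aestronglyMeasurable_ballField {u : ℝ → E d → E d} (hu : CaraField T u) :
    AEStronglyMeasurable (ballField u ρ) (leb T) := by
  refine aestronglyMeasurable_of_eval fun x => (hu.meas x).congr ?_
  filter_upwards [hu.ae_continuous] with t ht
  exact (ContinuousMap.mkD_apply_of_continuous (ht.comp continuous_subtype_val)).symm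

/-- Bounds of a Carathéodory field composed with the radial retraction. -/
lemma CaraField.retract_bounds {u : ℝ → E d → E d} (hu : CaraField T u) (hρ : 0 < ρ) :
    ∃ m, L1Nonneg T m ∧ ∀ᵐ t ∂leb T, (∀ x, ‖u t (retract ρ x)‖ ≤ m t) ∧
      ∀ x y, ‖u t (retract ρ x) - u t (retract ρ y)‖ ≤ m t * ‖x - y‖ := by
  obtain ⟨m, hm, hm'⟩ := hu.growth
  obtain ⟨l, hl, hl'⟩ := hu.lip ρ hρ
  have hm1 := hm.const_mul (c := 1 + ρ) (by positivity)
  have hl1 := hl.const_mul (c := 2) two_pos.le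
  refine ⟨_, hm1.add hl1, ?_⟩
  filter_upwards [hm', hl'] with t h1 h2
  refine ⟨fun x => ?_, fun x y => ?_⟩
  · have := h1 (retract ρ x)
    have := mul_le_mul_of_nonneg_left (norm_retract_le hρ x) (hm.1 t)
    have := hl1.1 t
    linarith
  · have e1 := h2 _ (retract_mem_closedBall hρ x) _ (retract_mem_closedBall hρ y)
    have e2 := mul_le_mul_of_nonneg_left (norm_retract_sub_le hρ x y) (hl.1 t)
    have e3 := mul_nonneg (hm1.1 t) (norm_nonneg (x - y))
    linarith

lemma CaraField.retract {u : ℝ → E d → E d} (hu : CaraField T u) (hρ : 0 < ρ) :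
    CaraField T (fun t x => u t (WassLin.retract ρ x)) where
  meas x := hu.meas _
  growth := by
    obtain ⟨m, hm, hm'⟩ := hu.retract_bounds hρ
    refine ⟨m, hm, hm'.mono fun t ht x => (ht.1 x).trans ?_⟩
    exact le_mul_of_one_le_right (hm.1 t) (by linarith [norm_nonneg x])
  lip R _ := by
    obtain ⟨m, hm, hm'⟩ := hu.retract_bounds hρ
    exact ⟨m, hm, hm'.mono fun t ht x _ y _ => ht.2 x y⟩

/-- Second-order comparison of a weak solution with one explicit Euler step. -/
lemma IsWeakSol.euler_step (hp : 1 ≤ p) (hρ : 0 < ρ) {u : ℝ → E d → E d} (hu : CaraField T u)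
    {ν : ℝ → Pc d} (h : IsWeakSol p T ρ u ν) {m k : ℝ → ℝ} (hm : L1Nonneg T m)
    (hm' : ∀ᵐ t ∂leb T, (∀ x, ‖u t (retract ρ x)‖ ≤ m t) ∧
      ∀ x y, ‖u t (retract ρ x) - u t (retract ρ y)‖ ≤ m t * ‖x - y‖)
    (hk : L1Nonneg T k)
    (hk' : ∀ s t, 0 ≤ s → s ≤ t → t ≤ T → wass p (ν s) (ν t) ≤ ∫ τ in s..t, k τ)
    {ζ : E d → ℝ} (hζ : ContDiff ℝ (⊤ : ℕ∞) ζ) {G H : ℝ} (hG0 : 0 ≤ G) (hH0 : 0 ≤ H)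
    (hG : ∀ x, ‖fderiv ℝ ζ x‖ ≤ G) (hH : ∀ x y, ‖fderiv ℝ ζ x - fderiv ℝ ζ y‖ ≤ H * ‖x - y‖)
    {s t : ℝ} (hs : 0 ≤ s) (hst : s ≤ t) (htT : t ≤ T) :
    |∫ x, ζ x ∂(ν t).meas - ∫ x, ζ (x + ∫ τ in s..t, u τ (retract ρ x)) ∂(ν s).meas|
      ≤ (2 * H + G) * (∫ τ in s..t, (m τ + k τ)) ^ 2 := by
  have hsm : s ∈ Icc 0 T := ⟨hs, hst.trans htT⟩
  have htm : t ∈ Icc 0 T := ⟨hs.trans hst, htT⟩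
  obtain ⟨gi, geq⟩ := h.eqn_of_contDiff hζ
  have geq := geq s hsm t htm
  set Δ := ∫ τ in s..t, (m τ + k τ) with hΔ
  have hmk := hm.add hk
  have hΔe : Δ = (∫ τ in s..t, m τ) + ∫ τ in s..t, k τ := intervalIntegral.integral_add
    (intervalIntegrable_of_mem_Icc hm.2 hsm htm) (intervalIntegrable_of_mem_Icc hk.2 hsm htm)
  have pm := hm.integral_nonneg hst
  have pk := hk.integral_nonneg hst
  have hcd : Continuous (fderiv ℝ ζ) := hζ.continuous_fderiv (by simp)
  let D : C(E d, E d →L[ℝ] ℝ) := ⟨fderiv ℝ ζ, hcd⟩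
  set U := ballField u ρ with hU
  have hUi : IntegrableOn U (Icc 0 T) := by
    refine Integrable.mono' hm.2 (aestronglyMeasurable_ballField hu) ?_
    filter_upwards [hm', hu.ae_continuous] with τ h1 h2
    refine (ContinuousMap.norm_le _ (hm.1 τ)).2 fun x => ?_
    rw [← extend_coe hρ, extend_ballField hρ h2]
    exact h1.1 x
  have hUi' := intervalIntegrable_of_mem_Icc hUi hsm htm
  have hUx : ∀ x, extend hρ (∫ τ in s..t, U τ) x = ∫ τ in s..t, u τ (retract ρ x) := by
    intro x
    rw [extend_apply, intervalIntegral_apply hUi']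
    refine intervalIntegral.integral_congr_ae_restrict ?_
    filter_upwards [ae_restrict_uIoc_of_ae_leb hu.ae_continuous hsm htm] with τ hτ
    exact extend_ballField hρ hτ x
  have hwb : ∀ x, ‖∫ τ in s..t, u τ (retract ρ x)‖ ≤ Δ := by
    intro x
    have := norm_integral_le_of_ae_leb_of_le hm.2 (hm'.mono fun τ h => h.1 x) hsm htm hst
    linarith
  have hwc : Continuous fun x => ∫ τ in s..t, u τ (retract ρ x) := by
    simp only [← hUx]; exact (extend hρ _).continuous
  set L := pairing (ν s) hρ D with hL
  -- The integrals in time and space are exchanged by applying a continuous linear form to a Bochner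
  -- integral of maps.
  have hLU : ∫ τ in s..t, L (U τ) = ∫ x, fderiv ℝ ζ x (∫ τ in s..t, u τ (retract ρ x)) ∂(ν s).meas := by
    rw [L.intervalIntegral_comp_comm hUi', hL, pairing_apply]
    simp only [hUx]; rfl
  have hLi : IntervalIntegrable (fun τ => L (U τ)) volume s t :=
    ⟨L.integrable_comp hUi'.1, L.integrable_comp hUi'.2⟩
  -- The measure at time τ is replaced by the one at time s. The integrand is Lipschitz with
  -- constant (H + G)m(τ) and the distance moved is at most Δ, so the total error is quadratic in Δ.
  have step1 : |(∫ τ in s..t, ∫ x, fderiv ℝ ζ x (u τ x) ∂(ν τ).meas) - ∫ τ in s..t, L (U τ)|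
      ≤ (H + G) * Δ ^ 2 := by
    rw [← intervalIntegral.integral_sub (intervalIntegrable_of_mem_Icc gi hsm htm) hLi]
    have hb : ‖∫ τ in s..t, ((∫ x, fderiv ℝ ζ x (u τ x) ∂(ν τ).meas) - L (U τ))‖
        ≤ ∫ τ in s..t, m τ * ((H + G) * Δ) := by
      refine intervalIntegral.norm_integral_le_of_norm_le hst ?_
        ((intervalIntegrable_of_mem_Icc hm.2 hsm htm).mul_const _)
      have hae := ae_restrict_uIoc_of_ae_leb (hm'.and hu.ae_continuous) hsm htm
      rw [uIoc_of_le hst] at hae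
      refine (ae_restrict_iff' measurableSet_Ioc).1 ?_
      filter_upwards [hae, ae_restrict_mem measurableSet_Ioc] with τ h1 hτ
      have hτm : τ ∈ Icc 0 T := ⟨hs.trans hτ.1.le, hτ.2.trans htT⟩
      have e1 : ∫ x, fderiv ℝ ζ x (u τ x) ∂(ν τ).meas
          = ∫ x, fderiv ℝ ζ x (u τ (retract ρ x)) ∂(ν τ).meas :=
        integral_congr_ae ((h.inBall τ hτm).ae_norm_le.mono fun x hx => by
          simp only [retract_of_le hρ hx])
      have e2 : L (U τ) = ∫ x, fderiv ℝ ζ x (u τ (retract ρ x)) ∂(ν s).meas := by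
        rw [hL, pairing_apply]
        simp only [hU, extend_ballField hρ h1.2]; rfl
      rw [e1, e2]
      have hc1 : Continuous fun x => fderiv ℝ ζ x (u τ (retract ρ x)) :=
        hcd.clm_apply (h1.2.comp (continuous_retract hρ))
      have e3 := abs_integral_sub_le_wass_of_continuous hp hc1
        (C := (H + G) * m τ) (mul_nonneg (by positivity) (hm.1 τ)) (fun x y => by
          have e : fderiv ℝ ζ x (u τ (retract ρ x)) - fderiv ℝ ζ y (u τ (retract ρ y))
              = (fderiv ℝ ζ x - fderiv ℝ ζ y) (u τ (retract ρ x))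
                + fderiv ℝ ζ y (u τ (retract ρ x) - u τ (retract ρ y)) := by
            rw [sub_apply, map_sub]; ring
          rw [e]
          refine (abs_add_le _ _).trans ?_
          have a1 : |(fderiv ℝ ζ x - fderiv ℝ ζ y) (u τ (retract ρ x))| ≤ H * ‖x - y‖ * m τ :=
            ((fderiv ℝ ζ x - fderiv ℝ ζ y).le_opNorm _).trans
              (mul_le_mul (hH x y) (h1.1.1 x) (norm_nonneg _) (by positivity))
          have a2 : |fderiv ℝ ζ y (u τ (retract ρ x) - u τ (retract ρ y))| ≤ G * (m τ * ‖x - y‖) :=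
            ((fderiv ℝ ζ y).le_opNorm _).trans
              (mul_le_mul (hG y) (h1.1.2 x y) (norm_nonneg _) hG0)
          linarith) (ν τ) (ν s)
      have e4 : wass p (ν τ) (ν s) ≤ Δ := by
        rw [wass_comm]
        refine (hk' s τ hs hτ.1.le hτm.2).trans ?_
        have := hk.integral_nonneg hτ.2
        have := intervalIntegral.integral_add_adjacent_intervals
          (intervalIntegrable_of_mem_Icc hk.2 hsm hτm) (intervalIntegrable_of_mem_Icc hk.2 hτm htm)
        linarith
      rw [Real.norm_eq_abs]
      refine e3.trans ((mul_le_mul_of_nonneg_left e4 (mul_nonneg (by positivity) (hm.1 τ))).trans_eq ?_)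
      ring
    rw [intervalIntegral.integral_mul_const, Real.norm_eq_abs] at hb
    refine hb.trans ?_
    have : (∫ τ in s..t, m τ) * ((H + G) * Δ) ≤ Δ * ((H + G) * Δ) :=
      mul_le_mul_of_nonneg_right (by linarith) (mul_nonneg (by positivity) (by linarith))
    exact this.trans_eq (by ring)
  have hc2 : Continuous fun x => ζ (x + ∫ τ in s..t, u τ (retract ρ x)) :=
    hζ.continuous.comp (continuous_id.add hwc)
  have hc3 : Continuous fun x => fderiv ℝ ζ x (∫ τ in s..t, u τ (retract ρ x)) := hcd.clm_apply hwc
  have step2 : |∫ x, ζ (x + ∫ τ in s..t, u τ (retract ρ x)) ∂(ν s).meas - ∫ x, ζ x ∂(ν s).meas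
      - ∫ x, fderiv ℝ ζ x (∫ τ in s..t, u τ (retract ρ x)) ∂(ν s).meas| ≤ H * Δ ^ 2 := by
    have i1 : Integrable (fun x => ζ (x + ∫ τ in s..t, u τ (retract ρ x)) - ζ x) (ν s).meas :=
      (ν s).integrable_of_continuous (hc2.sub hζ.continuous)
    rw [← MeasureTheory.integral_sub ((ν s).integrable_of_continuous hc2)
      ((ν s).integrable_of_continuous hζ.continuous),
      ← MeasureTheory.integral_sub i1 ((ν s).integrable_of_continuous hc3)]
    have := norm_integral_le_of_norm_le_const (μ := (ν s).meas) (C := H * Δ ^ 2)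
      (f := fun x => ζ (x + ∫ τ in s..t, u τ (retract ρ x)) - ζ x
        - fderiv ℝ ζ x (∫ τ in s..t, u τ (retract ρ x))) (.of_forall fun x => ?_)
    · simpa using this
    · have e := norm_taylor_le (hζ.differentiable (by simp)) hH hH0 x
        (x + ∫ τ in s..t, u τ (retract ρ x))
      rw [add_sub_cancel_left] at e
      refine e.trans (mul_le_mul_of_nonneg_left ?_ hH0)
      exact pow_le_pow_left₀ (norm_nonneg _) (hwb x) 2
  rw [← geq, hLU] at step1
  have := (abs_sub _ _).trans (add_le_add step1 step2)
  refine le_trans (le_of_eq ?_) (this.trans_eq (by ring))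
  congr 1
  ring

/-- Weak solutions are transported by the characteristics. -/
lemma IsWeakSol.integral_eq (hp : 1 ≤ p) (hρ : 0 < ρ) {u : ℝ → E d → E d} (hu : CaraField T u)
    {ν : ℝ → Pc d} (h : IsWeakSol p T ρ u ν) {ξ : E d → ℝ} {G : ℝ} (hG0 : 0 ≤ G)
    (hξ : ∀ x y, |ξ x - ξ y| ≤ G * ‖x - y‖) {t₁ : ℝ} (ht₁ : t₁ ∈ Icc 0 T) {Z : E d → ℝ → E d}
    (hZ : ∀ y, IsCaraSol T (fun t x => u t (retract ρ x)) 0 y (Z y)) :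
    ∫ x, ξ x ∂(ν t₁).meas = ∫ y, ξ (Z y t₁) ∂(ν 0).meas := by
  have hT : 0 ≤ T := ht₁.1.trans ht₁.2
  have m0 : (0 : ℝ) ∈ Icc 0 T := left_mem_Icc.2 hT
  have hr := hu.retract hρ
  obtain ⟨m, hm, hm'⟩ := hu.retract_bounds hρ
  obtain ⟨k, hk, hk'⟩ := h.ac
  have hK := hm.add hk
  set K : ℝ → ℝ := fun t => ∫ τ in (0 : ℝ)..t, (m τ + k τ) with hKd
  have ex : ∀ s ∈ Icc 0 T, ∀ y, ∃ X, IsCaraSol T (fun t x => u t (retract ρ x)) s y X :=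
    fun s hs y => hr.exists_isCaraSol hs y
  choose! Φ hΦ using ex
  have hΦs : ∀ s ∈ Icc 0 T, ∀ y, Φ s y s = y := fun s hs y => by
    rw [(hΦ s hs y).eqn s hs, intervalIntegral.integral_same, add_zero]
  set e := 2 * Real.exp (2 * ∫ τ in (0 : ℝ)..T, m τ) with he
  have lipΦ : ∀ s ∈ Icc 0 T, ∀ x y, ‖Φ s x t₁ - Φ s y t₁‖ ≤ e * ‖x - y‖ := by
    intro s hs x y
    obtain ⟨C, hC0, hC⟩ := exists_norm_le_of_continuousOn (hΦ s hs x).cont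
    obtain ⟨C', -, hC'⟩ := exists_norm_le_of_continuousOn (hΦ s hs y).cont
    have := hr.norm_sub_le (R := max C C') hm (hm'.mono fun t ht x _ y _ => ht.2 x y) hs
      (hΦ s hs x) (hΦ s hs y) (fun t ht => (hC t ht).trans (le_max_left _ _))
      (fun t ht => (hC' t ht).trans (le_max_right _ _)) ht₁
    exact this.trans_eq (by rw [he]; ring)
  -- Duality: g is the backward solution of the transport equation with datum ξ at time t₁, so its
  -- integral against ν should be constant in time. It is only Lipschitz, and must be mollified
  -- before being used as a test function.
  set g : ℝ → E d → ℝ := fun s y => ξ (Φ s y t₁) with hg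
  set G₁ := G * e with hG₁
  have hG₁0 : 0 ≤ G₁ := by positivity
  have glip : ∀ s ∈ Icc 0 T, ∀ x y, |g s x - g s y| ≤ G₁ * ‖x - y‖ := fun s hs x y =>
    (hξ _ _).trans ((mul_le_mul_of_nonneg_left (lipΦ s hs x y) hG0).trans_eq (by rw [hG₁]; ring))
  have gsemi : ∀ s ∈ Icc 0 T, ∀ t ∈ Icc 0 T, ∀ y, g s y = g t (Φ s y t) := fun s hs t ht y => by
    simp only [hg]
    rw [hr.unique ht (hr.restart hs ht (hΦ s hs y)) (hΦ t ht _) ht₁]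
  have key : ∀ δ > 0, |∫ x, ξ x ∂(ν t₁).meas - ∫ y, ξ (Z y t₁) ∂(ν 0).meas|
      ≤ δ * (G₁ * K t₁ + 2 * G₁) := by
    intro δ hδ
    obtain ⟨H, hH0, M, hM, hMc⟩ := exists_mollification (d := d) hδ hG₁0
    set f : ℝ → ℝ := fun t => ∫ x, M (g t) x ∂(ν t).meas with hf
    -- The part linear in the increment of K is the commutator between mollification and transport.
    -- Its total over [0,t₁] is at most G₁δK(t₁), which vanishes with δ; the quadratic part
    -- contributes nothing.
    have incr : ∀ s t, 0 ≤ s → s ≤ t → t ≤ T → |f t - f s|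
        ≤ (2 * H + 2 * G₁) * (K t - K s) ^ 2 + G₁ * δ * (K t - K s) := by
      intro s t hs hst htT
      have hsm : s ∈ Icc 0 T := ⟨hs, hst.trans htT⟩
      have htm : t ∈ Icc 0 T := ⟨hs.trans hst, htT⟩
      obtain ⟨a1, a2, a3, -⟩ := hM (g t) (glip t htm)
      have e1 := h.euler_step hp hρ hu hm hm' hk hk' a1 hG₁0 hH0 a2 a3 hs hst htT
      rw [← integral_sub_integral hK.2 m0 hsm htm] at e1
      change _ ≤ _ * (K t - K s) ^ 2 at e1
      set Δ := K t - K s with hΔ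
      have hΔe : Δ = (∫ τ in s..t, m τ) + ∫ τ in s..t, k τ := by
        rw [hΔ, hKd, integral_sub_integral hK.2 m0 hsm htm]
        exact intervalIntegral.integral_add (intervalIntegrable_of_mem_Icc hm.2 hsm htm)
          (intervalIntegrable_of_mem_Icc hk.2 hsm htm)
      have pm := hm.integral_nonneg hst
      have pk := hk.integral_nonneg hst
      -- Translate by translate, the Euler step from x is compared with the exact flow from x - z.
      -- The two displacements evaluate the field at points at distance at most δ + Δ.
      have pt : ∀ x, |M (g t) (x + ∫ τ in s..t, u τ (retract ρ x)) - M (g s) x|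
          ≤ G₁ * (Δ * (δ + Δ)) := by
        intro x
        refine hMc _ _ (glip t htm) (glip s hsm) _ _ _ fun z hz => ?_
        rw [gsemi s hsm t htm]
        refine (glip t htm _ _).trans (mul_le_mul_of_nonneg_left ?_ hG₁0)
        have hX := hΦ s hsm (x - z)
        rw [hX.eqn t htm]
        have i1 := intervalIntegrable_of_mem_Icc (hr.integrableOn_comp hX.cont) hsm htm
        have i2 := intervalIntegrable_of_mem_Icc
          (hr.integrableOn_comp (continuousOn_const (c := x))) hsm htm
        have e2 : x + (∫ τ in s..t, u τ (retract ρ x)) - z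
            - (x - z + ∫ τ in s..t, u τ (retract ρ (Φ s (x - z) τ)))
            = ∫ τ in s..t, (u τ (retract ρ x) - u τ (retract ρ (Φ s (x - z) τ))) := by
          rw [intervalIntegral.integral_sub i2 i1]; abel
        rw [e2]
        have e3 : ‖∫ τ in s..t, (u τ (retract ρ x) - u τ (retract ρ (Φ s (x - z) τ)))‖
            ≤ ∫ τ in s..t, m τ * (δ + Δ) := by
          refine intervalIntegral.norm_integral_le_of_norm_le hst ?_
            ((intervalIntegrable_of_mem_Icc hm.2 hsm htm).mul_const _)
          have hae := ae_restrict_uIoc_of_ae_leb hm' hsm htm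
          rw [uIoc_of_le hst] at hae
          refine (ae_restrict_iff' measurableSet_Ioc).1 ?_
          filter_upwards [hae, ae_restrict_mem measurableSet_Ioc] with τ h1 hτ
          have hτm : τ ∈ Icc 0 T := ⟨hs.trans hτ.1.le, hτ.2.trans htT⟩
          refine (h1.2 _ _).trans (mul_le_mul_of_nonneg_left ?_ (hm.1 τ))
          have e4 := norm_integral_le_of_ae_leb_of_le
            (f := fun σ => u σ (retract ρ (Φ s (x - z) σ))) hm.2
            (hm'.mono fun σ h => h.1 _) hsm hτm hτ.1.le
          have e5 := intervalIntegral.integral_add_adjacent_intervals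
            (intervalIntegrable_of_mem_Icc hm.2 hsm hτm) (intervalIntegrable_of_mem_Icc hm.2 hτm htm)
          have e6 := hm.integral_nonneg hτ.2
          rw [hX.eqn τ hτm]
          have e7 : x - (x - z + ∫ σ in s..τ, u σ (retract ρ (Φ s (x - z) σ)))
              = z - ∫ σ in s..τ, u σ (retract ρ (Φ s (x - z) σ)) := by abel
          rw [e7]
          refine (norm_sub_le _ _).trans ?_
          linarith
        rw [intervalIntegral.integral_mul_const] at e3
        exact e3.trans (mul_le_mul_of_nonneg_right (by linarith) (by linarith))
      obtain ⟨b1, -, -, -⟩ := hM (g s) (glip s hsm)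
      have hwc : Continuous fun x => ∫ τ in s..t, u τ (retract ρ x) := by
        refine (LipschitzWith.of_dist_le_mul (K := ⟨∫ τ in s..t, m τ, pm⟩) fun x y => ?_).continuous
        rw [dist_eq_norm, dist_eq_norm, ← intervalIntegral.integral_sub
          (intervalIntegrable_of_mem_Icc (hr.integrableOn_comp (continuousOn_const (c := x))) hsm htm)
          (intervalIntegrable_of_mem_Icc (hr.integrableOn_comp (continuousOn_const (c := y))) hsm htm)]
        refine (norm_integral_le_of_ae_leb_of_le (g := fun τ => m τ * ‖x - y‖)
          (Integrable.mul_const hm.2 _) (hm'.mono fun τ h => h.2 x y) hsm htm hst).trans_eq ?_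
        rw [intervalIntegral.integral_mul_const]; rfl
      have c1 : Continuous fun x => M (g t) (x + ∫ τ in s..t, u τ (retract ρ x)) :=
        a1.continuous.comp (continuous_id.add hwc)
      have e8 : |∫ x, M (g t) (x + ∫ τ in s..t, u τ (retract ρ x)) ∂(ν s).meas - f s|
          ≤ G₁ * (Δ * (δ + Δ)) := by
        rw [hf, ← MeasureTheory.integral_sub ((ν s).integrable_of_continuous c1)
          ((ν s).integrable_of_continuous b1.continuous)]
        have := norm_integral_le_of_norm_le_const (μ := (ν s).meas) (C := G₁ * (Δ * (δ + Δ)))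
          (f := fun x => M (g t) (x + ∫ τ in s..t, u τ (retract ρ x)) - M (g s) x)
          (.of_forall pt)
        simpa using this
      have := (abs_add_le _ _).trans (add_le_add e1 e8)
      rw [sub_add_sub_cancel] at this
      refine this.trans_eq ?_
      ring
    have sub : Icc 0 t₁ ⊆ Icc 0 T := Icc_subset_Icc_right ht₁.2
    have Km := hK.monotoneOn.mono sub
    have Kc := (continuousOn_primitive_Icc hK.2 m0).mono sub
    have K0 : K 0 = 0 := intervalIntegral.integral_same
    have u1 := le_of_increment_le_sq (h := fun t => f t - G₁ * δ * K t) (C := 2 * H + 2 * G₁)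
      ht₁.1 Km Kc (by positivity) fun s t hs hst ht => by
        have := (le_abs_self _).trans (incr s t hs hst (ht.trans ht₁.2))
        simp only [hKd] at this ⊢
        linarith
    have u2 := le_of_increment_le_sq (h := fun t => -f t - G₁ * δ * K t) (C := 2 * H + 2 * G₁)
      ht₁.1 Km Kc (by positivity) fun s t hs hst ht => by
        have := (neg_le_abs _).trans (incr s t hs hst (ht.trans ht₁.2))
        simp only [hKd] at this ⊢
        linarith
    simp only [K0] at u1 u2
    have close : ∀ t ∈ Icc 0 T, |f t - ∫ x, g t x ∂(ν t).meas| ≤ G₁ * δ := by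
      intro t ht
      obtain ⟨b1, -, -, b4⟩ := hM (g t) (glip t ht)
      have hgc : Continuous (g t) := by
        refine (LipschitzWith.of_dist_le_mul (K := ⟨G₁, hG₁0⟩) fun x y => ?_).continuous
        rw [Real.dist_eq, dist_eq_norm]
        exact glip t ht x y
      rw [hf, ← MeasureTheory.integral_sub ((ν t).integrable_of_continuous b1.continuous)
        ((ν t).integrable_of_continuous hgc)]
      have := norm_integral_le_of_norm_le_const (μ := (ν t).meas) (C := G₁ * δ)
        (f := fun x => M (g t) x - g t x) (.of_forall b4)
      simpa using this
    have c1 := close t₁ ht₁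
    have c0 := close 0 m0
    have e1 : ∫ x, g t₁ x ∂(ν t₁).meas = ∫ x, ξ x ∂(ν t₁).meas := by
      simp only [hg, hΦs t₁ ht₁]
    have e0 : ∫ x, g 0 x ∂(ν 0).meas = ∫ y, ξ (Z y t₁) ∂(ν 0).meas := by
      simp only [hg]
      refine integral_congr_ae (.of_forall fun y => ?_)
      simp only [hr.unique m0 (hΦ 0 m0 y) (hZ y) ht₁]
    rw [e1] at c1
    rw [e0] at c0
    rw [abs_le] at c1 c0 ⊢
    constructor <;> nlinarith
  by_contra hne
  have hpos : 0 < |∫ x, ξ x ∂(ν t₁).meas - ∫ y, ξ (Z y t₁) ∂(ν 0).meas| :=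
    abs_pos.2 (sub_ne_zero.2 hne)
  have hKt : 0 ≤ K t₁ := hK.integral_nonneg ht₁.1
  have hden : 0 < G₁ * K t₁ + 2 * G₁ + 1 := by positivity
  have := key (|∫ x, ξ x ∂(ν t₁).meas - ∫ y, ξ (Z y t₁) ∂(ν 0).meas| / (G₁ * K t₁ + 2 * G₁ + 1))
    (by positivity)
  rw [div_mul_eq_mul_div, le_div_iff₀ hden] at this
  nlinarith

end Representation

end WassLin

namespace WassLin

/-! ### Chain rule for functionals on a Banach space. -/

section ChainRule

variable {T : ℝ} {B : Type*} [NormedAddCommGroup B] [NormedSpace ℝ B] [CompleteSpace B]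

/-- Chain rule for a functional with bounded Lipschitz derivative along a primitive. -/
lemma integral_chain_rule (hT : 0 ≤ T) {A : B → ℝ} {A' : B → B →L[ℝ] ℝ} {H : ℝ} (hH0 : 0 ≤ H)
    (h1 : ∀ x, ‖A' x‖ ≤ H) (h2 : ∀ x y, ‖A' x - A' y‖ ≤ H * ‖x - y‖)
    (h3 : ∀ x y, |A y - A x - A' x (y - x)| ≤ H * ‖y - x‖ ^ 2) {Z f : ℝ → B}
    (hf : IntegrableOn f (Icc 0 T)) (hZc : ContinuousOn Z (Icc 0 T))
    (hZ : ∀ s ∈ Icc 0 T, ∀ t ∈ Icc 0 T, Z t - Z s = ∫ τ in s..t, f τ) :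
    IntegrableOn (fun t => A' (Z t) (f t)) (Icc 0 T) ∧
      A (Z T) - A (Z 0) = ∫ t in (0 : ℝ)..T, A' (Z t) (f t) := by
  have m0 : (0 : ℝ) ∈ Icc 0 T := left_mem_Icc.2 hT
  have mT : T ∈ Icc 0 T := right_mem_Icc.2 hT
  have hA'c : Continuous A' := (LipschitzWith.of_dist_le_mul (K := ⟨H, hH0⟩) fun x y => by
    rw [dist_eq_norm, dist_eq_norm]; exact h2 x y).continuous
  have hbm : AEStronglyMeasurable (fun t => A' (Z t) (f t)) (leb T) := by
    have e1 : AEStronglyMeasurable (fun t => A' (Z t)) (leb T) :=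
      (hA'c.comp_continuousOn hZc).aestronglyMeasurable measurableSet_Icc
    exact (ContinuousLinearMap.apply ℝ ℝ : B →L[ℝ] (B →L[ℝ] ℝ) →L[ℝ] ℝ).aestronglyMeasurable_comp₂
      hf.1 e1
  have hb : IntegrableOn (fun t => A' (Z t) (f t)) (Icc 0 T) := by
    refine Integrable.mono' (hf.norm.const_mul H) hbm (.of_forall fun t => ?_)
    exact ((A' _).le_opNorm _).trans (mul_le_mul_of_nonneg_right (h1 _) (norm_nonneg _))
  refine ⟨hb, ?_⟩
  have hn : L1Nonneg T (fun t => ‖f t‖) := ⟨fun t => norm_nonneg _, hf.norm⟩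
  set K : ℝ → ℝ := fun t => ∫ τ in (0 : ℝ)..t, ‖f τ‖ with hK
  set P : ℝ → ℝ := fun t => ∫ τ in (0 : ℝ)..t, A' (Z τ) (f τ) with hP
  -- One error comes from the Taylor expansion of A at Z(s), the other from freezing A' at Z(s)
  -- under the integral. Both are quadratic in the increment of K, so the two sides have equal total
  -- increments.
  have incr : ∀ s t, 0 ≤ s → s ≤ t → t ≤ T →
      |A (Z t) - A (Z s) - (P t - P s)| ≤ 2 * H * (K t - K s) ^ 2 := by
    intro s t hs hst htT
    have hsm : s ∈ Icc 0 T := ⟨hs, hst.trans htT⟩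
    have htm : t ∈ Icc 0 T := ⟨hs.trans hst, htT⟩
    have dK : K t - K s = ∫ τ in s..t, ‖f τ‖ := integral_sub_integral hn.2 m0 hsm htm
    have dP : P t - P s = ∫ τ in s..t, A' (Z τ) (f τ) := integral_sub_integral hb m0 hsm htm
    have bd : ∀ τ ∈ Icc s t, ‖Z τ - Z s‖ ≤ K t - K s := by
      intro τ hτ
      have hτm : τ ∈ Icc 0 T := ⟨hs.trans hτ.1, hτ.2.trans htT⟩
      rw [hZ s hsm τ hτm]
      have e1 := norm_integral_le_of_ae_leb_of_le hn.2 (.of_forall fun _ => le_rfl) hsm hτm hτ.1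
        (f := f)
      have e2 : K τ - K s = ∫ τ in s..τ, ‖f τ‖ := integral_sub_integral hn.2 m0 hsm hτm
      have e3 : K τ ≤ K t := hn.monotoneOn hτm htm hτ.2
      linarith
    have fi := intervalIntegrable_of_mem_Icc hf hsm htm
    have e1 := h3 (Z s) (Z t)
    have e2 : A' (Z s) (Z t - Z s) = ∫ τ in s..t, A' (Z s) (f τ) := by
      rw [hZ s hsm t htm, (A' (Z s)).intervalIntegral_comp_comm fi]
    have i2 : IntervalIntegrable (fun τ => A' (Z s) (f τ)) volume s t :=
      ⟨(A' (Z s)).integrable_comp fi.1, (A' (Z s)).integrable_comp fi.2⟩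
    have e3 : |A' (Z s) (Z t - Z s) - (P t - P s)| ≤ H * (K t - K s) ^ 2 := by
      rw [e2, dP, ← intervalIntegral.integral_sub i2 (intervalIntegrable_of_mem_Icc hb hsm htm)]
      have : ‖∫ τ in s..t, (A' (Z s) (f τ) - A' (Z τ) (f τ))‖
          ≤ ∫ τ in s..t, H * (K t - K s) * ‖f τ‖ := by
        refine intervalIntegral.norm_integral_le_of_norm_le hst (.of_forall fun τ hτ => ?_)
          ((intervalIntegrable_of_mem_Icc hn.2 hsm htm).const_mul _)
        rw [← sub_apply]
        refine ((A' (Z s) - A' (Z τ)).le_opNorm _).trans ?_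
        refine mul_le_mul_of_nonneg_right ?_ (norm_nonneg _)
        refine (h2 _ _).trans (mul_le_mul_of_nonneg_left ?_ hH0)
        rw [norm_sub_rev]
        exact bd τ ⟨hτ.1.le, hτ.2⟩
      rw [intervalIntegral.integral_const_mul, ← dK, Real.norm_eq_abs] at this
      exact this.trans_eq (by ring)
    have e4 : H * ‖Z t - Z s‖ ^ 2 ≤ H * (K t - K s) ^ 2 :=
      mul_le_mul_of_nonneg_left
        (pow_le_pow_left₀ (norm_nonneg _) (bd t (right_mem_Icc.2 hst)) 2) hH0
    have := (abs_add_le _ _).trans (add_le_add (e1.trans e4) e3)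
    rw [sub_add_sub_cancel] at this
    linarith
  have Km := hn.monotoneOn
  have Kc := continuousOn_primitive_Icc hn.2 m0
  have u1 := le_of_increment_le_sq (h := fun t => A (Z t) - P t) (C := 2 * H) hT Km Kc
    (by positivity) fun s t hs hst ht => by
      have := (le_abs_self _).trans (incr s t hs hst ht)
      simp only [hK] at this ⊢; linarith
  have u2 := le_of_increment_le_sq (h := fun t => -A (Z t) + P t) (C := 2 * H) hT Km Kc
    (by positivity) fun s t hs hst ht => by
      have := (neg_le_abs _).trans (incr s t hs hst ht)
      simp only [hK] at this ⊢; linarith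
  have P0 : P 0 = 0 := intervalIntegral.integral_same
  simp only [P0] at u1 u2
  linarith

end ChainRule

/-! ### Lagrangian solutions solve the continuity equation. -/

section Existence

variable {d : ℕ} {p T ρ : ℝ}

lemma hasDerivAt_slice {ξ : ℝ × E d → ℝ} (hξ : Differentiable ℝ ξ) (t : ℝ) (x : E d) :
    deriv (fun s => ξ (s, x)) t = fderiv ℝ ξ (t, x) (1, 0) := by
  have h1 : HasDerivAt (fun s : ℝ => (s, x)) ((1 : ℝ), (0 : E d)) t :=
    (hasDerivAt_id t).prodMk (hasDerivAt_const t x)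
  exact ((hξ (t, x)).hasFDerivAt.comp_hasDerivAt t h1).deriv

lemma inner_gradient_slice {ξ : ℝ × E d → ℝ} (hξ : Differentiable ℝ ξ) (t : ℝ) (x w : E d) :
    inner ℝ (gradient (fun y => ξ (t, y)) x) w = fderiv ℝ ξ (t, x) (0, w) := by
  rw [inner_gradient_left]
  have h1 : HasFDerivAt (fun y : E d => (t, y)) (ContinuousLinearMap.inr ℝ ℝ (E d)) x := by
    have := (hasFDerivAt_const (𝕜 := ℝ) t x).prodMk (hasFDerivAt_id x)
    exact this
  have h2 := ((hξ (t, x)).hasFDerivAt.comp x h1).fderiv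
  have h3 : fderiv ℝ (fun y => ξ (t, y)) x = _ := h2
  rw [h3]; rfl

/-- The functional `(t, X) ↦ ∫ ξ(t, X(x)) dμ(x)` and its derivative. -/
lemma exists_functional_derivative (hρ : 0 < ρ) (μ : Pc d) {ξ : ℝ × E d → ℝ}
    (hξ : ContDiff ℝ (⊤ : ℕ∞) ξ) (hξc : HasCompactSupport ξ) :
    ∃ H ≥ 0, ∃ A' : ℝ × BallMap d ρ → ℝ × BallMap d ρ →L[ℝ] ℝ,
      (∀ z w, A' z w = ∫ x, fderiv ℝ ξ (z.1, extend hρ z.2 x) (w.1, extend hρ w.2 x) ∂μ.meas) ∧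
      (∀ z, ‖A' z‖ ≤ H) ∧ (∀ y z, ‖A' y - A' z‖ ≤ H * ‖y - z‖) ∧
      ∀ y z, |∫ x, ξ (z.1, extend hρ z.2 x) ∂μ.meas - ∫ x, ξ (y.1, extend hρ y.2 x) ∂μ.meas
        - A' y (z - y)| ≤ H * ‖z - y‖ ^ 2 := by
  obtain ⟨H, hH0, hH1, hH2⟩ := exists_lipschitz_fderiv hξ hξc
  have hc : Continuous (fderiv ℝ ξ) := hξ.continuous_fderiv (by simp)
  have hev : ∀ z : ℝ × BallMap d ρ, Continuous fun x => (z.1, extend hρ z.2 x) :=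
    fun z => by fun_prop
  let D : ℝ × BallMap d ρ → C(E d, E d →L[ℝ] ℝ) := fun z =>
    ⟨fun x => (fderiv ℝ ξ (z.1, extend hρ z.2 x)).comp (ContinuousLinearMap.inr ℝ ℝ (E d)),
      (hc.comp (hev z)).clm_comp continuous_const⟩
  let A' : ℝ × BallMap d ρ → ℝ × BallMap d ρ →L[ℝ] ℝ := fun z =>
    (∫ x, fderiv ℝ ξ (z.1, extend hρ z.2 x) (1, 0) ∂μ.meas) •
      ContinuousLinearMap.fst ℝ ℝ (BallMap d ρ)
      + (pairing μ hρ (D z)).comp (ContinuousLinearMap.snd ℝ ℝ (BallMap d ρ))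
  have formula : ∀ z w, A' z w
      = ∫ x, fderiv ℝ ξ (z.1, extend hρ z.2 x) (w.1, extend hρ w.2 x) ∂μ.meas := by
    intro z w
    have e1 : ∀ x, fderiv ℝ ξ (z.1, extend hρ z.2 x) (w.1, extend hρ w.2 x)
        = fderiv ℝ ξ (z.1, extend hρ z.2 x) (1, 0) * w.1
          + D z x (extend hρ w.2 x) := by
      intro x
      have : (w.1, extend hρ w.2 x) = w.1 • ((1 : ℝ), (0 : E d)) + (0, extend hρ w.2 x) := by simp
      rw [this, map_add, map_smul, smul_eq_mul, mul_comm]; rfl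
    simp only [e1]
    have i1 : Integrable (fun x => fderiv ℝ ξ (z.1, extend hρ z.2 x) (1, 0) * w.1) μ.meas :=
      μ.integrable_of_continuous (((hc.comp (hev z)).clm_apply continuous_const).mul
        continuous_const)
    have i2 : Integrable (fun x => D z x (extend hρ w.2 x)) μ.meas :=
      μ.integrable_of_continuous (by fun_prop)
    rw [integral_add i1 i2, integral_mul_const]
    rfl
  have hpair : ∀ (w : ℝ × BallMap d ρ) x, ‖(w.1, extend hρ w.2 x)‖ ≤ ‖w‖ := fun w x =>
    max_le_max le_rfl (norm_extend_le hρ w.2 x)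
  have hsub : ∀ (y z : ℝ × BallMap d ρ) x,
      (y.1, extend hρ y.2 x) - (z.1, extend hρ z.2 x)
        = ((y - z).1, extend hρ (y - z).2 x) := fun y z x => rfl
  have hci : ∀ z w : ℝ × BallMap d ρ, Continuous fun x =>
      fderiv ℝ ξ (z.1, extend hρ z.2 x) (w.1, extend hρ w.2 x) := fun z w =>
    (hc.comp (hev z)).clm_apply (hev w)
  have bound : ∀ {f : E d → ℝ} {C : ℝ}, (∀ x, |f x| ≤ C) → |∫ x, f x ∂μ.meas| ≤ C := by
    intro f C hf
    have := norm_integral_le_of_norm_le_const (μ := μ.meas) (C := C) (f := f) (.of_forall hf)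
    simpa using this
  refine ⟨H, hH0.le, A', formula, fun z => ?_, fun y z => ?_, fun y z => ?_⟩
  · refine ContinuousLinearMap.opNorm_le_bound _ hH0.le fun w => ?_
    rw [formula]
    exact bound fun x => ((fderiv ℝ ξ _).le_opNorm _).trans
      (mul_le_mul (hH1 _) (hpair w x) (norm_nonneg _) hH0.le)
  · refine ContinuousLinearMap.opNorm_le_bound _ (by positivity) fun w => ?_
    rw [sub_apply, formula, formula, ← integral_sub (μ.integrable_of_continuous (hci y w))
      (μ.integrable_of_continuous (hci z w))]
    refine bound fun x => ?_
    rw [← sub_apply]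
    refine ((_ : ℝ × E d →L[ℝ] ℝ).le_opNorm _).trans
      (mul_le_mul ((hH2 _ _).trans ?_) (hpair w x) (norm_nonneg _) (by positivity))
    rw [hsub]
    exact mul_le_mul_of_nonneg_left (hpair _ x) hH0.le
  · have j1 : ∀ z : ℝ × BallMap d ρ, Continuous fun x => ξ (z.1, extend hρ z.2 x) := fun z =>
      hξ.continuous.comp (hev z)
    have i1 : Integrable (fun x => ξ (z.1, extend hρ z.2 x) - ξ (y.1, extend hρ y.2 x)) μ.meas :=
      μ.integrable_of_continuous ((j1 z).sub (j1 y))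
    rw [formula, ← integral_sub (μ.integrable_of_continuous (j1 z))
      (μ.integrable_of_continuous (j1 y)), ← integral_sub i1
      (μ.integrable_of_continuous (hci y (z - y)))]
    refine bound fun x => ?_
    have := norm_taylor_le (hξ.differentiable (by simp)) hH2 hH0.le (y.1, extend hρ y.2 x)
      (z.1, extend hρ z.2 x)
    rw [hsub] at this
    refine this.trans (mul_le_mul_of_nonneg_left ?_ hH0.le)
    exact pow_le_pow_left₀ (norm_nonneg _) (hpair _ x) 2

/-- Lagrangian solutions induce solutions of the continuity equation. -/
lemma IsCaraSol.isSolution (hT : 0 < T) (hp : 1 ≤ p) {v : ℝ → Pc d → E d → E d} (hv : HypCE p T v)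
    {μ : Pc d} {hρ : 0 < ρ} {X₀ : BallMap d ρ} {X : ℝ → BallMap d ρ}
    (hX : IsCaraSol T (liftField v μ hρ) 0 X₀ X) :
    IsSolution p T v (μ.push (extend hρ X₀)).meas (fun t => μ.push (extend hρ (X t))) where
  ac := by
    have hl := hv.caraField_lift hp μ hρ
    have hi := hl.integrableOn_comp hX.cont
    refine ⟨fun t => ‖liftField v μ hρ t (X t)‖, ⟨fun _ => norm_nonneg _, hi.norm⟩,
      fun s t hs hst ht => (wass_push_extend_le hp hρ μ _ _).trans ?_⟩
    have hsm : s ∈ Icc 0 T := ⟨hs, hst.trans ht⟩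
    have htm : t ∈ Icc 0 T := ⟨hs.trans hst, ht⟩
    rw [norm_sub_rev, (hl.restart (left_mem_Icc.2 hT.le) hsm hX).eqn t htm, add_sub_cancel_left]
    exact norm_integral_le_of_ae_leb_of_le hi.norm (.of_forall fun _ => le_rfl) hsm htm hst
  eqn := by
    intro ξ hξ hξc hξs
    have m0 : (0 : ℝ) ∈ Icc 0 T := left_mem_Icc.2 hT.le
    have mT : T ∈ Icc 0 T := right_mem_Icc.2 hT.le
    have hξd : Differentiable ℝ ξ := hξ.differentiable (by simp)
    obtain ⟨H, hH0, A', hA, h1, h2, h3⟩ := exists_functional_derivative hρ μ hξ hξc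
    have hl := hv.caraField_lift hp μ hρ
    have hi := hl.integrableOn_comp hX.cont
    -- Time is adjoined to the state with speed 1, so that a time-dependent test function becomes an
    -- autonomous functional. The boundary terms vanish because the test function does at times 0
    -- and T.
    set f : ℝ → ℝ × BallMap d ρ := fun t => (1, liftField v μ hρ t (X t)) with hf
    have hfi : IntegrableOn f (Icc 0 T) := by
      have : IntegrableOn (fun _ : ℝ => (1 : ℝ)) (Icc 0 T) := by simp [IntegrableOn]
      exact Integrable.prodMk this hi
    obtain ⟨b1, b2⟩ := integral_chain_rule hT.le hH0 h1 h2 h3 (Z := fun t => (t, X t)) hfi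
      (continuousOn_id.prodMk hX.cont) fun s hs t ht => by
        have hfi' := intervalIntegrable_of_mem_Icc hfi hs ht
        have e1 := (ContinuousLinearMap.fst ℝ ℝ (BallMap d ρ)).intervalIntegral_comp_comm hfi'
        have e2 := (ContinuousLinearMap.snd ℝ ℝ (BallMap d ρ)).intervalIntegral_comp_comm hfi'
        refine Prod.ext ?_ ?_
        · refine Eq.trans ?_ e1
          simp [hf]
        · refine Eq.trans ?_ e2
          simp only [hf, ContinuousLinearMap.coe_snd', Prod.snd_sub]
          rw [(hl.restart m0 hs hX).eqn t ht, add_sub_cancel_left]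
    have key : ∀ᵐ t ∂leb T, A' (t, X t) (f t) = ∫ x, (deriv (fun s => ξ (s, x)) t
        + inner ℝ (gradient (fun y => ξ (t, y)) x) (v t (μ.push (extend hρ (X t))) x))
        ∂(μ.push (extend hρ (X t))).meas := by
      filter_upwards [hv.ae_continuous] with t ht
      have e1 : ∀ x, deriv (fun s => ξ (s, x)) t
          + inner ℝ (gradient (fun y => ξ (t, y)) x) (v t (μ.push (extend hρ (X t))) x)
          = fderiv ℝ ξ (t, x) (1, v t (μ.push (extend hρ (X t))) x) := by
        intro x
        rw [hasDerivAt_slice hξd, inner_gradient_slice hξd, ← map_add]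
        simp
      simp only [e1]
      have hc : Continuous (fderiv ℝ ξ) := hξ.continuous_fderiv (by simp)
      have hcx : Continuous fun x => fderiv ℝ ξ (t, x) (1, v t (μ.push (extend hρ (X t))) x) :=
        (hc.comp (by fun_prop)).clm_apply (continuous_const.prodMk (ht _))
      rw [hA, Pc.integral_push _ _ hcx]
      refine integral_congr_ae (.of_forall fun x => ?_)
      simp only [hf, extend_apply, liftField_apply ht]
    have hz : ∀ t x, t ∉ Ioo 0 T → ξ (t, x) = 0 := fun t x ht =>
      image_eq_zero_of_notMem_tsupport fun h => ht (hξs h).1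
    have key' := ae_restrict_uIoc_of_ae_leb key m0 mT
    refine ⟨(intervalIntegrable_of_mem_Icc b1 m0 mT).congr_ae key', ?_⟩
    rw [← intervalIntegral.integral_congr_ae_restrict key', ← b2]
    simp [hz T _ (by simp), hz 0 _ (by simp)]
  init := by
    have : X 0 = X₀ := by
      rw [hX.eqn 0 (left_mem_Icc.2 hT.le), intervalIntegral.integral_same, add_zero]
    rw [this]

end Existence

/-! ### Every solution is Lagrangian, hence unique. -/

section Lagrangian

variable {d : ℕ} {p T ρ : ℝ}

/-- Freezing the solution in the velocity makes the equation local and linear. The radius is left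
free from below so that it can later contain the characteristics as well. -/
lemma IsSolution.exists_isWeakSol (hT : 0 < T) (hp : 1 ≤ p) {v : ℝ → Pc d → E d → E d}
    (hv : HypCE p T v) {μ₀ : Measure (E d)} {ν : ℝ → Pc d} (h : IsSolution p T v μ₀ ν) :
    CaraField T (fun t x => v t (ν t) x) ∧
      ∃ ρ₀ > 0, ∀ ρ ≥ ρ₀, IsWeakSol p T ρ (fun t x => v t (ν t) x) ν := by
  obtain ⟨R, hR0, hR⟩ := h.eqn.exists_inBall hT hp hv h.ac
  exact ⟨hv.caraField_frozen hR fun t ht => h.ac.tendsto_wass ht, R, hR0, fun ρ hρ =>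
    ⟨h.ac, fun t ht => (hR t ht).mono hρ, fun ζ h1 h2 => h.eqn.integral_sub hT hp hv h.ac h1 h2⟩⟩

/-- Every solution of the nonlocal continuity equation is Lagrangian. -/
lemma IsSolution.eq_push (hT : 0 < T) (hp : 1 ≤ p) {v : ℝ → Pc d → E d → E d} (hv : HypCE p T v)
    {μ : Pc d} {hρ : 0 < ρ} {X₀ : BallMap d ρ} {X : ℝ → BallMap d ρ}
    (hX : IsCaraSol T (liftField v μ hρ) 0 X₀ X) {ν : ℝ → Pc d}
    (h : IsSolution p T v (μ.push (extend hρ X₀)).meas ν) {t : ℝ} (ht : t ∈ Icc 0 T) :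
    ν t = μ.push (extend hρ (X t)) := by
  have m0 : (0 : ℝ) ∈ Icc 0 T := left_mem_Icc.2 hT.le
  obtain ⟨hu, ρ₀, hρ₀, hw⟩ := h.exists_isWeakSol hT hp hv
  have hu' := hu.hypCE p
  -- Y is the flow of the frozen field, seen as a non-local field that ignores the measure. Once ν
  -- is known to be the push-forward of μ by Y, the frozen and the true lifted fields coincide along
  -- Y, and uniqueness identifies Y with X. The radius max ρ₀ C makes the retraction inactive both
  -- on the supports of ν and on the trajectories of Y.
  obtain ⟨Y, hY⟩ := (hu'.caraField_lift hp μ hρ).exists_isCaraSol m0 X₀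
  obtain ⟨C, hC0, hC⟩ := exists_norm_le_of_continuousOn hY.cont
  have hρ₁ : 0 < max ρ₀ C := lt_max_of_lt_left hρ₀
  have hr := hu.retract hρ₁
  choose Z hZ using fun y : E d => hr.exists_isCaraSol m0 y
  obtain ⟨m, hm, hm'⟩ := hu.retract_bounds hρ₁
  have hν0 : ν 0 = μ.push (extend hρ X₀) := Pc.ext_meas h.init
  have hYeq : ∀ s ∈ Icc 0 T, ν s = μ.push (extend hρ (Y s)) := by
    intro s hs
    refine Pc.ext_of_lipschitz fun ξ ⟨G, hG0, hG⟩ => ?_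
    have hξc : Continuous ξ := by
      refine (LipschitzWith.of_dist_le_mul (K := ⟨G, hG0⟩) fun x y => ?_).continuous
      rw [Real.dist_eq, dist_eq_norm]; exact hG x y
    have hZc : Continuous fun y => Z y s := by
      refine (LipschitzWith.of_dist_le_mul
        (K := ⟨2 * Real.exp (2 * ∫ τ in (0 : ℝ)..T, m τ), by positivity⟩) fun x y => ?_).continuous
      obtain ⟨C₁, hC₁0, hC₁⟩ := exists_norm_le_of_continuousOn (hZ x).cont
      obtain ⟨C₂, -, hC₂⟩ := exists_norm_le_of_continuousOn (hZ y).cont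
      have := hr.norm_sub_le (R := max C₁ C₂) hm (hm'.mono fun t ht x _ y _ => ht.2 x y) m0
        (hZ x) (hZ y) (fun t ht => (hC₁ t ht).trans (le_max_left _ _))
        (fun t ht => (hC₂ t ht).trans (le_max_right _ _)) hs
      rw [dist_eq_norm, dist_eq_norm]
      refine this.trans_eq ?_
      change _ = 2 * Real.exp (2 * ∫ τ in (0 : ℝ)..T, m τ) * ‖x - y‖
      ring
    rw [(hw _ (le_max_left _ C)).integral_eq hp hρ₁ hu hG0 hG hs hZ, hν0,
      Pc.integral_push _ _ (f := fun y => ξ (Z y s)) (hξc.comp hZc), Pc.integral_push _ _ hξc]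
    refine integral_congr_ae (.of_forall fun x => ?_)
    simp only [extend_apply]
    have e1 := IsCaraSol.eval hp hu' m0 hY (toBall hρ x)
    have e2 : IsCaraSol T (fun t x => v t (ν t) (retract (max ρ₀ C) x)) 0 (X₀ (toBall hρ x))
        (fun t => Y t (toBall hρ x)) := by
      refine ⟨e1.cont, fun t ht => ?_⟩
      rw [e1.eqn t ht]
      congr 1
      refine intervalIntegral.integral_congr fun τ hτ => ?_
      have hτm := (convex_Icc (0 : ℝ) T).ordConnected.uIcc_subset m0 ht hτ
      rw [retract_of_le hρ₁]
      exact ((Y τ).norm_coe_le_norm _).trans ((hC τ hτm).trans (le_max_right _ _))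
    rw [hr.unique m0 (hZ _) e2 hs]
  have hYX : IsCaraSol T (liftField v μ hρ) 0 X₀ Y := by
    refine ⟨hY.cont, fun s hs => ?_⟩
    rw [hY.eqn s hs]
    congr 1
    refine intervalIntegral.integral_congr fun τ hτ => ?_
    have hτm := (convex_Icc (0 : ℝ) T).ordConnected.uIcc_subset m0 hs hτ
    simp only [liftField, hYeq τ hτm]
  rw [hYeq t ht, (hv.caraField_lift hp μ hρ).unique m0 hYX hX ht]

end Lagrangian

end WassLin

namespace WassLin

/-! ### The flow family along the curve. -/

section Flow

variable {d : ℕ} {p T : ℝ}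

lemma IsNonlocalFlow.isCaraSol {v : ℝ → Pc d → E d → E d} {μ : ℝ → Pc d}
    {Φ : ℝ → ℝ → E d → E d} (h : IsNonlocalFlow T v μ Φ) {s : ℝ} (hs : s ∈ Icc 0 T) (x : E d) :
    IsCaraSol T (fun t x => v t (μ t) x) s x (fun t => Φ s t x) := by
  have hT : 0 ≤ T := hs.1.trans hs.2
  have m0 : (0 : ℝ) ∈ Icc 0 T := left_mem_Icc.2 hT
  have mT : T ∈ Icc 0 T := right_mem_Icc.2 hT
  have hi : IntegrableOn (fun σ => v σ (μ σ) (Φ s σ x)) (Icc 0 T) :=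
    (intervalIntegrable_iff_integrableOn_Icc_of_le hT).1
      ((h s hs 0 m0 x).1.symm.trans (h s hs T mT x).1)
  exact ⟨(continuousOn_const.add (continuousOn_primitive_Icc hi hs)).congr
    fun t ht => (h s hs t ht x).2, fun t ht => (h s hs t ht x).2⟩

lemma exists_isNonlocalFlow {v : ℝ → Pc d → E d → E d} {μ : ℝ → Pc d}
    (hu : CaraField T (fun t x => v t (μ t) x)) :
    ∃ Φ : ℝ → ℝ → E d → E d, IsNonlocalFlow T v μ Φ ∧
      ∀ Φ', IsNonlocalFlow T v μ Φ' → ∀ s ∈ Icc 0 T, ∀ t ∈ Icc 0 T, ∀ x, Φ' s t x = Φ s t x := by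
  have ex : ∀ s ∈ Icc 0 T, ∀ x, ∃ X, IsCaraSol T (fun t x => v t (μ t) x) s x X :=
    fun s hs x => hu.exists_isCaraSol hs x
  choose! Ψ hΨ using ex
  have hflow : IsNonlocalFlow T v μ fun s t x => Ψ s x t := fun s hs t ht x =>
    ⟨intervalIntegrable_of_mem_Icc (hu.integrableOn_comp (hΨ s hs x).cont) hs ht,
      (hΨ s hs x).eqn t ht⟩
  exact ⟨_, hflow, fun Φ' h' s hs t ht x =>
    hu.unique hs (h'.isCaraSol hs x) (hflow.isCaraSol hs x) ht⟩

variable {v : ℝ → Pc d → E d → E d} {μ : ℝ → Pc d} {Φ : ℝ → ℝ → E d → E d}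

lemma IsNonlocalFlow.self (h : IsNonlocalFlow T v μ Φ) {s : ℝ} (hs : s ∈ Icc 0 T) (x : E d) :
    Φ s s x = x := by
  rw [(h s hs s hs x).2, intervalIntegral.integral_same, add_zero]

lemma IsNonlocalFlow.comp (h : IsNonlocalFlow T v μ Φ)
    (hu : CaraField T (fun t x => v t (μ t) x)) {r s t : ℝ} (hr : r ∈ Icc 0 T) (hs : s ∈ Icc 0 T)
    (ht : t ∈ Icc 0 T) (x : E d) : Φ s t (Φ r s x) = Φ r t x :=
  hu.unique hs (h.isCaraSol hs _) (hu.restart hr hs (h.isCaraSol hr x)) ht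

lemma IsNonlocalFlow.exists_bound (h : IsNonlocalFlow T v μ Φ)
    (hu : CaraField T (fun t x => v t (μ t) x)) (r : ℝ) :
    ∃ C > 0, ∀ s ∈ Icc 0 T, ∀ t ∈ Icc 0 T, ∀ x, ‖x‖ ≤ r → ‖Φ s t x‖ ≤ C := by
  obtain ⟨m, hm, hm'⟩ := hu.growth
  refine ⟨max (2 * (r + ∫ τ in (0 : ℝ)..T, m τ) * Real.exp (2 * ∫ τ in (0 : ℝ)..T, m τ)) 1,
    by positivity, fun s hs t ht x hx => le_max_of_le_left ?_⟩
  refine ((h.isCaraSol hs x).norm_le_of_growth hm hm' hs ht).trans ?_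
  have := Real.exp_pos (2 * ∫ τ in (0 : ℝ)..T, m τ)
  gcongr

lemma IsNonlocalFlow.exists_lipschitz (h : IsNonlocalFlow T v μ Φ)
    (hu : CaraField T (fun t x => v t (μ t) x)) (r : ℝ) :
    ∃ C > 0, ∀ s ∈ Icc 0 T, ∀ t ∈ Icc 0 T, ∀ x y, ‖x‖ ≤ r → ‖y‖ ≤ r →
      ‖Φ s t x - Φ s t y‖ ≤ C * ‖x - y‖ := by
  obtain ⟨R, hR0, hR⟩ := h.exists_bound hu r
  obtain ⟨l, hl, hl'⟩ := hu.lip R hR0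
  refine ⟨2 * Real.exp (2 * ∫ τ in (0 : ℝ)..T, l τ), by positivity,
    fun s hs t ht x y hx hy => ?_⟩
  refine (hu.norm_sub_le hl hl' hs (h.isCaraSol hs x) (h.isCaraSol hs y)
    (fun t ht => hR s hs t ht x hx) (fun t ht => hR s hs t ht y hy) ht).trans_eq ?_
  ring

lemma IsNonlocalFlow.continuous (h : IsNonlocalFlow T v μ Φ)
    (hu : CaraField T (fun t x => v t (μ t) x)) {s t : ℝ} (hs : s ∈ Icc 0 T) (ht : t ∈ Icc 0 T) :
    Continuous (Φ s t) := by
  refine continuous_iff_continuousAt.2 fun x => ?_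
  obtain ⟨C, hC0, hC⟩ := h.exists_lipschitz hu (‖x‖ + 1)
  have hl : LipschitzOnWith ⟨C, hC0.le⟩ (Φ s t) (Metric.closedBall 0 (‖x‖ + 1)) :=
    LipschitzOnWith.of_dist_le_mul fun y hy z hz => by
      rw [dist_eq_norm, dist_eq_norm]
      exact hC s hs t ht y z (by simpa using hy) (by simpa using hz)
  refine hl.continuousOn.continuousAt (Metric.closedBall_mem_nhds_of_mem ?_)
  simp

/-- Backward flows are jointly continuous in the initial time and the initial point. -/
lemma IsNonlocalFlow.continuousOn_initial (h : IsNonlocalFlow T v μ Φ)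
    (hu : CaraField T (fun t x => v t (μ t) x)) {r : ℝ} (hr : r ∈ Icc 0 T) :
    ContinuousOn (fun z : ℝ × E d => Φ z.1 r z.2) (Icc 0 T ×ˢ univ) := by
  rintro ⟨s, y⟩ ⟨hs, -⟩
  obtain ⟨B, hB0, hB⟩ := h.exists_bound hu (‖y‖ + 1)
  obtain ⟨C, hC0, hC⟩ := h.exists_lipschitz hu (max B (‖y‖ + 1))
  -- By the flow property the two values are the images under the same map, from time z.1 to r, of
  -- z.2 and Φ(s, z.1, y). The uniform Lipschitz bound then reduces the claim to this limit.
  have h1 : Tendsto (fun z : ℝ × E d => z.2 - Φ s z.1 y) (𝓝[Icc 0 T ×ˢ univ] (s, y)) (𝓝 0) := by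
    have hc : ContinuousOn (fun z : ℝ × E d => z.2 - Φ s z.1 y) (Icc 0 T ×ˢ univ) :=
      continuousOn_snd.sub ((h.isCaraSol hs y).cont.comp continuousOn_fst fun z hz => hz.1)
    have := (hc (s, y) ⟨hs, mem_univ _⟩).tendsto
    simpa [h.self hs] using this
  rw [ContinuousWithinAt, tendsto_iff_norm_sub_tendsto_zero]
  refine tendsto_of_tendsto_of_tendsto_of_le_of_le' tendsto_const_nhds
    (by simpa using (h1.norm.const_mul C)) (.of_forall fun _ => norm_nonneg _) ?_
  have hnear : ∀ᶠ z : ℝ × E d in 𝓝[Icc 0 T ×ˢ univ] (s, y), ‖z.2‖ < ‖y‖ + 1 :=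
    mem_nhdsWithin_of_mem_nhds (continuous_snd.norm.continuousAt.eventually_lt
      continuousAt_const (by simp))
  filter_upwards [hnear, self_mem_nhdsWithin] with z hz hzm
  change ‖Φ z.1 r z.2 - Φ s r y‖ ≤ _
  rw [← h.comp hu hs hzm.1 hr y]
  exact hC z.1 hzm.1 r hr _ _ (le_max_of_le_right hz.le)
    (le_max_of_le_left (hB s hs z.1 hzm.1 y (by linarith)))

end Flow

/-! ### Identification of the flow with the Lagrangian solution. -/

section Lagrange

variable {d : ℕ} {p T ρ R : ℝ}

/-- Restriction of a map to a ball. -/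
def toBallMap (ρ : ℝ) (f : C(E d, E d)) : BallMap d ρ := f.restrict (Metric.closedBall 0 ρ)

lemma extend_toBallMap (hρ : 0 < ρ) (f : C(E d, E d)) {x : E d} (hx : ‖x‖ ≤ ρ) :
    extend hρ (toBallMap ρ f) x = f x := by
  rw [extend_of_norm_le hρ _ hx]; rfl

/-- The flow map on a ball is the Lagrangian solution starting from the identity. -/
lemma IsSolution.exists_lagrangian (hT : 0 < T) (hp : 1 ≤ p) {v : ℝ → Pc d → E d → E d}
    (hv : HypCE p T v) {μ₀ : Pc d} {μ : ℝ → Pc d} (hμ : IsSolution p T v μ₀.meas μ)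
    (hμ₀ : μ₀.InBall R) (hu : CaraField T (fun t x => v t (μ t) x))
    {Φ : ℝ → ℝ → E d → E d} (hΦ : IsNonlocalFlow T v μ Φ) (hρ : 0 < ρ) (hRρ : R ≤ ρ) :
    ∃ X : ℝ → BallMap d ρ,
      IsCaraSol T (liftField v μ₀ hρ) 0 (toBallMap ρ (ContinuousMap.id _)) X ∧
      (∀ t ∈ Icc 0 T, μ t = μ₀.push (extend hρ (X t))) ∧
      ∀ t ∈ Icc 0 T, ∀ x : Metric.closedBall (0 : E d) ρ, X t x = Φ 0 t x := by
  have m0 : (0 : ℝ) ∈ Icc 0 T := left_mem_Icc.2 hT.le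
  obtain ⟨X, hX⟩ := (hv.caraField_lift hp μ₀ hρ).exists_isCaraSol m0
    (toBallMap ρ (ContinuousMap.id _))
  have e0 : μ₀.push (extend hρ (toBallMap ρ (ContinuousMap.id _))) = μ₀ := by
    conv_rhs => rw [← μ₀.push_id]
    exact Pc.push_congr (hμ₀.ae_norm_le.mono fun x hx => extend_toBallMap hρ _ (hx.trans hRρ))
  have hμX : ∀ t ∈ Icc 0 T, μ t = μ₀.push (extend hρ (X t)) := fun t ht =>
    IsSolution.eq_push hT hp hv hX (by rw [e0]; exact hμ) ht
  refine ⟨X, hX, hμX, fun t ht x => ?_⟩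
  have e1 := IsCaraSol.eval hp hv m0 hX x
  have e2 : IsCaraSol T (fun t x => v t (μ t) x) 0 (x : E d) (fun t => X t x) := by
    refine ⟨e1.cont, fun t ht => ?_⟩
    rw [e1.eqn t ht]
    congr 1
    refine intervalIntegral.integral_congr fun τ hτ => ?_
    have hτm := (convex_Icc (0 : ℝ) T).ordConnected.uIcc_subset m0 ht hτ
    simp only [hμX τ hτm]
  exact hu.unique m0 e2 (hΦ.isCaraSol m0 x) ht

end Lagrange

/-! ### Uniqueness for the linearised problem. -/

section Linear

variable {d : ℕ} {p T ρ R : ℝ}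

lemma linRHS_congr {v : ℝ → Pc d → E d → E d} {Dμ : ℝ → Pc d → E d → E d → E d →L[ℝ] E d}
    {w : ℝ → E d → E d} {μ : ℝ → Pc d} {Φ : ℝ → ℝ → E d → E d} {F F' : ℝ → E d → E d}
    (hμ₀ : (μ 0).InBall R) {t : ℝ} {x : E d} (hx : F t x = F' t x)
    (h : ∀ y, ‖y‖ ≤ R → F t y = F' t y) : linRHS v Dμ w μ Φ F t x = linRHS v Dμ w μ Φ F' t x := by
  rw [linRHS, linRHS, hx]
  congr 1
  exact integral_congr_ae (hμ₀.ae_norm_le.mono fun y hy => by simp only [h y hy])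

/-- Radius zero, possible when the curve stays at the Dirac mass at the origin, is treated apart
because the radial formula is controlled only for positive radii. -/
lemma exists_retraction (hR : 0 ≤ R) : ∃ r : C(E d, E d), (∀ x, ‖r x‖ ≤ R) ∧ ∀ x, ‖x‖ ≤ R → r x = x := by
  rcases hR.eq_or_lt with rfl | h
  · refine ⟨ContinuousMap.const _ 0, by simp, fun x hx => ?_⟩
    simpa using (norm_le_zero_iff.1 hx).symm
  · exact ⟨⟨retract R, continuous_retract h⟩, norm_retract_le h, fun x hx => retract_of_le h hx⟩

/-- The nonlocal part of the derivative is bounded by the Lipschitz constant in the measure. -/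
lemma norm_integral_differential_le (hp : 1 ≤ p) {φ : Pc d → E d} {μ₀ : Pc d} {f F : C(E d, E d)}
    {D : E d → E d →L[ℝ] E d} (h : IsWassDifferential φ (μ₀.push f) D) {L C r : ℝ} (hL0 : 0 ≤ L)
    (hL : ∀ μ ν : Pc d, μ.InBall r → ν.InBall r → ‖φ μ - φ ν‖ ≤ L * wass p μ ν)
    (hf : ∀ᵐ x ∂μ₀.meas, ‖f x‖ ≤ r - 1) (hF : ∀ᵐ x ∂μ₀.meas, ‖F x‖ ≤ C) :
    ‖∫ x, D (f x) (F x) ∂μ₀.meas‖ ≤ L * C := by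
  have hC0 : 0 ≤ C := by
    obtain ⟨x, hx⟩ := hF.exists
    exact (norm_nonneg _).trans hx
  -- The integral is the derivative at s = 0 of φ along (f + sF)_#μ₀, a function whose increments
  -- from 0 are bounded by LC|s| for small s. The margin 1 in the bound on f keeps the perturbed
  -- measures in the ball of radius r.
  refine (integrable_differential_comp h F).2.le_of_lip' (by positivity) ?_
  filter_upwards [Metric.ball_mem_nhds (0 : ℝ) (by positivity : 0 < 1 / (C + 1))] with s hs
  rw [mem_ball_zero_iff, lt_div_iff₀ (by positivity)] at hs
  have hsC : ‖s‖ * C ≤ 1 := by nlinarith [norm_nonneg s]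
  have e1 : (μ₀.push (f + s • F)).InBall r := by
    refine Pc.push_inBall ?_
    filter_upwards [hf, hF] with x h1 h2
    have : ‖s • F x‖ ≤ ‖s‖ * C := by
      rw [norm_smul]; exact mul_le_mul_of_nonneg_left h2 (norm_nonneg s)
    have := norm_add_le (f x) (s • F x)
    change ‖f x + s • F x‖ ≤ r
    linarith
  have e2 : (μ₀.push (f + (0 : ℝ) • F)).InBall r := by
    refine Pc.push_inBall ?_
    filter_upwards [hf] with x h1
    change ‖f x + (0 : ℝ) • F x‖ ≤ r
    rw [zero_smul, add_zero]; linarith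
  refine (hL _ _ e1 e2).trans ?_
  have e3 : wass p (μ₀.push (f + s • F)) (μ₀.push (f + (0 : ℝ) • F)) ≤ C * ‖s - 0‖ := by
    refine wass_push_le hp (by positivity) (hF.mono fun x hx => ?_)
    have : (f + s • F) x - (f + (0 : ℝ) • F) x = s • F x := by
      change (f x + s • F x) - (f x + (0 : ℝ) • F x) = _
      rw [zero_smul]; abel
    rw [this, norm_smul, sub_zero, mul_comm]
    exact mul_le_mul_of_nonneg_right hx (norm_nonneg _)
  exact (mul_le_mul_of_nonneg_left e3 hL0).trans_eq (by ring)

lemma IsLinSolution.mono {v : ℝ → Pc d → E d → E d} {Dμ : ℝ → Pc d → E d → E d → E d →L[ℝ] E d}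
    {w : ℝ → E d → E d} {μ : ℝ → Pc d} {Φ : ℝ → ℝ → E d → E d} {F₀ : E d → E d} {S S' : Set (E d)}
    {F : ℝ → E d → E d} (h : IsLinSolution T v Dμ w μ Φ F₀ S F) (hS : S' ⊆ S) :
    IsLinSolution T v Dμ w μ Φ F₀ S' F :=
  ⟨h.cont.mono (prod_mono le_rfl hS), fun x hx => h.integrable x (hS hx),
    fun t ht x hx => h.eqn t ht x (hS hx)⟩

/-- Uniqueness for the linearised problem on sets containing a ball which carries the curve. -/
lemma IsLinSolution.unique (hT : 0 < T) (hp : 1 ≤ p) {v : ℝ → Pc d → E d → E d}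
    {Dμ : ℝ → Pc d → E d → E d → E d →L[ℝ] E d} (hv : HypH p T v Dμ) {μ₀ : Pc d} {μ : ℝ → Pc d}
    (hμ : IsSolution p T v μ₀.meas μ) (hμ₀ : μ₀.InBall R)
    (hu : CaraField T (fun t x => v t (μ t) x)) {w : ℝ → E d → E d}
    {Φ : ℝ → ℝ → E d → E d} (hΦ : IsNonlocalFlow T v μ Φ) {F₀ : E d → E d} {S : Set (E d)}
    (hS : Metric.closedBall 0 R ⊆ S) {F F' : ℝ → E d → E d}
    (hF : IsLinSolution T v Dμ w μ Φ F₀ S F) (hF' : IsLinSolution T v Dμ w μ Φ F₀ S F')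
    {t : ℝ} (ht : t ∈ Icc 0 T) {x : E d} (hx : x ∈ S) : F t x = F' t x := by
  have m0 : (0 : ℝ) ∈ Icc 0 T := left_mem_Icc.2 hT.le
  have hR0 : 0 ≤ R := hμ₀.nonneg
  have hμ0 : μ 0 = μ₀ := Pc.ext_meas hμ.init
  obtain ⟨X, hX, hμX, hXΦ⟩ := hμ.exists_lagrangian hT hp hv.ce hμ₀ hu hΦ (ρ := R + 1)
    (by linarith) (by linarith)
  have hρ : 0 < R + 1 := by linarith
  -- Solutions are continuous only on S. Precomposition with a retraction onto the small ball gives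
  -- maps continuous on the whole space, unchanged μ₀-almost everywhere, to which the derivative
  -- formulas apply.
  obtain ⟨r, hr, hr'⟩ := exists_retraction (d := d) hR0
  have hslice : ∀ {F : ℝ → E d → E d}, IsLinSolution T v Dμ w μ Φ F₀ S F → ∀ t ∈ Icc 0 T,
      Continuous fun y => F t (r y) := fun h t ht =>
    continuousOn_univ.1 (h.cont.comp
      ((continuous_const.prodMk r.continuous).continuousOn (s := univ))
      fun y _ => ⟨ht, hS (by simpa using hr y)⟩)
  -- the estimate of the difference at a given point
  have est : ∀ B > 0, (∀ t ∈ Icc 0 T, ‖X t‖ ≤ B) → ∃ l, L1Nonneg T l ∧ ∀ᵐ t ∂leb T,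
      ∀ y ∈ S, ‖Φ 0 t y‖ ≤ B → ∀ N, (∀ z, ‖z‖ ≤ R → ‖F t z - F' t z‖ ≤ N) →
        ‖linRHS v Dμ w μ Φ F t y - linRHS v Dμ w μ Φ F' t y‖ ≤ l t * (‖F t y - F' t y‖ + N) := by
    intro B hB0 hB
    obtain ⟨l, L, hl, hL, hlL⟩ := hv.ce.lipschitz (B + 1) (by linarith)
    refine ⟨_, hl.add hL, ?_⟩
    filter_upwards [hlL, hv.ae_diffField, ae_leb_mem] with t h1 h2 htm y hy hyB N hN
    have hN0 : 0 ≤ N := (norm_nonneg _).trans (hN 0 (by simpa using hR0))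
    have hμB : (μ t).InBall (B + 1) := by
      rw [hμX t htm]
      exact push_extend_inBall hρ μ₀ ((hB t htm).trans (by linarith))
    have hyB' : Φ 0 t y ∈ Metric.closedBall (0 : E d) (B + 1) := by
      simp only [mem_closedBall_zero_iff]; linarith
    have b1 : ‖fderiv ℝ (v t (μ t)) (Φ 0 t y)‖ ≤ l t := by
      refine norm_fderiv_le_of_lipschitzOn ℝ (C := ⟨l t, hl.1 t⟩)
        (s := Metric.closedBall 0 (B + 1)) (Metric.closedBall_mem_nhds_of_mem ?_)
        (LipschitzOnWith.of_dist_le_mul fun a ha b hb => ?_)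
      · simp only [mem_ball_zero_iff]; linarith
      · rw [dist_eq_norm, dist_eq_norm]
        exact (h1 _ _ hμB hμB a ha b hb).1
    let Z : C(E d, E d) := ⟨fun y => F t (r y) - F' t (r y),
      (hslice hF t htm).sub (hslice hF' t htm)⟩
    let A : C(E d, E d) := ⟨fun y => F t (r y), hslice hF t htm⟩
    let A' : C(E d, E d) := ⟨fun y => F' t (r y), hslice hF' t htm⟩
    have hd := h2.diff_μ (μ t) (Φ 0 t y)
    rw [hμX t htm] at hd
    have hfX : ∀ᵐ z ∂μ₀.meas, ‖z‖ ≤ R ∧ extend hρ (X t) z = Φ 0 t z ∧ r z = z := by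
      filter_upwards [hμ₀.ae_norm_le] with z hz
      refine ⟨hz, ?_, hr' z hz⟩
      rw [extend_of_norm_le hρ _ (by linarith), hXΦ t htm]
    have conv : ∀ (F : ℝ → E d → E d) (A : C(E d, E d)), (∀ y, A y = F t (r y)) →
        ∫ z, Dμ t (μ t) (Φ 0 t y) (Φ 0 t z) (F t z) ∂(μ 0).meas
          = ∫ z, Dμ t (μ₀.push (extend hρ (X t))) (Φ 0 t y) (extend hρ (X t) z) (A z) ∂μ₀.meas := by
      intro F A hA
      rw [hμ0, ← hμX t htm]
      refine integral_congr_ae (hfX.mono fun z hz => ?_)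
      simp only [hz.2.1, hA, hz.2.2]
    have b2 : ‖∫ z, Dμ t (μ t) (Φ 0 t y) (Φ 0 t z) (F t z) ∂(μ 0).meas
        - ∫ z, Dμ t (μ t) (Φ 0 t y) (Φ 0 t z) (F' t z) ∂(μ 0).meas‖ ≤ L t * N := by
      rw [conv F A fun _ => rfl, conv F' A' fun _ => rfl, ← integral_sub
        (integrable_differential_comp hd A).1 (integrable_differential_comp hd A').1]
      simp only [← map_sub]
      refine norm_integral_differential_le hp (F := Z) hd (r := B + 1) (hL.1 t)
        (fun μ ν hμ hν => (h1 μ ν hμ hν _ hyB' _ hyB').2)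
        (.of_forall fun z => ?_) (.of_forall fun z => hN _ (hr z))
      have := (norm_extend_le hρ (X t) z).trans (hB t htm)
      linarith
    have e : linRHS v Dμ w μ Φ F t y - linRHS v Dμ w μ Φ F' t y
        = fderiv ℝ (v t (μ t)) (Φ 0 t y) (F t y - F' t y)
          + (∫ z, Dμ t (μ t) (Φ 0 t y) (Φ 0 t z) (F t z) ∂(μ 0).meas
            - ∫ z, Dμ t (μ t) (Φ 0 t y) (Φ 0 t z) (F' t z) ∂(μ 0).meas) := by
      rw [linRHS, linRHS, map_sub]; abel
    rw [e]
    refine (norm_add_le _ _).trans ?_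
    have b3 := ((fderiv ℝ (v t (μ t)) (Φ 0 t y)).le_opNorm (F t y - F' t y)).trans
      (mul_le_mul_of_nonneg_right b1 (norm_nonneg _))
    have b4 := mul_nonneg (hL.1 t) (norm_nonneg (F t y - F' t y))
    have b5 := mul_nonneg (hl.1 t) hN0
    nlinarith
  have hdiff : ∀ y ∈ S, ∀ t ∈ Icc 0 T, F t y - F' t y
      = ∫ s in (0 : ℝ)..t, (linRHS v Dμ w μ Φ F s y - linRHS v Dμ w μ Φ F' s y) := by
    intro y hy t ht
    have i := fun {F : ℝ → E d → E d} (h : IsLinSolution T v Dμ w μ Φ F₀ S F) =>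
      intervalIntegrable_of_mem_Icc
        ((intervalIntegrable_iff_integrableOn_Icc_of_le hT.le).1 (h.integrable y hy)) m0 ht
    rw [intervalIntegral.integral_sub (i hF) (i hF'), hF.eqn t ht y hy, hF'.eqn t ht y hy]
    abel
  obtain ⟨B₁, hB₁0, hB₁⟩ := exists_norm_le_of_continuousOn hX.cont
  -- agreement on the ball
  have onball : ∀ t ∈ Icc 0 T, ∀ y, ‖y‖ ≤ R → F t y = F' t y := by
    let P : ℝ → C(Metric.closedBall (0 : E d) R, E d) := fun t =>
      ContinuousMap.mkD (fun y => F t y - F' t y) 0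
    have hPt : ∀ t ∈ Icc 0 T, ∀ y, P t y = F t y - F' t y := by
      intro t ht y
      refine ContinuousMap.mkD_apply_of_continuous (f := fun y : Metric.closedBall (0 : E d) R =>
        F t y - F' t y) ?_
      have c := fun {F : ℝ → E d → E d} (h : IsLinSolution T v Dμ w μ Φ F₀ S F) =>
        continuousOn_univ.1 (h.cont.comp
          ((continuous_const.prodMk continuous_subtype_val).continuousOn (s := univ))
          fun (y : Metric.closedBall (0 : E d) R) _ => (⟨ht, hS y.2⟩ : (t, (y : E d)) ∈ Icc 0 T ×ˢ S))
      exact (c hF).sub (c hF')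
    have hPc : ContinuousOn P (Icc 0 T) := by
      rw [continuousOn_iff_continuous_domRestrict]
      refine ContinuousMap.continuous_of_continuous_uncurry _ ?_
      have c := fun {F : ℝ → E d → E d} (h : IsLinSolution T v Dμ w μ Φ F₀ S F) =>
        continuousOn_univ.1 (h.cont.comp
          (f := fun z : Icc 0 T × Metric.closedBall (0 : E d) R => ((z.1 : ℝ), (z.2 : E d)))
          (by fun_prop : Continuous _).continuousOn (s := univ)
          fun z _ => ⟨z.1.2, hS z.2.2⟩)
      refine ((c hF).sub (c hF')).congr fun z => ?_
      exact (hPt _ z.1.2 z.2).symm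
    obtain ⟨l, hl, hl'⟩ := est B₁ hB₁0 hB₁
    have hz := fun t ht => gronwall_abs (a := 0) (r := 0) (u := fun t => ‖P t‖) (hl.const_mul
      (c := 2) two_pos.le) m0 hPc.norm (fun _ _ => norm_nonneg _) (fun t ht => ?_) (t := t) ht
    · intro t ht y hy
      have h1 := hz t ht
      simp only [mul_zero, zero_mul] at h1
      have h2 := (P t).norm_coe_le_norm ⟨y, by simpa using hy⟩
      rw [hPt t ht] at h2
      exact sub_eq_zero.1 (norm_le_zero_iff.1 (h2.trans h1))
    · rw [zero_add]
      refine (ContinuousMap.norm_le _ (abs_nonneg _)).2 fun y => ?_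
      rw [hPt t ht, hdiff y (hS y.2) t ht]
      refine norm_integral_le_of_ae_leb (IntegrableOn.mul_continuousOn (hl.const_mul (c := 2)
        two_pos.le).2 hPc.norm isCompact_Icc) ?_ m0 ht
      filter_upwards [hl', ae_leb_mem] with s h1 hs
      have hyR : ‖(y : E d)‖ ≤ R := mem_closedBall_zero_iff.1 y.2
      have hbd : ∀ z, ‖z‖ ≤ R → ‖F s z - F' s z‖ ≤ ‖P s‖ := fun z hz => by
        rw [← hPt s hs ⟨z, by simpa using hz⟩]
        exact (P s).norm_coe_le_norm _
      have hyB : ‖Φ 0 s y‖ ≤ B₁ := by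
        have := ((X s).norm_coe_le_norm ⟨y, by simp only [mem_closedBall_zero_iff]; linarith⟩).trans
          (hB₁ s hs)
        rwa [hXΦ s hs] at this
      refine (h1 y (hS y.2) hyB _ hbd).trans ?_
      have := mul_le_mul_of_nonneg_left (hbd y hyR) (hl.1 s)
      linarith
  -- agreement at the point
  obtain ⟨B₂, hB₂0, hB₂⟩ := exists_norm_le_of_continuousOn (hΦ.isCaraSol m0 x).cont
  obtain ⟨l, hl, hl'⟩ := est (max B₁ B₂) (lt_max_of_lt_left hB₁0)
    fun t ht => (hB₁ t ht).trans (le_max_left _ _)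
  have hcx := fun {F : ℝ → E d → E d} (h : IsLinSolution T v Dμ w μ Φ F₀ S F) =>
    h.cont.comp (f := fun t : ℝ => (t, x)) (s := Icc 0 T) (by fun_prop) fun t ht => ⟨ht, hx⟩
  have hz := gronwall_abs (a := 0) (r := 0) (u := fun t => ‖F t x - F' t x‖) hl m0
    ((hcx hF).sub (hcx hF')).norm (fun _ _ => norm_nonneg _) (fun t ht => ?_) ht
  · simp only [mul_zero, zero_mul] at hz
    exact sub_eq_zero.1 (norm_le_zero_iff.1 hz)
  · rw [zero_add, hdiff x hx t ht]
    refine norm_integral_le_of_ae_leb (IntegrableOn.mul_continuousOn hl.2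
      ((hcx hF).sub (hcx hF')).norm isCompact_Icc) ?_ m0 ht
    filter_upwards [hl', ae_leb_mem] with s h1 hs
    -- Agreement on the ball allows N = 0: the non-local term cancels and a linear estimate at the
    -- single point x remains.
    have := h1 x hx ((hB₂ s hs).trans (le_max_right _ _)) 0 fun z hz => by
      rw [onball s hs z hz, sub_self, norm_zero]
    rwa [add_zero] at this

end Linear

end WassLin

namespace WassLin

/-! ### Existence for the linearised problem. -/

section LinearExistence

variable {d : ℕ} {p T ρ R : ℝ}

/-- The derivative of the lifted field along a curve. -/
noncomputable def linField (v : ℝ → Pc d → E d → E d) (Dμ : ℝ → Pc d → E d → E d → E d →L[ℝ] E d)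
    (μ : Pc d) (hρ : 0 < ρ) (X : ℝ → BallMap d ρ) (t : ℝ) (Y : BallMap d ρ) : BallMap d ρ :=
  ContinuousMap.mkD (liftDeriv (v t) (Dμ t) μ hρ (X t) Y) 0

lemma HypH.ae_hasDerivAt (hp : 1 ≤ p) {v : ℝ → Pc d → E d → E d}
    {Dμ : ℝ → Pc d → E d → E d → E d →L[ℝ] E d} (hv : HypH p T v Dμ) (μ : Pc d) (hρ : 0 < ρ)
    (X : ℝ → BallMap d ρ) : ∀ᵐ t ∂leb T, ∀ Y,
      HasDerivAt (fun h : ℝ => liftField v μ hρ t (X t + h • Y)) (linField v Dμ μ hρ X t Y) 0 := by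
  filter_upwards [hv.ae_diffField] with t ht Y
  exact (ht.hasDerivAt_lift hp μ hρ (X t) Y).2

lemma continuousOn_extend_uncurry (hρ : 0 < ρ) {Y : ℝ → BallMap d ρ}
    (hY : ContinuousOn Y (Icc 0 T)) (S : Set (E d)) :
    ContinuousOn (fun z : ℝ × E d => extend hρ (Y z.1) z.2) (Icc 0 T ×ˢ S) := by
  have h1 : ContinuousOn (fun z : ℝ × E d => (Y z.1, toBall hρ z.2)) (Icc 0 T ×ˢ S) :=
    (hY.comp continuousOn_fst fun z hz => hz.1).prodMk
      ((toBall hρ).continuous.comp continuous_snd).continuousOn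
  exact continuous_eval.comp_continuousOn h1

/-- Existence for the linearised problem on a ball. -/
lemma exists_isLinSolution_ball (hT : 0 < T) (hp : 1 ≤ p) {v : ℝ → Pc d → E d → E d}
    {Dμ : ℝ → Pc d → E d → E d → E d →L[ℝ] E d} (hv : HypH p T v Dμ) {μ₀ : Pc d} {μ : ℝ → Pc d}
    (hμ : IsSolution p T v μ₀.meas μ) (hμ₀ : μ₀.InBall R) {w : ℝ → E d → E d}
    (hw : CaraField T w) {Φ : ℝ → ℝ → E d → E d} (hρ : 0 < ρ) (hRρ : R ≤ ρ)
    {X : ℝ → BallMap d ρ} (hXc : ContinuousOn X (Icc 0 T))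
    (hμX : ∀ t ∈ Icc 0 T, μ t = μ₀.push (extend hρ (X t)))
    (hXΦ : ∀ t ∈ Icc 0 T, ∀ x : Metric.closedBall (0 : E d) ρ, X t x = Φ 0 t x)
    (F₀ : C(E d, E d)) :
    ∃ Y : ℝ → BallMap d ρ,
      IsCaraSol T (fun t Y => linField v Dμ μ₀ hρ X t Y
        + liftField (fun t _ x => w t x) μ₀ hρ t (X t)) 0 (toBallMap ρ F₀) Y ∧
      IsLinSolution T v Dμ w μ Φ F₀ (Metric.closedBall 0 ρ) (fun t x => extend hρ (Y t) x) := by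
  have m0 : (0 : ℝ) ∈ Icc 0 T := left_mem_Icc.2 hT.le
  have mT : T ∈ Icc 0 T := right_mem_Icc.2 hT.le
  have hμ0 : μ 0 = μ₀ := Pc.ext_meas hμ.init
  have hw' := hw.hypCE p
  have hlin := (hv.ce.caraField_lift hp μ₀ hρ).linearized hXc (hv.ae_hasDerivAt hp μ₀ hρ X)
    ((hw'.caraField_lift hp μ₀ hρ).integrableOn_comp hXc)
  obtain ⟨Y, hY⟩ := hlin.exists_isCaraSol m0 (toBallMap ρ F₀)
  have hi := hlin.integrableOn_comp hY.cont
  -- Evaluated at a point, the derivative of the lifted field plus the source is exactly the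
  -- right-hand side of the linearised problem; null sets of times are harmless in integral form.
  have key : ∀ᵐ t ∂leb T, ∀ x : Metric.closedBall (0 : E d) ρ,
      (linField v Dμ μ₀ hρ X t (Y t) + liftField (fun t _ x => w t x) μ₀ hρ t (X t)) x
        = linRHS v Dμ w μ Φ (fun t x => extend hρ (Y t) x) t x := by
    filter_upwards [hv.ae_diffField, hw'.ae_continuous, ae_leb_mem] with t h1 h2 ht x
    have e1 : linField v Dμ μ₀ hρ X t (Y t) x = liftDeriv (v t) (Dμ t) μ₀ hρ (X t) (Y t) x :=
      ContinuousMap.mkD_apply_of_continuous (h1.hasDerivAt_lift hp μ₀ hρ (X t) (Y t)).1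
    have e2 : ∫ y, Dμ t (μ t) (Φ 0 t x) (Φ 0 t y) (extend hρ (Y t) y) ∂(μ 0).meas
        = ∫ y, Dμ t (μ t) (Φ 0 t x) (extend hρ (X t) y) (extend hρ (Y t) y) ∂μ₀.meas := by
      rw [hμ0]
      refine integral_congr_ae (hμ₀.ae_norm_le.mono fun y hy => ?_)
      simp only [extend_of_norm_le hρ (X t) (hy.trans hRρ), hXΦ t ht]
    rw [ContinuousMap.add_apply, e1, liftField_apply h2, liftDeriv, linRHS, e2, ← hμX t ht,
      hXΦ t ht, extend_coe]
    abel
  have hcongr : ∀ x : Metric.closedBall (0 : E d) ρ, ∀ t ∈ Icc 0 T,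
      (fun s => (linField v Dμ μ₀ hρ X s (Y s) + liftField (fun t _ x => w t x) μ₀ hρ s (X s)) x)
        =ᵐ[volume.restrict (uIoc 0 t)]
        fun s => linRHS v Dμ w μ Φ (fun t x => extend hρ (Y t) x) s x := fun x t ht =>
    (ae_restrict_uIoc_of_ae_leb key m0 ht).mono fun s hs => hs x
  refine ⟨Y, hY, continuousOn_extend_uncurry hρ hY.cont _, fun x hx => ?_, fun t ht x hx => ?_⟩
  · have i1 := intervalIntegrable_of_mem_Icc hi m0 mT
    have i2 : IntervalIntegrable (fun s => (linField v Dμ μ₀ hρ X s (Y s)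
        + liftField (fun t _ x => w t x) μ₀ hρ s (X s)) ⟨x, hx⟩) volume 0 T :=
      let L : BallMap d ρ →L[ℝ] E d :=
        ContinuousMap.evalCLM ℝ (⟨x, hx⟩ : Metric.closedBall (0 : E d) ρ)
      ⟨L.integrable_comp i1.1, L.integrable_comp i1.2⟩
    exact i2.congr_ae (hcongr ⟨x, hx⟩ T mT)
  · have i1 := intervalIntegrable_of_mem_Icc hi m0 ht
    change extend hρ (Y t) ((⟨x, hx⟩ : Metric.closedBall (0 : E d) ρ) : E d) = _
    rw [extend_coe, hY.eqn t ht, ContinuousMap.add_apply, intervalIntegral_apply i1,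
      intervalIntegral.integral_congr_ae_restrict (hcongr ⟨x, hx⟩ t ht)]
    rfl

/-- Existence for the linearised problem on the whole space. -/
lemma exists_isLinSolution (hT : 0 < T) (hp : 1 ≤ p) {v : ℝ → Pc d → E d → E d}
    {Dμ : ℝ → Pc d → E d → E d → E d →L[ℝ] E d} (hv : HypH p T v Dμ) {μ₀ : Pc d} {μ : ℝ → Pc d}
    (hμ : IsSolution p T v μ₀.meas μ) (hμ₀ : μ₀.InBall R)
    (hu : CaraField T (fun t x => v t (μ t) x)) {w : ℝ → E d → E d}
    (hw : CaraField T w) {Φ : ℝ → ℝ → E d → E d} (hΦ : IsNonlocalFlow T v μ Φ) (F₀ : C(E d, E d)) :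
    ∃ F : ℝ → E d → E d, IsLinSolution T v Dμ w μ Φ F₀ univ F := by
  have hR0 : 0 ≤ R := hμ₀.nonneg
  have hμ0 : (μ 0).InBall R := by rwa [Pc.ext_meas hμ.init]
  have ex : ∀ n : ℕ, ∃ F : ℝ → E d → E d,
      IsLinSolution T v Dμ w μ Φ F₀ (Metric.closedBall 0 (R + 1 + n)) F := by
    intro n
    have hρ : 0 < R + 1 + n := by positivity
    have hRρ : R ≤ R + 1 + n := by linarith [(Nat.cast_nonneg n : (0 : ℝ) ≤ n)]
    obtain ⟨X, hX, hμX, hXΦ⟩ := hμ.exists_lagrangian hT hp hv.ce hμ₀ hu hΦ hρ hRρ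
    obtain ⟨Y, -, hY⟩ := exists_isLinSolution_ball hT hp hv hμ hμ₀ hw hρ hRρ hX.cont hμX hXΦ F₀
    exact ⟨_, hY⟩
  choose G hG using ex
  -- The solutions on the balls of radius R + 1 + n are glued. They agree on overlaps by uniqueness,
  -- and their non-local terms coincide because every ball contains the one that carries the initial
  -- measure.
  set F : ℝ → E d → E d := fun t x => G ⌈‖x‖⌉₊ t x with hF
  have hFG : ∀ n : ℕ, ∀ t ∈ Icc 0 T, ∀ x, ‖x‖ ≤ R + 1 + n → F t x = G n t x := by
    have aux : ∀ n m : ℕ, n ≤ m → ∀ t ∈ Icc 0 T, ∀ x, ‖x‖ ≤ R + 1 + n → G n t x = G m t x := by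
      intro n m hnm t ht x hx
      have hn : (n : ℝ) ≤ m := by exact_mod_cast hnm
      have hn0 : (0 : ℝ) ≤ n := Nat.cast_nonneg n
      exact (hG n).unique hT hp hv hμ hμ₀ hu hΦ (Metric.closedBall_subset_closedBall (by linarith))
        ((hG m).mono (Metric.closedBall_subset_closedBall (by linarith))) ht (by simpa using hx)
    intro n t ht x hx
    have hx' : ‖x‖ ≤ R + 1 + (⌈‖x‖⌉₊ : ℝ) := by linarith [Nat.le_ceil ‖x‖]
    rcases le_total n ⌈‖x‖⌉₊ with h | h
    · exact (aux _ _ h t ht x hx).symm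
    · exact aux _ _ h t ht x hx'
  have hRHS : ∀ n : ℕ, ∀ t ∈ Icc 0 T, ∀ x, ‖x‖ ≤ R + 1 + n →
      linRHS v Dμ w μ Φ (G n) t x = linRHS v Dμ w μ Φ F t x := fun n t ht x hx =>
    linRHS_congr hμ0 (hFG n t ht x hx).symm fun y hy => (hFG n t ht y (by
      linarith [(Nat.cast_nonneg n : (0 : ℝ) ≤ n)])).symm
  have hmem : ∀ x : E d, ∃ n : ℕ, ‖x‖ < R + 1 + n := fun x => by
    obtain ⟨n, hn⟩ := exists_nat_gt ‖x‖
    exact ⟨n, by linarith⟩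
  have m0 : (0 : ℝ) ∈ Icc 0 T := left_mem_Icc.2 hT.le
  have mT : T ∈ Icc 0 T := right_mem_Icc.2 hT.le
  have hEq : ∀ n : ℕ, ∀ t ∈ Icc 0 T, ∀ x, ‖x‖ ≤ R + 1 + n → EqOn
      (fun s => linRHS v Dμ w μ Φ (G n) s x) (fun s => linRHS v Dμ w μ Φ F s x) (uIcc 0 t) :=
    fun n t ht x hx s hs =>
      hRHS n s ((convex_Icc (0 : ℝ) T).ordConnected.uIcc_subset m0 ht hs) x hx
  refine ⟨F, ?_, fun x _ => ?_, fun t ht x _ => ?_⟩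
  · rintro ⟨t, x⟩ ⟨ht, -⟩
    obtain ⟨n, hn⟩ := hmem x
    have h1 := (hG n).cont (t, x) ⟨ht, by simpa using hn.le⟩
    have hnb : Icc 0 T ×ˢ Metric.closedBall (0 : E d) (R + 1 + n)
        ∈ 𝓝[Icc 0 T ×ˢ univ] (t, x) := by
      have : (univ : Set ℝ) ×ˢ Metric.closedBall (0 : E d) (R + 1 + n) ∈ 𝓝 (t, x) :=
        prod_mem_nhds univ_mem (Metric.closedBall_mem_nhds_of_mem (by simpa using hn))
      filter_upwards [mem_nhdsWithin_of_mem_nhds this, self_mem_nhdsWithin] with z h2 h3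
      exact ⟨h3.1, h2.2⟩
    refine ContinuousWithinAt.mono_of_mem_nhdsWithin ?_ hnb
    refine h1.congr (fun z hz => hFG n z.1 hz.1 z.2 (by simpa using hz.2))
      (hFG n t ht x hn.le)
  · obtain ⟨n, hn⟩ := hmem x
    refine ((hG n).integrable x (by simpa using hn.le)).congr (fun s hs => ?_)
    exact hEq n T mT x hn.le (uIoc_subset_uIcc hs)
  · obtain ⟨n, hn⟩ := hmem x
    rw [hFG n t ht x hn.le, (hG n).eqn t ht x (by simpa using hn.le),
      intervalIntegral.integral_congr (hEq n t ht x hn.le)]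

end LinearExistence

/-! ### The lift of the perturbed field. -/

section Perturbation

variable {d : ℕ} {p T ρ R : ℝ}

/-- Additivity is only claimed for almost every time: where v or w is not continuous in space, the
default value in the lift may destroy it. -/
lemma liftField_add_smul {v : ℝ → Pc d → E d → E d} {w : ℝ → E d → E d} (hv : HypCE p T v)
    (hw : CaraField T w) (μ : Pc d) (hρ : 0 < ρ) (ε : ℝ) : ∀ᵐ t ∂leb T, ∀ Y,
      liftField (fun t ν x => v t ν x + ε • w t x) μ hρ t Y
        = liftField v μ hρ t Y + ε • liftField (fun t _ x => w t x) μ hρ t Y := by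
  filter_upwards [hv.ae_continuous, hw.ae_continuous] with t h1 h2 Y
  ext1 x
  rw [liftField_apply (fun ν => (h1 ν).add (h2.const_smul ε)), ContinuousMap.add_apply,
    ContinuousMap.smul_apply, liftField_apply h1, liftField_apply fun _ => h2]

lemma IsCaraSol.congr_ae {B : Type*} [NormedAddCommGroup B] [NormedSpace ℝ B] {f g : ℝ → B → B}
    {r : ℝ} {x₀ : B} {X : ℝ → B} (hX : IsCaraSol T f r x₀ X) (hr : r ∈ Icc 0 T)
    (h : ∀ᵐ t ∂leb T, ∀ x, f t x = g t x) : IsCaraSol T g r x₀ X := by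
  refine ⟨hX.cont, fun t ht => ?_⟩
  rw [hX.eqn t ht]
  congr 1
  exact intervalIntegral.integral_congr_ae_restrict
    ((ae_restrict_uIoc_of_ae_leb h hr ht).mono fun s hs => hs _)

end Perturbation

end WassLin

end

/-! ### Assembly of the conclusions. -/

theorem proposition3p7 {d : ℕ} (p T : ℝ) (hp : 1 ≤ p) (hT : 0 < T)
    (v : ℝ → WassLin.Pc d → WassLin.E d → WassLin.E d)
    (Dμ : ℝ → WassLin.Pc d → WassLin.E d → WassLin.E d → WassLin.E d →L[ℝ] WassLin.E d)
    (hv : WassLin.HypH p T v Dμ)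
    (μ₀ : WassLin.Pc d) (μ : ℝ → WassLin.Pc d) (hμ : WassLin.IsSolution p T v μ₀.meas μ)
    (R : ℝ) (hR : ∀ t ∈ Set.Icc 0 T, (μ t).InBall R)
    (F₀ : WassLin.E d → WassLin.E d) (hF₀ : Continuous F₀)
    (w : ℝ → WassLin.E d → WassLin.E d) (hw : WassLin.HypCELocal T w) :
    -- the non-local flow along the curve exists and is unique
    ∃ Φ : ℝ → ℝ → WassLin.E d → WassLin.E d, WassLin.IsNonlocalFlow T v μ Φ ∧
      (∀ Φ', WassLin.IsNonlocalFlow T v μ Φ' →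
        ∀ s ∈ Set.Icc 0 T, ∀ t ∈ Set.Icc 0 T, ∀ x, Φ' s t x = Φ s t x) ∧
    -- the linearised problem has a unique solution
    ∃ F : ℝ → WassLin.E d → WassLin.E d,
      WassLin.IsLinSolution T v Dμ w μ Φ F₀ Set.univ F ∧
      (∀ S : Set (WassLin.E d), Metric.closedBall 0 R ⊆ S → ∀ F' : ℝ → WassLin.E d → WassLin.E d,
        WassLin.IsLinSolution T v Dμ w μ Φ F₀ S F' →
        ∀ t ∈ Set.Icc 0 T, ∀ x ∈ S, F' t x = F t x) ∧
    ∃ G : ℝ → ℝ → WassLin.E d → WassLin.E d,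
      (∀ ε ∈ Set.Icc (-1 : ℝ) 1,
        ContinuousOn (fun z : ℝ × WassLin.E d => G ε z.1 z.2)
          (Set.Icc 0 T ×ˢ Metric.closedBall 0 R) ∧
        -- the perturbed problem has a unique solution, given by the push-forward
        ∃ με : ℝ → WassLin.Pc d,
          WassLin.IsSolution p T (fun t ν x => v t ν x + ε • w t x)
            (μ₀.meas.map (fun x => x + ε • F₀ x)) με ∧
          (∀ ν : ℝ → WassLin.Pc d,
            WassLin.IsSolution p T (fun t ν x => v t ν x + ε • w t x)
              (μ₀.meas.map (fun x => x + ε • F₀ x)) ν → ∀ t ∈ Set.Icc 0 T, ν t = με t) ∧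
          ∀ t ∈ Set.Icc 0 T, (με t).meas = (μ t).meas.map (G ε t)) ∧
      -- first-order expansion, uniformly in time and space
      ∀ δ > 0, ∃ η > 0, ∀ ε ∈ Set.Icc (-1 : ℝ) 1, |ε| < η →
        ∀ t ∈ Set.Icc 0 T, ∀ x ∈ Metric.closedBall (0 : WassLin.E d) R,
          ‖G ε t x - (x + ε • F t (Φ t 0 x))‖ ≤ δ * |ε| := by
  open WassLin MeasureTheory Set in
  have m0 : (0 : ℝ) ∈ Icc 0 T := left_mem_Icc.2 hT.le
  have hμ0 : μ 0 = μ₀ := Pc.ext_meas hμ.init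
  have hμ₀ : μ₀.InBall R := hμ0 ▸ hR 0 m0
  have hR0 : 0 ≤ R := hμ₀.nonneg
  have hw' : CaraField T w := hw.caraField
  have hu : CaraField T (fun t x => v t (μ t) x) :=
    hv.ce.caraField_frozen hR fun t ht => hμ.ac.tendsto_wass ht
  obtain ⟨Φ, hΦ, hΦu⟩ := exists_isNonlocalFlow hu
  refine ⟨Φ, hΦ, hΦu, ?_⟩
  let F₀' : C(E d, E d) := ⟨F₀, hF₀⟩
  obtain ⟨F, hF⟩ := exists_isLinSolution hT hp hv hμ hμ₀ hu hw' hΦ F₀'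
  refine ⟨F, hF, fun S hS F' hF' t ht x hx =>
    hF'.unique hT hp hv hμ hμ₀ hu hΦ hS (hF.mono (subset_univ S)) ht hx, ?_⟩
  obtain ⟨B, hB0, hB⟩ := hΦ.exists_bound hu R
  -- B bounds all flow maps on the ball of radius R, so the labels Φ(t, 0, x) of points x of that
  -- ball lie where the Lagrangian maps are genuine and not extended by retraction.
  have hρ : 0 < max R B := lt_max_of_lt_right hB0
  obtain ⟨X, hX, hμX, hXΦ⟩ := hμ.exists_lagrangian hT hp hv.ce hμ₀ hu hΦ hρ (le_max_left R B)
  obtain ⟨Y, hY, hYF⟩ := exists_isLinSolution_ball hT hp hv hμ hμ₀ hw' hρ (le_max_left R B)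
    hX.cont hμX hXΦ F₀'
  have hlift := hv.ce.caraField_lift hp μ₀ hρ
  have hliftw := (hw'.hypCE p).caraField_lift hp μ₀ hρ
  set I : BallMap d (max R B) := toBallMap _ (ContinuousMap.id _) with hI
  set Y₀ : BallMap d (max R B) := toBallMap _ F₀' with hY₀
  choose Xε hXε using fun ε : ℝ =>
    (hlift.add (hliftw.const_smul ε)).exists_isCaraSol m0 (I + ε • Y₀)
  have hback : ∀ t ∈ Icc 0 T, ∀ x, ‖x‖ ≤ R → ‖Φ t 0 x‖ ≤ max R B := fun t ht x hx =>
    (hB t ht 0 m0 x hx).trans (le_max_right _ _)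
  have hvε := fun ε : ℝ => hv.ce.add_local (hw'.const_smul ε)
  have hXε' := fun ε : ℝ => (hXε ε).congr_ae m0
    ((liftField_add_smul hv.ce hw' μ₀ hρ ε).mono fun t h Y => (h Y).symm)
  have hinit : ∀ ε : ℝ, (μ₀.push (extend hρ (I + ε • Y₀))).meas
      = μ₀.meas.map (fun x => x + ε • F₀ x) := fun ε =>
    Measure.map_congr (hμ₀.ae_norm_le.mono fun x hx => by
      have hx' : ‖x‖ ≤ max R B := hx.trans (le_max_left _ _)
      rw [extend_of_norm_le hρ _ hx']; rfl)
  -- The point x is pulled back to its label at time 0 and then carried by the perturbed Lagrangian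
  -- solution.
  refine ⟨fun ε t x => extend hρ (Xε ε t) (Φ t 0 x), fun ε hε => ⟨?_,
    fun t => μ₀.push (extend hρ (Xε ε t)), ?_, ?_, ?_⟩, fun δ hδ => ?_⟩
  · exact (continuousOn_extend_uncurry hρ (hXε ε).cont univ).comp
      (continuousOn_fst.prodMk ((hΦ.continuousOn_initial hu m0).mono
        (prod_mono le_rfl (subset_univ _)))) fun z hz => ⟨hz.1, mem_univ _⟩
  · rw [← hinit ε]
    exact (hXε' ε).isSolution hT hp (hvε ε)
  · intro ν hν t ht
    rw [← hinit ε] at hν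
    exact hν.eq_push hT hp (hvε ε) (hXε' ε) ht
  · intro t ht
    have hc : Continuous fun x => extend hρ (Xε ε t) (Φ t 0 x) :=
      (extend hρ (Xε ε t)).continuous.comp (hΦ.continuous hu ht m0)
    rw [hμX t ht, Pc.meas_push, Pc.meas_push, Measure.map_map hc.measurable
      (extend hρ (X t)).continuous.measurable]
    refine Measure.map_congr (hμ₀.ae_norm_le.mono fun x hx => ?_)
    have hx' : ‖x‖ ≤ max R B := hx.trans (le_max_left _ _)
    simp only [Function.comp_apply]
    rw [extend_of_norm_le hρ (X t) hx', hXΦ t ht, hΦ.comp hu m0 ht m0, hΦ.self m0]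
  · obtain ⟨η, hη, H⟩ := hlift.first_order hT.le hliftw hX (hv.ae_hasDerivAt hp μ₀ hρ X) hY
      (fun ε _ => hXε ε) hδ
    refine ⟨η, hη, fun ε hε hεη t ht x hx => ?_⟩
    have hz := hback t ht x (by simpa using hx)
    have e1 : X t ⟨Φ t 0 x, by simpa using hz⟩ = x := by
      rw [hXΦ t ht, hΦ.comp hu ht m0 ht, hΦ.self ht]
    -- The linear ODE on the larger ball and the global solution agree there by uniqueness on sets
    -- containing the ball of radius R.
    have e2 : Y t ⟨Φ t 0 x, by simpa using hz⟩ = F t (Φ t 0 x) := by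
      have := hYF.unique hT hp hv hμ hμ₀ hu hΦ
        (Metric.closedBall_subset_closedBall (le_max_left R B)) (hF.mono (subset_univ _)) ht
        (x := Φ t 0 x) (by simpa using hz)
      rwa [extend_of_norm_le hρ _ hz] at this
    have := ((Xε ε t - (X t + ε • Y t)).norm_coe_le_norm ⟨Φ t 0 x, by simpa using hz⟩).trans
      (H ε hε hεη t ht)
    rw [ContinuousMap.sub_apply, ContinuousMap.add_apply, ContinuousMap.smul_apply, e1, e2] at this
    simp only [extend_of_norm_le hρ _ hz]
    exact this
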